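/- Let $M$ be a compact connected smooth manifold with a smooth foliation $\mathcal F$ of codimension $q$ and normal bundle $\mathcal N=TM/T\mathcal F$. A holonomy map is a diffeomorphism between transversals obtained by sliding points along leaves; for a path $c$ from $x$ to $y$ contained in a leaf, the infinitesimal holonomy $h_c:\mathcal N_x\to\mathcal N_y$ is the differential at $x$ of a holonomy map along $c$. A transverse similarity structure on $(M,\mathcal F)$ is an open covering $(U_i)_{i\in I}$ of $M$ together with smooth transverse Riemannian metrics $g_i$ (bundle metrics on $\mathcal N|_{U_i}$) such that for all $i,j$ one has $g_i=\lambda_{ij}g_j$ on $U_i\cap U_j$ for a constant $\lambda_{ij}>0$. It is holonomy-invariant if for every holonomy map $\gamma:T\to T'$ from a connected transversal $T\subset U_i$ to a transversal $T'\subset U_j$ there is a constant $\lambda>0$ with $\gamma^*(g_j|_{T'})=\lambda\, g_i|_T$. Suppose such a structure is given. Its transverse curvature $R$ (a section of $\mathcal N^{*\otimes 3}\otimes\mathcal N$) is the curvature of the transverse connection induced on transversals by the Levi-Civita connections of the $g_i$. Let $g$ be any smooth Riemannian metric on $\mathcal N$ which at each point $x\in U_i$ is a positive multiple (depending on $x$)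 of $g_i$, and let $w:M\to\mathbb R_{\ge 0}$, $w(x)=\|R_x\|_g$. Let $k$ be any auxiliary smooth Riemannian metric on $\mathcal N$, with norm $\|\cdot\|$, and let $\mathcal E$ be the bi-equicontinuity domain: the set of $x\in M$ for which there is $\delta>1$ such that $\|u\|/\delta\le\|h_c(u)\|\le\delta\|u\|$ for every path $c$ starting at $x$ and contained in the leaf of $x$, and every $u\in\mathcal N_x$. Then $\{x\in M:\ w(x)\ne 0\}\subset\mathcal E$. Consequently, if $\mathcal E=\emptyset$, the structure is transversely flat: $R$ vanishes identically, and the structure is transversely modelled on $(\mathrm{Sim}(\mathbb R^q),\mathbb R^q)$, i.e. $M$ is covered by open sets $V$ carrying submersions $f:V\to\mathbb R^q$ which define $\mathcal F$, which differ locally by similarities of $\mathbb R^q$, and for which each $g_i$ is locally a constant positive multiple of the pull-back by $f$ of the Euclidean metric. -/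

import Mathlib

open scoped Manifold ContDiff Topology
open Set

/-- Euclidean space of dimension `q`. -/
abbrev Euc (q : ℕ) : Type := EuclideanSpace ℝ (Fin q)

/-! ### Riemannian geometry on an open subset of a Euclidean space -/

/-- A field of bilinear forms on (an open part of) `Euc q`. -/
abbrev FormField (q : ℕ) : Type := Euc q → (Euc q →L[ℝ] Euc q →L[ℝ] ℝ)

/-- The linear form
`a ↦ (1/2) (D_u G (v, a) + D_v G (u, a) - D_a G (u, v))` at `z`
(the Koszul formula for constant vector fields). -/
noncomputable def koszulForm {q : ℕ} (G : FormField q) (z u v : Euc q) : Euc q →L[ℝ] ℝ :=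
  (1 / 2 : ℝ) • (fderiv ℝ G z u v + fderiv ℝ G z v u - ((fderiv ℝ G z).flip u).flip v)

/-- The Christoffel map of the Levi-Civita connection of the metric `G`: the vector `Γ_z(u, v)` with
`G_z (Γ_z(u, v), a) = koszulForm G z u v a` for all `a`, so that
`(∇_X Y)(z) = D_X Y (z) + Γ_z (X z, Y z)`. -/
noncomputable def christoffel {q : ℕ} (G : FormField q) (z u v : Euc q) : Euc q :=
  (G z).inverse (koszulForm G z u v)

/-- The Riemann curvature tensor `R(u, v) w = ∇_u ∇_v w - ∇_v ∇_u w - ∇_[u,v] w` of the Levi-Civita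
connection of `G`, at the point `z`. -/
noncomputable def riemannTensor {q : ℕ} (G : FormField q) (z u v w : Euc q) : Euc q :=
  fderiv ℝ (fun y => christoffel G y v w) z u - fderiv ℝ (fun y => christoffel G y u w) z v
    + christoffel G z u (christoffel G z v w) - christoffel G z v (christoffel G z u w)

/-- The norm of a `(1, 3)`-tensor `R` with respect to the scalar product `g`: the maximum of
`|R(u, v) w|_g` over all `u, v, w` of `g`-norm at most one. -/
noncomputable def tensorNorm {q : ℕ} (g : Euc q →L[ℝ] Euc q →L[ℝ] ℝ)
    (R : Euc q → Euc q → Euc q → Euc q) : ℝ :=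
  sSup {r : ℝ | ∃ u v w : Euc q, g u u ≤ 1 ∧ g v v ≤ 1 ∧ g w w ≤ 1 ∧
    r = Real.sqrt (g (R u v w) (R u v w))}

/-- `s` is a similarity of the Euclidean space `Euc q`, i.e. an element of `Sim(ℝ^q)`. -/
def IsEuclideanSimilarity {q : ℕ} (s : Euc q → Euc q) : Prop :=
  ∃ (r : ℝ) (L : Euc q ≃ₗᵢ[ℝ] Euc q) (b : Euc q), 0 < r ∧ ∀ z, s z = r • L z + b

/-! ### Foliations, leafwise paths, transversals and holonomy -/

/-- A smooth foliation with leaves of dimension `p` and of codimension `q` on the manifold `M`, given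
by an atlas of smooth foliated charts `φ` with values in `ℝ^p × ℝ^q`: the plaques of `φ` are (locally)
the level sets of the second component of `φ`, and two charts have the same plaques locally. -/
structure Foliation (n p q : ℕ) (M : Type*) [TopologicalSpace M] [ChartedSpace (Euc n) M] where
  atlas : Set (OpenPartialHomeomorph M (Euc p × Euc q))
  exists_chart : ∀ x : M, ∃ φ ∈ atlas, x ∈ φ.source
  smooth_chart : ∀ φ ∈ atlas, ContMDiffOn (𝓡 n) 𝓘(ℝ, Euc p × Euc q) ∞ φ φ.source
  smooth_chart_symm : ∀ φ ∈ atlas, ContMDiffOn 𝓘(ℝ, Euc p × Euc q) (𝓡 n) ∞ φ.symm φ.target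
  plaques : ∀ φ ∈ atlas, ∀ ψ ∈ atlas, ∀ x ∈ φ.source ∩ ψ.source,
    ∃ V ∈ 𝓝 x, ∀ y ∈ V, ∀ z ∈ V, (φ y).2 = (φ z).2 → (ψ y).2 = (ψ z).2

namespace Foliation

variable {n p q : ℕ} {M : Type*} [TopologicalSpace M] [ChartedSpace (Euc n) M]

/-- The tangent space `T_x F` of the leaf through `x`: the kernel of the differential of the
transverse component of the foliated charts at `x`. -/
noncomputable def leafTangent (F : Foliation n p q M) (x : M) :
    Submodule ℝ (TangentSpace (𝓡 n) x) :=
  ⨅ φ ∈ F.atlas, ⨅ _ : x ∈ φ.source,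
    LinearMap.ker (mfderiv (𝓡 n) 𝓘(ℝ, Euc q) (fun y => (φ y).2) x).toLinearMap

/-- `c` is a path contained in a leaf (continuous for the topology of the leaf): it is continuous and
the transverse component of every foliated chart is locally constant along it. -/
def IsLeafwisePath (F : Foliation n p q M) (c : unitInterval → M) : Prop :=
  Continuous c ∧ ∀ t, ∀ φ ∈ F.atlas, c t ∈ φ.source → ∀ᶠ s in 𝓝 t, (φ (c s)).2 = (φ (c t)).2

/-- `σ` parametrizes over the open set `D` of `ℝ^q` an embedded transversal of the foliation. -/
structure IsTransversal (F : Foliation n p q M) (D : Set (Euc q)) (σ : Euc q → M) : Prop where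
  isOpen : IsOpen D
  smooth : ContMDiffOn 𝓘(ℝ, Euc q) (𝓡 n) ∞ σ D
  embedding : Topology.IsEmbedding (D.domRestrict σ)
  transverse : ∀ z ∈ D, IsCompl
    (LinearMap.range (mfderiv 𝓘(ℝ, Euc q) (𝓡 n) σ z).toLinearMap) (F.leafTangent (σ z))

/-- The map `γ = τ ∘ σ⁻¹` from the transversal `σ(D)` to the transversal `τ(D)` is a holonomy map of
the foliation: it is obtained by sliding the points `σ z` along leaves until they reach `τ z`. The
leafwise path followed by `σ z` is `t ↦ H (t, z)`, and it depends continuously on `z`. Every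
diffeomorphism between parametrizable transversals is of the form `τ ∘ σ⁻¹` for parametrizations with
the same domain. -/
structure IsHolonomy (F : Foliation n p q M) (D : Set (Euc q)) (σ τ : Euc q → M)
    (H : unitInterval × Euc q → M) : Prop where
  source : F.IsTransversal D σ
  target : F.IsTransversal D τ
  continuousOn : ContinuousOn H (univ ×ˢ D)
  start : ∀ z ∈ D, H (0, z) = σ z
  finish : ∀ z ∈ D, H (1, z) = τ z
  leafwise : ∀ z ∈ D, F.IsLeafwisePath (fun t => H (t, z))

/-- A transverse metric on `(U, F|_U)`: a smooth Riemannian metric on the normal bundle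
`N = TM / TF` over `U`. It is written as the induced degenerate metric on `TM`, a smooth field of
positive semidefinite symmetric forms on the tangent spaces whose kernel is `TF`. The values outside
`U` are irrelevant. -/
structure TransverseMetric (F : Foliation n p q M) [IsManifold (𝓡 n) ∞ M] (U : Set M) where
  form : ∀ x : M, TangentSpace (𝓡 n) x →L[ℝ] TangentSpace (𝓡 n) x →L[ℝ] ℝ
  symm : ∀ x ∈ U, ∀ v w, form x v w = form x w v
  nonneg : ∀ x ∈ U, ∀ v, 0 ≤ form x v v
  eq_zero_iff : ∀ x ∈ U, ∀ v, form x v v = 0 ↔ v ∈ F.leafTangent x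
  smooth : ContMDiffOn (𝓡 n) ((𝓡 n).prod 𝓘(ℝ, Euc n →L[ℝ] Euc n →L[ℝ] ℝ)) ∞
    (fun x => Bundle.TotalSpace.mk' (Euc n →L[ℝ] Euc n →L[ℝ] ℝ)
      (E := fun y : M => TangentSpace (𝓡 n) y →L[ℝ] TangentSpace (𝓡 n) y →L[ℝ] ℝ) x (form x)) U

variable [IsManifold (𝓡 n) ∞ M] {F : Foliation n p q M}

/-- The norm on the normal space `N_x = T_x M / T_x F`, evaluated on the class of `v`. -/
noncomputable def TransverseMetric.norm {U : Set M} (k : TransverseMetric F U) (x : M)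
    (v : TangentSpace (𝓡 n) x) : ℝ :=
  Real.sqrt (k.form x v v)

/-- The metric induced on a transversal, in a parametrization `σ`. -/
noncomputable def TransverseMetric.restrict {U : Set M} (g : TransverseMetric F U)
    (σ : Euc q → M) : FormField q := fun z =>
  let B : Euc n →L[ℝ] Euc n →L[ℝ] ℝ := g.form (σ z)
  let A : Euc q →L[ℝ] Euc n := mfderiv 𝓘(ℝ, Euc q) (𝓡 n) σ z
  B.bilinearComp A A

/-- The bi-equicontinuity domain of the foliation, with respect to an auxiliary metric `k` on the
normal bundle `N`: the points `x` for which there is `δ > 1` such that for every path `c` starting at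
`x` and contained in the leaf of `x`, the infinitesimal holonomy `h_c : N_x → N_y` satisfies
`‖u‖ / δ ≤ ‖h_c u‖ ≤ δ ‖u‖` for all `u`. Here `h_c` is the differential at `x` of a holonomy map
`τ ∘ σ⁻¹` along `c` from a transversal at `x = σ z` to a transversal at `y = τ z`, so that it sends
the class of `dσ_z a` to the class of `dτ_z a`. -/
def biEquicontinuityDomain (F : Foliation n p q M) (k : TransverseMetric F univ) : Set M :=
  {x | ∃ δ : ℝ, 1 < δ ∧ ∀ c : unitInterval → M, F.IsLeafwisePath c → c 0 = x →
    ∀ (D : Set (Euc q)) (σ τ : Euc q → M) (H : unitInterval × Euc q → M) (z : Euc q),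
      F.IsHolonomy D σ τ H → z ∈ D → (∀ t, H (t, z) = c t) →
      ∀ a : Euc q,
        k.norm (σ z) (mfderiv 𝓘(ℝ, Euc q) (𝓡 n) σ z a) / δ
            ≤ k.norm (τ z) (mfderiv 𝓘(ℝ, Euc q) (𝓡 n) τ z a) ∧
        k.norm (τ z) (mfderiv 𝓘(ℝ, Euc q) (𝓡 n) τ z a)
            ≤ δ * k.norm (σ z) (mfderiv 𝓘(ℝ, Euc q) (𝓡 n) σ z a)}

end Foliation

/-! ### Transverse similarity structures -/

/-- A transverse similarity structure on `(M, F)`: an open covering `(U i)` of `M` with a transverse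
metric `g i` on each `U i`, such that the classes up to homothety of `g i` and `g j` agree on
`U i ∩ U j`. -/
structure TransverseSimilarity {n p q : ℕ} {M : Type*} [TopologicalSpace M]
    [ChartedSpace (Euc n) M] [IsManifold (𝓡 n) ∞ M] (F : Foliation n p q M) (ι : Type*) where
  U : ι → Set M
  isOpen : ∀ i, IsOpen (U i)
  cover : ∀ x, ∃ i, x ∈ U i
  g : ∀ i, F.TransverseMetric (U i)
  compatible : ∀ i j, ∃ r : ℝ, 0 < r ∧ ∀ x ∈ U i ∩ U j, (g i).form x = r • (g j).form x

namespace TransverseSimilarity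

variable {n p q : ℕ} {M : Type*} [TopologicalSpace M] [ChartedSpace (Euc n) M]
  [IsManifold (𝓡 n) ∞ M] {F : Foliation n p q M} {ι : Type*}

/-- Every holonomy map from a connected transversal `σ(D) ⊆ U i` to a transversal `τ(D) ⊆ U j` is a
homothety with constant ratio from `g i` to `g j`. -/
def HolonomyInvariant (S : TransverseSimilarity F ι) : Prop :=
  ∀ (i j : ι) (D : Set (Euc q)) (σ τ : Euc q → M) (H : unitInterval × Euc q → M),
    F.IsHolonomy D σ τ H → IsConnected D → MapsTo σ D (S.U i) → MapsTo τ D (S.U j) →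
    ∃ r : ℝ, 0 < r ∧ ∀ z ∈ D, (S.g j).restrict τ z = r • (S.g i).restrict σ z

/-- `g` is a global transverse metric which at each point belongs to the similarity class; the
proportionality factor may depend on the point. Fixing such a `g` amounts to fixing a volume element
on the normal bundle. -/
def IsAdapted (S : TransverseSimilarity F ι) (g : F.TransverseMetric univ) : Prop :=
  ∀ i, ∀ x ∈ S.U i, ∃ r : ℝ, 0 < r ∧ g.form x = r • (S.g i).form x

/-- A foliated chart around `x`. -/
noncomputable def chart (_S : TransverseSimilarity F ι) (x : M) :
    OpenPartialHomeomorph M (Euc p × Euc q) :=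
  Classical.choose (F.exists_chart x)

/-- An index `i` with `x ∈ U i`. -/
noncomputable def index (S : TransverseSimilarity F ι) (x : M) : ι :=
  Classical.choose (S.cover x)

/-- The transversal through `x` along which the first component of the chart is constant; its
parameter at the point `x` is `(S.chart x x).2`. -/
noncomputable def slice (S : TransverseSimilarity F ι) (x : M) (z : Euc q) : M :=
  (S.chart x).symm ((S.chart x x).1, z)

/-- The transverse curvature `R_x : N_x × N_x × N_x → N_x`, i.e. the curvature of the transverse
connection induced on transversals by the Levi-Civita connection of the metrics `g i`. It is written
in the coordinates `ℝ^q ≃ N_x` given by the transverse coordinates of the chart at `x`. -/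
noncomputable def curvature (S : TransverseSimilarity F ι) (x : M) :
    Euc q → Euc q → Euc q → Euc q :=
  riemannTensor ((S.g (S.index x)).restrict (S.slice x)) (S.chart x x).2

/-- The function `w`: the norm of the transverse curvature at `x` with respect to `g`. -/
noncomputable def curvatureNorm (S : TransverseSimilarity F ι) (g : F.TransverseMetric univ)
    (x : M) : ℝ :=
  tensorNorm (g.restrict (S.slice x) (S.chart x x).2) (S.curvature x)

/-- The structure is transversely modelled on `(Sim(ℝ^q), ℝ^q)`: the manifold `M` is covered by open
sets `V` with submersions `f : V → ℝ^q` defining the foliation, which differ locally by similarities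
of `ℝ^q`, and the metrics of the structure are locally constant multiples of the pull-backs by `f` of
the Euclidean metric. -/
def IsModelledOnSim (S : TransverseSimilarity F ι) : Prop :=
  ∃ A : Set (Set M × (M → Euc q)),
    (∀ x : M, ∃ c ∈ A, x ∈ c.1) ∧
    (∀ c ∈ A, IsOpen c.1 ∧ ContMDiffOn (𝓡 n) 𝓘(ℝ, Euc q) ∞ c.2 c.1 ∧
      ∀ x ∈ c.1, Function.Surjective (mfderiv (𝓡 n) 𝓘(ℝ, Euc q) c.2 x) ∧
        LinearMap.ker (mfderiv (𝓡 n) 𝓘(ℝ, Euc q) c.2 x).toLinearMap = F.leafTangent x) ∧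
    (∀ c ∈ A, ∀ d ∈ A, ∀ x ∈ c.1 ∩ d.1,
      ∃ s : Euc q → Euc q, IsEuclideanSimilarity s ∧ ∀ᶠ y in 𝓝 x, d.2 y = s (c.2 y)) ∧
    (∀ c ∈ A, ∀ i, ∀ x ∈ c.1 ∩ S.U i, ∃ r : ℝ, 0 < r ∧ ∀ᶠ y in 𝓝 x,
      ∀ u v : TangentSpace (𝓡 n) y, (S.g i).form y u v =
        r * inner ℝ (E := Euc q) (mfderiv (𝓡 n) 𝓘(ℝ, Euc q) c.2 y u)
          (mfderiv (𝓡 n) 𝓘(ℝ, Euc q) c.2 y v))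

/-- The structure is transversely flat: its transverse curvature vanishes identically, and it is
transversely modelled on `(Sim(ℝ^q), ℝ^q)`. -/
def IsTransverselyFlat (S : TransverseSimilarity F ι) : Prop :=
  (∀ x u v w, S.curvature x u v w = 0) ∧ S.IsModelledOnSim

end TransverseSimilarity

/-!
In a foliated chart, the metrics of a holonomy invariant similarity structure are pulled back from the
transverse coordinate (`TransverseSimilarity.FoliatedBox.form_eq`): sliding a transversal along the
plaques, while one of its points is kept fixed, is a holonomy map, so it is a homothety of constant
ratio, and the fixed point shows that the ratio is one. Finitely many foliated boxes cover the compact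
manifold. Hence the holonomy of the foliation is described by finitely many Riemannian metrics on
balls of `ℝ^q` and by chains of local homotheties between them, each of which is defined on a ball of
uniform radius `r`, and whose ratio only depends on the two boxes
(`TransverseSimilarity.FoliatedBox.isTransition`).

The first part of the theorem is a statement about such chains (`exists_ratio_bound`). A homothety
of ratio `s` preserves the curvature as a `(1, 3)`-tensor, so it multiplies its norm by `s⁻²`. Start at
a point `x` of nonzero curvature. The curvature is bounded on the compact transversals, so `s` is
bounded below. Suppose that `s` is large, and cut the chain where its ratio is maximal. Going back from
this place to `x`, all the partial compositions have ratio at most one, so that they do not leave the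
balls on which the next homothety is defined, and the inverse of the chain is defined on a ball of
uniform radius, whose image is a small neighbourhood of `x`. The curvature does not vanish on this
neighbourhood, so it does not vanish on the ball. The points of a compact set at distance at least `r'`
from the zeros of the curvature form a compact set, on which the norm of the curvature has a positive
minimum; this bounds `s` from above. So the ratios of the chains starting at `x` are bounded in both
directions. The infinitesimal holonomy along a leafwise path is the differential of a chain
(`TransverseSimilarity.BoxCover.exists_hasFDerivAt`), and all metrics on the normal bundle are
comparable by compactness, which gives `TransverseSimilarity.mem_biEquicontinuityDomain`.

If the bi-equicontinuity domain is empty, the curvature therefore vanishes. A flat metric is locally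
isometric to the Euclidean one (`IsRiemannianOn.exists_isometry`): the equation of parallel coframes is
a linear total differential equation whose integrability condition is the vanishing of the curvature,
it is solved along rays (`exists_total_solution`), and a parallel coframe is closed and orthonormal, so
that its primitive is an isometry. Two such isometries differ by a similarity
(`IsHomothetyOn.exists_similarity`), and their compositions with the transverse coordinates are the
submersions which model the structure on the similarities of `ℝ^q`.
-/

set_option maxSynthPendingDepth 3

/-! ### Levi-Civita connection and curvature of a metric on an open subset of `ℝ^q` -/

/-- `G` is a smooth Riemannian metric on the open set `Ω` of `ℝ^q`. -/
structure IsRiemannianOn {q : ℕ} (G : FormField q) (Ω : Set (Euc q)) : Prop where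
  isOpen : IsOpen Ω
  smooth : ContDiffOn ℝ ∞ G Ω
  symm : ∀ z ∈ Ω, ∀ u v, G z u v = G z v u
  pos : ∀ z ∈ Ω, ∀ u, u ≠ 0 → 0 < G z u u

lemma IsRiemannianOn.mono {q : ℕ} {G : FormField q} {Ω Ω' : Set (Euc q)} (hG : IsRiemannianOn G Ω)
    (h : Ω' ⊆ Ω) (ho : IsOpen Ω') : IsRiemannianOn G Ω' :=
  ⟨ho, hG.smooth.mono h, fun z hz => hG.symm z (h hz), fun z hz => hG.pos z (h hz)⟩

/-- A positive definite form on a finite dimensional space is nondegenerate. -/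
lemma isInvertible_of_pos {q : ℕ} (B : Euc q →L[ℝ] Euc q →L[ℝ] ℝ)
    (hB : ∀ u, u ≠ 0 → 0 < B u u) : B.IsInvertible := by
  have hinj : Function.Injective B := by
    rw [injective_iff_map_eq_zero]
    intro u hu
    by_contra h
    have := hB u h
    simp [hu] at this
  have hfr : Module.finrank ℝ (Euc q) = Module.finrank ℝ (Euc q →L[ℝ] ℝ) := by
    rw [← (LinearMap.toContinuousLinearMap (𝕜 := ℝ) (E := Euc q) (F' := ℝ)).finrank_eq]
    exact (Subspace.dual_finrank_eq (K := ℝ) (V := Euc q)).symm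
  have hb : Function.Bijective B :=
    ⟨hinj, (LinearMap.injective_iff_surjective_of_finrank_eq_finrank (f := B.toLinearMap) hfr).1 hinj⟩
  exact ⟨(LinearEquiv.ofBijective B.toLinearMap hb).toContinuousLinearEquiv, by ext; rfl⟩

/-- The Koszul form as a continuous trilinear map. -/
noncomputable def koszulCLM {q : ℕ} (G : FormField q) (z : Euc q) :
    Euc q →L[ℝ] Euc q →L[ℝ] Euc q →L[ℝ] ℝ :=
  (1 / 2 : ℝ) • (fderiv ℝ G z + (fderiv ℝ G z).flip
    - (ContinuousLinearMap.flipₗᵢ ℝ (Euc q) (Euc q) ℝ).toContinuousLinearEquiv.toContinuousLinearMap.comp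
      (fderiv ℝ G z).flip)

/-- The Christoffel map as a continuous bilinear map. -/
noncomputable def christoffelCLM {q : ℕ} (G : FormField q) (z : Euc q) :
    Euc q →L[ℝ] Euc q →L[ℝ] Euc q :=
  (ContinuousLinearMap.compL ℝ (Euc q) (Euc q →L[ℝ] ℝ) (Euc q) (G z).inverse).comp (koszulCLM G z)

lemma koszulForm_eq {q : ℕ} (G : FormField q) (z u v : Euc q) :
    koszulForm G z u v = koszulCLM G z u v := by
  ext a
  simp [koszulForm, koszulCLM]

lemma christoffel_eq {q : ℕ} (G : FormField q) (z u v : Euc q) :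
    christoffel G z u v = christoffelCLM G z u v := by
  simp [christoffel, christoffelCLM, koszulForm_eq]

/-- The map `(u, v, w) ↦ Γ (u, Γ (v, w))`. -/
noncomputable def nestCLM {q : ℕ} (Γ : Euc q →L[ℝ] Euc q →L[ℝ] Euc q) :
    Euc q →L[ℝ] Euc q →L[ℝ] Euc q →L[ℝ] Euc q :=
  (ContinuousLinearMap.compL ℝ (Euc q) (Euc q) (Euc q)).bilinearComp Γ Γ

lemma nestCLM_apply {q : ℕ} (Γ : Euc q →L[ℝ] Euc q →L[ℝ] Euc q) (u v w : Euc q) :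
    nestCLM Γ u v w = Γ u (Γ v w) := rfl

/-- The Riemann tensor as a continuous trilinear map. -/
noncomputable def riemannCLM {q : ℕ} (G : FormField q) (z : Euc q) :
    Euc q →L[ℝ] Euc q →L[ℝ] Euc q →L[ℝ] Euc q :=
  fderiv ℝ (christoffelCLM G) z - (fderiv ℝ (christoffelCLM G) z).flip
    + nestCLM (christoffelCLM G z) - (nestCLM (christoffelCLM G z)).flip

section Riemannian

variable {q : ℕ} {G : FormField q} {Ω : Set (Euc q)}

lemma IsRiemannianOn.isInvertible (hG : IsRiemannianOn G Ω) {z : Euc q} (hz : z ∈ Ω) :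
    (G z).IsInvertible :=
  isInvertible_of_pos _ (hG.pos z hz)

lemma IsRiemannianOn.contDiffAt (hG : IsRiemannianOn G Ω) {z : Euc q} (hz : z ∈ Ω) :
    ContDiffAt ℝ ∞ G z :=
  hG.smooth.contDiffAt (hG.isOpen.mem_nhds hz)

/-- The Koszul formula. -/
lemma IsRiemannianOn.christoffel_spec (hG : IsRiemannianOn G Ω) {z : Euc q} (hz : z ∈ Ω)
    (u v a : Euc q) :
    G z (christoffelCLM G z u v) a =
      (1 / 2 : ℝ) * (fderiv ℝ G z u v a + fderiv ℝ G z v u a - fderiv ℝ G z a u v) := by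
  have h : G z (christoffelCLM G z u v) = koszulCLM G z u v := by
    rw [christoffelCLM]
    exact (hG.isInvertible hz).self_apply_inverse (koszulCLM G z u v)
  rw [h]
  simp [koszulCLM]

lemma contDiff_clm_flip {E F H : Type*} [NormedAddCommGroup E] [NormedSpace ℝ E]
    [NormedAddCommGroup F] [NormedSpace ℝ F] [NormedAddCommGroup H] [NormedSpace ℝ H]
    {m : WithTop ℕ∞} :
    ContDiff ℝ m (fun B : E →L[ℝ] F →L[ℝ] H => B.flip) :=
  (ContinuousLinearMap.flipₗᵢ ℝ E F H).toContinuousLinearEquiv.contDiff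

lemma IsRiemannianOn.contDiffAt_christoffel (hG : IsRiemannianOn G Ω) {z : Euc q} (hz : z ∈ Ω) :
    ContDiffAt ℝ ∞ (christoffelCLM G) z := by
  have h1 : ContDiffAt ℝ ∞ (fun y => (G y).inverse) z := by
    obtain ⟨e, he⟩ := hG.isInvertible hz
    have := contDiffAt_map_inverse (𝕜 := ℝ) (n := ∞) e
    rw [he] at this
    exact this.comp z (hG.contDiffAt hz)
  have h2 : ContDiffAt ℝ ∞ (fderiv ℝ G) z := (hG.contDiffAt hz).fderiv_right (by simp)
  have h2' : ContDiffAt ℝ ∞ (fun y => (fderiv ℝ G y).flip) z :=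
    contDiff_clm_flip.contDiffAt.comp z h2
  have h3 : ContDiffAt ℝ ∞ (koszulCLM G) z := by
    unfold koszulCLM
    exact ContDiffAt.const_smul _ ((h2.add h2').sub (contDiffAt_const.clm_comp h2'))
  unfold christoffelCLM
  exact ((ContinuousLinearMap.contDiff _).contDiffAt.comp z h1).clm_comp h3

lemma IsRiemannianOn.differentiableAt_christoffel (hG : IsRiemannianOn G Ω) {z : Euc q}
    (hz : z ∈ Ω) : DifferentiableAt ℝ (christoffelCLM G) z :=
  (hG.contDiffAt_christoffel hz).differentiableAt (by simp)

lemma riemannCLM_apply (G : FormField q) (z u v w : Euc q) :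
    riemannCLM G z u v w = fderiv ℝ (christoffelCLM G) z u v w - fderiv ℝ (christoffelCLM G) z v u w
      + christoffelCLM G z u (christoffelCLM G z v w)
      - christoffelCLM G z v (christoffelCLM G z u w) := by
  simp [riemannCLM, nestCLM_apply]

lemma IsRiemannianOn.riemannTensor_eq (hG : IsRiemannianOn G Ω) {z : Euc q} (hz : z ∈ Ω)
    (u v w : Euc q) : riemannTensor G z u v w = riemannCLM G z u v w := by
  have hd := hG.differentiableAt_christoffel hz
  have key : ∀ a b c : Euc q, fderiv ℝ (fun y => christoffel G y a b) z c =
      fderiv ℝ (christoffelCLM G) z c a b := by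
    intro a b c
    simp only [christoffel_eq]
    rw [fderiv_clm_apply (hd.clm_apply (differentiableAt_const a)) (differentiableAt_const b),
      fderiv_clm_apply hd (differentiableAt_const a)]
    simp
  rw [riemannCLM_apply, riemannTensor, key, key]
  simp only [christoffel_eq]

lemma IsRiemannianOn.continuousAt_riemannCLM (hG : IsRiemannianOn G Ω) {z : Euc q} (hz : z ∈ Ω) :
    ContinuousAt (riemannCLM G) z := by
  have h1 := hG.contDiffAt_christoffel hz
  have h2 : ContDiffAt ℝ ∞ (fderiv ℝ (christoffelCLM G)) z := h1.fderiv_right (by simp)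
  have h3 : ContDiffAt ℝ ∞ (fun y => (fderiv ℝ (christoffelCLM G) y).flip) z :=
    contDiff_clm_flip.contDiffAt.comp z h2
  have h4 : ContDiffAt ℝ ∞ (fun y => nestCLM (christoffelCLM G y)) z := by
    have ha : ContDiffAt ℝ ∞ (fun y => (ContinuousLinearMap.compL ℝ (Euc q) (Euc q) (Euc q)).comp
        (christoffelCLM G y)) z := contDiffAt_const.clm_comp h1
    have hb : ContDiffAt ℝ ∞ (fun y => ((ContinuousLinearMap.compL ℝ (Euc q) (Euc q) (Euc q)).comp
        (christoffelCLM G y)).flip.comp (christoffelCLM G y)) z :=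
      (contDiff_clm_flip.contDiffAt.comp z ha).clm_comp h1
    exact contDiff_clm_flip.contDiffAt.comp z hb
  have h5 : ContDiffAt ℝ ∞ (fun y => (nestCLM (christoffelCLM G y)).flip) z :=
    contDiff_clm_flip.contDiffAt.comp z h4
  exact (((h2.sub h3).add h4).sub h5).continuousAt

/-- The derivative of a symmetric field of forms is symmetric. -/
lemma IsRiemannianOn.fderiv_symm (hG : IsRiemannianOn G Ω) {z : Euc q} (hz : z ∈ Ω)
    (a u v : Euc q) : fderiv ℝ G z a u v = fderiv ℝ G z a v u := by
  have hd : DifferentiableAt ℝ G z := (hG.contDiffAt hz).differentiableAt (by simp)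
  have key : ∀ u v : Euc q, fderiv ℝ (fun y => G y u v) z a = fderiv ℝ G z a u v := by
    intro u v
    rw [fderiv_clm_apply (hd.clm_apply (differentiableAt_const u)) (differentiableAt_const v),
      fderiv_clm_apply hd (differentiableAt_const u)]
    simp
  rw [← key, ← key]
  have : (fun y => G y u v) =ᶠ[𝓝 z] fun y => G y v u := by
    filter_upwards [hG.isOpen.mem_nhds hz] with y hy using hG.symm y hy u v
  rw [this.fderiv_eq]

/-- The Levi-Civita connection is torsion free. -/
lemma IsRiemannianOn.christoffel_symm (hG : IsRiemannianOn G Ω) {z : Euc q} (hz : z ∈ Ω)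
    (u v : Euc q) : christoffelCLM G z u v = christoffelCLM G z v u := by
  have hinj : Function.Injective (G z) := (hG.isInvertible hz).injective
  apply hinj
  ext a
  rw [hG.christoffel_spec hz, hG.christoffel_spec hz, hG.fderiv_symm hz a u v]
  ring

/-- The Levi-Civita connection is metric. -/
lemma IsRiemannianOn.fderiv_eq (hG : IsRiemannianOn G Ω) {z : Euc q} (hz : z ∈ Ω)
    (a u v : Euc q) : fderiv ℝ G z a u v =
      G z (christoffelCLM G z a u) v + G z u (christoffelCLM G z a v) := by
  rw [hG.symm z hz u, hG.christoffel_spec hz, hG.christoffel_spec hz,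
    hG.fderiv_symm hz a v u]
  ring

end Riemannian

/-! ### Homotheties and the invariance of the curvature -/

section Pullback

lemma two_le_infty : (2 : WithTop ℕ∞) ≤ ∞ := WithTop.coe_le_coe.2 (le_top : (2 : ℕ∞) ≤ ⊤)

variable {q : ℕ} {G G' : FormField q} {Ω Ω' : Set (Euc q)} {h : Euc q → Euc q} {c : ℝ}

/-- The map `h` sends the open set `Ω` to `Ω'`, and `G = c • h^* G'` for the constant `c > 0`: it
multiplies the squares of lengths by `c⁻¹`. -/
structure IsHomothetyOn (G : FormField q) (Ω : Set (Euc q)) (G' : FormField q) (Ω' : Set (Euc q))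
    (h : Euc q → Euc q) (c : ℝ) : Prop where
  source : IsRiemannianOn G Ω
  target : IsRiemannianOn G' Ω'
  smooth : ContDiffOn ℝ ∞ h Ω
  mapsTo : MapsTo h Ω Ω'
  pos : 0 < c
  eq : ∀ z ∈ Ω, ∀ u v, G z u v = c * G' (h z) (fderiv ℝ h z u) (fderiv ℝ h z v)

lemma IsHomothetyOn.contDiffAt (H : IsHomothetyOn G Ω G' Ω' h c) {z : Euc q} (hz : z ∈ Ω) :
    ContDiffAt ℝ ∞ h z :=
  H.smooth.contDiffAt (H.source.isOpen.mem_nhds hz)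

lemma IsHomothetyOn.injective (H : IsHomothetyOn G Ω G' Ω' h c) {z : Euc q} (hz : z ∈ Ω) :
    Function.Injective (fderiv ℝ h z) := by
  rw [injective_iff_map_eq_zero]
  intro u hu
  by_contra hne
  have := H.source.pos z hz u hne
  rw [H.eq z hz, hu] at this
  simp at this

lemma IsHomothetyOn.surjective (H : IsHomothetyOn G Ω G' Ω' h c) {z : Euc q} (hz : z ∈ Ω) :
    Function.Surjective (fderiv ℝ h z) :=
  LinearMap.injective_iff_surjective.1
    (H.injective hz : Function.Injective (fderiv ℝ h z).toLinearMap)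

lemma IsHomothetyOn.comp {G'' : FormField q} {Ω₁ Ω'' : Set (Euc q)} {f : Euc q → Euc q} {c' : ℝ}
    (hf : IsHomothetyOn G' Ω' G'' Ω'' f c') (hh : IsHomothetyOn G Ω G' Ω₁ h c)
    (hm : MapsTo h Ω Ω') : IsHomothetyOn G Ω G'' Ω'' (f ∘ h) (c * c') where
  source := hh.source
  target := hf.target
  smooth := hf.smooth.comp hh.smooth hm
  mapsTo := hf.mapsTo.comp hm
  pos := mul_pos hh.pos hf.pos
  eq := by
    intro z hz u v
    rw [hh.eq z hz, hf.eq _ (hm hz), fderiv_comp z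
      ((hf.contDiffAt (hm hz)).differentiableAt (by simp))
      ((hh.contDiffAt hz).differentiableAt (by simp))]
    simp only [ContinuousLinearMap.comp_apply, Function.comp_apply, mul_assoc]

lemma IsHomothetyOn.mono {Ω₁ : Set (Euc q)} (H : IsHomothetyOn G Ω G' Ω' h c) (hs : Ω₁ ⊆ Ω)
    (ho : IsOpen Ω₁) : IsHomothetyOn G Ω₁ G' Ω' h c where
  source := H.source.mono hs ho
  target := H.target
  smooth := H.smooth.mono hs
  mapsTo := H.mapsTo.mono_left hs
  pos := H.pos
  eq := fun z hz => H.eq z (hs hz)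

lemma IsHomothetyOn.second_symm (H : IsHomothetyOn G Ω G' Ω' h c) {z : Euc q} (hz : z ∈ Ω)
    (u v : Euc q) : fderiv ℝ (fderiv ℝ h) z u v = fderiv ℝ (fderiv ℝ h) z v u :=
  ((H.contDiffAt hz).isSymmSndFDerivAt (by simpa using two_le_infty)).eq u v

/-- The derivative of the equation `G = c • h^* G'`. -/
lemma IsHomothetyOn.fderiv_eq (H : IsHomothetyOn G Ω G' Ω' h c) {z : Euc q} (hz : z ∈ Ω)
    (a u v : Euc q) : fderiv ℝ G z a u v =
      c * (fderiv ℝ G' (h z) (fderiv ℝ h z a) (fderiv ℝ h z u) (fderiv ℝ h z v)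
        + G' (h z) (fderiv ℝ (fderiv ℝ h) z a u) (fderiv ℝ h z v)
        + G' (h z) (fderiv ℝ h z u) (fderiv ℝ (fderiv ℝ h) z a v)) := by
  have hd : DifferentiableAt ℝ G z := (H.source.contDiffAt hz).differentiableAt (by simp)
  have hd' : DifferentiableAt ℝ G' (h z) :=
    (H.target.contDiffAt (H.mapsTo hz)).differentiableAt (by simp)
  have hh : DifferentiableAt ℝ h z := (H.contDiffAt hz).differentiableAt (by simp)
  have hh2 : DifferentiableAt ℝ (fderiv ℝ h) z :=
    ((H.contDiffAt hz).fderiv_right (m := ∞) (by simp)).differentiableAt (by simp)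
  have h1 : HasFDerivAt (fun y => G y u v) (((fderiv ℝ G z).flip u).flip v) z := by
    have := (hd.hasFDerivAt.clm_apply (hasFDerivAt_const u z)).clm_apply (hasFDerivAt_const v z)
    refine this.congr_fderiv ?_
    ext a
    simp
  have h2 := ((hd'.hasFDerivAt.comp z hh.hasFDerivAt).clm_apply
    (hh2.hasFDerivAt.clm_apply (hasFDerivAt_const u z))).clm_apply
    (hh2.hasFDerivAt.clm_apply (hasFDerivAt_const v z))
  have h3 := h2.const_mul c
  have h4 : (fun y => G y u v) =ᶠ[𝓝 z] fun y => c * G' (h y) (fderiv ℝ h y u) (fderiv ℝ h y v) := by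
    filter_upwards [H.source.isOpen.mem_nhds hz] with y hy using H.eq y hy u v
  have h5 := h1.unique (h3.congr_of_eventuallyEq h4)
  have h6 := congrArg (fun L => L a) h5
  simp only [ContinuousLinearMap.flip_apply] at h6
  rw [h6]
  simp
  ring

/-- The transformation rule of the Christoffel map under homotheties: the constant `c` cancels in the
Koszul formula. -/
lemma IsHomothetyOn.fderiv_christoffel (H : IsHomothetyOn G Ω G' Ω' h c)
    {z : Euc q} (hz : z ∈ Ω) (u v : Euc q) :
    fderiv ℝ h z (christoffelCLM G z u v) = fderiv ℝ (fderiv ℝ h) z u v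
      + christoffelCLM G' (h z) (fderiv ℝ h z u) (fderiv ℝ h z v) := by
  have hz' := H.mapsTo hz
  apply (H.target.isInvertible hz').injective
  ext b
  obtain ⟨a, rfl⟩ := H.surjective hz b
  have h1 := H.source.christoffel_spec hz u v a
  rw [H.eq z hz, H.fderiv_eq hz, H.fderiv_eq hz, H.fderiv_eq hz] at h1
  rw [map_add, add_apply, H.target.christoffel_spec hz']
  apply mul_left_cancel₀ H.pos.ne'
  rw [h1, H.second_symm hz v u, H.second_symm hz a u, H.second_symm hz a v,
    H.target.symm _ hz' (fderiv ℝ h z u) (fderiv ℝ (fderiv ℝ h) z v a),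
    H.target.symm _ hz' (fderiv ℝ h z v)]
  ring

/-- The curvature is natural under homotheties. -/
lemma IsHomothetyOn.riemann_eq (H : IsHomothetyOn G Ω G' Ω' h c)
    {z : Euc q} (hz : z ∈ Ω) (u v w : Euc q) :
    riemannCLM G' (h z) (fderiv ℝ h z u) (fderiv ℝ h z v) (fderiv ℝ h z w) =
      fderiv ℝ h z (riemannCLM G z u v w) := by
  have hz' := H.mapsTo hz
  have hd := H.source.differentiableAt_christoffel hz
  have hd' := H.target.differentiableAt_christoffel hz'
  have hh : DifferentiableAt ℝ h z := (H.contDiffAt hz).differentiableAt (by simp)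
  have hs2 : ContDiffAt ℝ ∞ (fderiv ℝ h) z := (H.contDiffAt hz).fderiv_right (by simp)
  have hh2 : DifferentiableAt ℝ (fderiv ℝ h) z := hs2.differentiableAt (by simp)
  have hh3 : DifferentiableAt ℝ (fderiv ℝ (fderiv ℝ h)) z :=
    (hs2.fderiv_right (m := ∞) (by simp)).differentiableAt (by simp)
  -- the derivative of the transformation rule of the Christoffel map
  have key : ∀ u v w : Euc q,
      fderiv ℝ (fderiv ℝ h) z u (christoffelCLM G z v w)
        + fderiv ℝ h z (fderiv ℝ (christoffelCLM G) z u v w) =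
      fderiv ℝ (fderiv ℝ (fderiv ℝ h)) z u v w
        + fderiv ℝ (christoffelCLM G') (h z) (fderiv ℝ h z u) (fderiv ℝ h z v) (fderiv ℝ h z w)
        + christoffelCLM G' (h z) (fderiv ℝ (fderiv ℝ h) z u v) (fderiv ℝ h z w)
        + christoffelCLM G' (h z) (fderiv ℝ h z v) (fderiv ℝ (fderiv ℝ h) z u w) := by
    intro u v w
    have h1 := hh2.hasFDerivAt.clm_apply
      ((hd.hasFDerivAt.clm_apply (hasFDerivAt_const v z)).clm_apply (hasFDerivAt_const w z))
    have h2 := ((hh3.hasFDerivAt.clm_apply (hasFDerivAt_const v z)).clm_apply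
      (hasFDerivAt_const w z)).add (((hd'.hasFDerivAt.comp z hh.hasFDerivAt).clm_apply
      (hh2.hasFDerivAt.clm_apply (hasFDerivAt_const v z))).clm_apply
      (hh2.hasFDerivAt.clm_apply (hasFDerivAt_const w z)))
    have h4 : (fun y => fderiv ℝ h y (christoffelCLM G y v w)) =ᶠ[𝓝 z]
        fun y => fderiv ℝ (fderiv ℝ h) y v w
          + christoffelCLM G' (h y) (fderiv ℝ h y v) (fderiv ℝ h y w) := by
      filter_upwards [H.source.isOpen.mem_nhds hz] with y hy using H.fderiv_christoffel hy v w
    have h5 := h1.unique (h2.congr_of_eventuallyEq h4)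
    have h6 := congrArg (fun L => L u) h5
    simp at h6
    rw [add_comm, h6]
    abel
  have k1 := key u v w
  have k2 := key v u w
  have hsym : fderiv ℝ (fderiv ℝ (fderiv ℝ h)) z u v w =
      fderiv ℝ (fderiv ℝ (fderiv ℝ h)) z v u w := by
    rw [(hs2.isSymmSndFDerivAt (by simpa using two_le_infty)).eq u v]
  have t1 := H.fderiv_christoffel hz u (christoffelCLM G z v w)
  have t2 := H.fderiv_christoffel hz v (christoffelCLM G z u w)
  rw [H.fderiv_christoffel hz v w, map_add] at t1
  rw [H.fderiv_christoffel hz u w, map_add] at t2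
  rw [riemannCLM_apply, riemannCLM_apply, map_sub, map_add, map_sub, t1, t2,
    eq_sub_of_add_eq' k1, eq_sub_of_add_eq' k2, hsym, H.second_symm hz v u]
  abel

end Pullback

/-! ### Integrable total differential equations -/

section TotalODE

variable {E F : Type*} [NormedAddCommGroup E] [NormedSpace ℝ E] [NormedAddCommGroup F]
  [NormedSpace ℝ F]

/-- Grönwall's inequality on the unit interval, with growth rate one. -/
lemma norm_le_of_deriv_le_Icc_zero_one {f f' : ℝ → F} {δ ε : ℝ} (hδ : 0 ≤ δ) (hε : 0 ≤ ε)
    (hf : ∀ t ∈ Icc (0 : ℝ) 1, HasDerivWithinAt f (f' t) (Icc 0 1) t) (h0 : ‖f 0‖ ≤ δ)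
    (bound : ∀ t ∈ Icc (0 : ℝ) 1, ‖f' t‖ ≤ ‖f t‖ + ε) :
    ∀ t ∈ Icc (0 : ℝ) 1, ‖f t‖ ≤ 3 * (δ + ε) := by
  intro t ht
  have h1 := norm_le_gronwallBound_of_norm_deriv_right_le (f := f) (f' := f') (δ := δ) (K := 1)
    (ε := ε) (a := 0) (b := 1) (fun s hs => (hf s hs).continuousWithinAt)
    (fun s hs => (hf s ⟨hs.1, hs.2.le⟩).mono_of_mem_nhdsWithin
      (Filter.mem_of_superset (Ico_mem_nhdsGE hs.2) fun r hr => ⟨hs.1.trans hr.1, hr.2.le⟩)) h0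
    (fun s hs => by simpa using bound s ⟨hs.1, hs.2.le⟩) t ht
  rw [gronwallBound_of_K_ne_0 one_ne_zero] at h1
  have he : Real.exp (1 * (t - 0)) ≤ 3 := by
    calc Real.exp (1 * (t - 0)) ≤ Real.exp 1 := Real.exp_le_exp.2 (by linarith [ht.2])
      _ ≤ 3 := by linarith [Real.exp_one_lt_d9]
  have he0 := Real.exp_pos (1 * (t - 0))
  calc ‖f t‖ ≤ _ := h1
    _ ≤ 3 * (δ + ε) := by
      simp only [div_one]
      nlinarith

/-- A solution of a linear total differential inequality which vanishes at the centre of a ball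
vanishes on the ball. -/
lemma eq_zero_of_norm_fderiv_le {M : E → F} {M' : E → E →L[ℝ] F} {z₀ : E} {ε C : ℝ}
    (hM : ∀ z ∈ Metric.ball z₀ ε, HasFDerivAt M (M' z) z)
    (hb : ∀ z ∈ Metric.ball z₀ ε, ‖M' z‖ ≤ C * ‖M z‖) (h0 : M z₀ = 0) :
    ∀ z ∈ Metric.ball z₀ ε, M z = 0 := by
  intro z hz
  have hmem : ∀ t ∈ Icc (0 : ℝ) 1, z₀ + t • (z - z₀) ∈ Metric.ball z₀ ε := by
    intro t ht
    rw [Metric.mem_ball, dist_eq_norm] at hz ⊢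
    rw [add_sub_cancel_left, norm_smul, Real.norm_of_nonneg ht.1]
    exact (mul_le_of_le_one_left (norm_nonneg _) ht.2).trans_lt hz
  have hd : ∀ t ∈ Icc (0 : ℝ) 1,
      HasDerivAt (fun t : ℝ => M (z₀ + t • (z - z₀))) (M' (z₀ + t • (z - z₀)) (z - z₀)) t := by
    intro t ht
    have h1 : HasDerivAt (fun t : ℝ => z₀ + t • (z - z₀)) (z - z₀) t := by
      simpa using ((hasDerivAt_id t).smul_const (z - z₀)).const_add z₀
    exact (hM _ (hmem t ht)).comp_hasDerivAt t h1
  have := eq_zero_of_abs_deriv_le_mul_abs_self_of_eq_zero_right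
    (f := fun t : ℝ => M (z₀ + t • (z - z₀))) (K := C * ‖z - z₀‖) (a := 0) (b := 1)
    (fun t ht => (hd t ht).continuousAt.continuousWithinAt)
    (fun t ht => (hd t ⟨ht.1, ht.2.le⟩).hasDerivWithinAt) (by simp [h0])
    (fun t ht => by
      have h := hb _ (hmem t ⟨ht.1, ht.2.le⟩)
      calc _ ≤ ‖M' (z₀ + t • (z - z₀))‖ * ‖z - z₀‖ := ContinuousLinearMap.le_opNorm _ _
        _ ≤ (C * ‖M (z₀ + t • (z - z₀))‖) * ‖z - z₀‖ := by gcongr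
        _ = _ := by ring) 1 (by simp)
  simpa using this

/-- Existence of solutions of the linear ODE along the ray of direction `v`. -/
lemma exists_ray_solution [CompleteSpace F] {A : E → E →L[ℝ] F →L[ℝ] F} {z₀ v : E} {C : ℝ}
    (hc : ∀ t ∈ Icc (0 : ℝ) 1, ContinuousAt A (z₀ + t • v))
    (hb : ∀ t ∈ Icc (0 : ℝ) 1, ‖A (z₀ + t • v)‖ ≤ C) (hv : C * ‖v‖ ≤ 1 / 2) (y₀ : F) :
    ∃ y : ℝ → F, y 0 = y₀ ∧ ∀ t ∈ Icc (0 : ℝ) 1,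
      HasDerivWithinAt y (A (z₀ + t • v) v (y t)) (Icc 0 1) t := by
  have hA : ∀ t ∈ Icc (0 : ℝ) 1, ∀ y : F, ‖A (z₀ + t • v) v y‖ ≤ 1 / 2 * ‖y‖ := by
    intro t ht y
    calc _ ≤ ‖A (z₀ + t • v)‖ * ‖v‖ * ‖y‖ := ContinuousLinearMap.le_opNorm₂ _ _ _
      _ ≤ C * ‖v‖ * ‖y‖ := by gcongr; exact hb t ht
      _ ≤ _ := by gcongr
  have hP : IsPicardLindelof (fun t y => A (z₀ + t • v) v y) (tmin := 0) (tmax := 1)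
      ⟨0, by simp⟩ y₀ (‖y₀‖₊ + 1) 0 (‖y₀‖₊ + 1) 1 := by
    refine ⟨?_, ?_, ?_, ?_⟩
    · intro t ht
      refine (LipschitzWith.of_dist_le_mul fun x y => ?_).lipschitzOnWith
      rw [dist_eq_norm, dist_eq_norm, ← map_sub]
      refine (hA t ht _).trans ?_
      simp only [NNReal.coe_one]
      gcongr
      norm_num
    · intro y _ t ht
      have h1 : ContinuousAt (fun t : ℝ => A (z₀ + t • v)) t := by
        have h2 : ContinuousAt (fun t : ℝ => z₀ + t • v) t := by fun_prop
        exact ContinuousAt.comp (f := fun t : ℝ => z₀ + t • v) (hc t ht) h2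
      exact ((h1.clm_apply continuousAt_const).clm_apply continuousAt_const).continuousWithinAt
    · intro t ht y hy
      refine (hA t ht _).trans ?_
      rw [Metric.mem_closedBall, dist_eq_norm] at hy
      have h1 : ‖y‖ ≤ ‖y - y₀‖ + ‖y₀‖ := by simpa using norm_add_le (y - y₀) y₀
      simp only [NNReal.coe_add, NNReal.coe_one, coe_nnnorm] at hy ⊢
      linarith
    · simp
  exact hP.exists_eq_forall_mem_Icc_hasDerivWithinAt₀

/-- A linear total differential equation `Dθ_z (u) = A_z (u) (θ z)` whose integrability condition
holds has a local solution with a prescribed value at one point. The solution is built along rays,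
where the integrability condition says that `t ↦ t A (w) (θ)` solves the variational equation. -/
theorem exists_total_solution [CompleteSpace F] {A : E → E →L[ℝ] F →L[ℝ] F} {z₀ : E}
    (hA : ContDiffAt ℝ 2 A z₀)
    (hint : ∀ᶠ z in 𝓝 z₀, ∀ u v, fderiv ℝ A z u v + (A z v).comp (A z u) =
      fderiv ℝ A z v u + (A z u).comp (A z v)) (y₀ : F) :
    ∃ ε > 0, ∃ θ : E → F, θ z₀ = y₀ ∧
      ∀ z ∈ Metric.ball z₀ ε, HasFDerivAt θ ((A z).flip (θ z)) z := by
  obtain ⟨K, s, hs, hLip⟩ : ∃ K, ∃ s ∈ 𝓝 z₀, LipschitzOnWith K (fderiv ℝ A) s :=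
    (hA.fderiv_right (m := 1) (by norm_num)).exists_lipschitzOnWith
  have hev : ∀ᶠ z in 𝓝 z₀, z ∈ s ∧ DifferentiableAt ℝ A z ∧ ‖A z‖ ≤ ‖A z₀‖ + 1 ∧
      ‖fderiv ℝ A z‖ ≤ ‖fderiv ℝ A z₀‖ + 1 ∧
      ∀ u v, fderiv ℝ A z u v + (A z v).comp (A z u) =
      fderiv ℝ A z v u + (A z u).comp (A z v) := by
    refine Filter.Eventually.and hs (Filter.Eventually.and ?_ (Filter.Eventually.and ?_
      (Filter.Eventually.and ?_ hint)))
    · exact (hA.eventually (by simp)).mono fun z hz => hz.differentiableAt (by simp)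
    · exact (hA.continuousAt.norm.eventually_lt_const (lt_add_one _)).mono fun z hz => hz.le
    · exact ((hA.fderiv_right (m := 1) (by norm_num)).continuousAt.norm.eventually_lt_const
        (lt_add_one _)).mono fun z hz => hz.le
  obtain ⟨ε₀, hε₀, hball⟩ := Metric.eventually_nhds_iff_ball.1 hev
  -- one constant for all the bounds on the ball of radius `ε₀`
  obtain ⟨C, hC1, hCK, hCA, hCD⟩ : ∃ C : ℝ, 1 ≤ C ∧ (K : ℝ) ≤ C ∧ ‖A z₀‖ + 1 ≤ C ∧
      ‖fderiv ℝ A z₀‖ + 1 ≤ C :=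
    ⟨1 + K + (‖A z₀‖ + 1) + (‖fderiv ℝ A z₀‖ + 1), by
      have h1 := K.2
      have h2 := norm_nonneg (A z₀)
      have h3 := norm_nonneg (fderiv ℝ A z₀)
      refine ⟨?_, ?_, ?_, ?_⟩ <;> linarith [show (0 : ℝ) ≤ K from h1]⟩
  have hC0 : 0 < C := by linarith
  have hA1 : ∀ x ∈ Metric.ball z₀ ε₀, ∀ x' ∈ Metric.ball z₀ ε₀, ‖A x' - A x‖ ≤ C * ‖x' - x‖ :=
    fun x hx x' hx' => (convex_ball z₀ ε₀).norm_image_sub_le_of_norm_fderiv_le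
      (fun y hy => (hball y hy).2.1) (fun y hy => (hball y hy).2.2.2.1.trans hCD) hx hx'
  have hA2 : ∀ x ∈ Metric.ball z₀ ε₀, ∀ x' ∈ Metric.ball z₀ ε₀,
      ‖A x' - A x - fderiv ℝ A x (x' - x)‖ ≤ C * ‖x' - x‖ * ‖x' - x‖ := by
    intro x hx x' hx'
    have hseg : segment ℝ x x' ⊆ Metric.ball z₀ ε₀ := (convex_ball z₀ ε₀).segment_subset hx hx'
    refine (convex_segment x x').norm_image_sub_le_of_norm_hasFDerivWithin_le'
      (f' := fderiv ℝ A) (fun y hy => ((hball y (hseg hy)).2.1).hasFDerivAt.hasFDerivWithinAt)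
      (fun y hy => ?_) (left_mem_segment ℝ x x') (right_mem_segment ℝ x x')
    calc ‖fderiv ℝ A y - fderiv ℝ A x‖ ≤ K * ‖y - x‖ :=
          hLip.norm_sub_le (hball y (hseg hy)).1 (hball x hx).1
      _ ≤ C * ‖x' - x‖ := by
          gcongr
          exact norm_sub_le_of_mem_segment hy
  set ε : ℝ := min ε₀ (1 / (2 * C)) with hε
  have hε0 : 0 < ε := by positivity
  have hεC : C * ε ≤ 1 / 2 := by
    calc C * ε ≤ C * (1 / (2 * C)) := by gcongr; exact min_le_right _ _
      _ = 1 / 2 := by field_simp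
  have hε1 : ε ≤ 1 := by nlinarith
  have hray : ∀ v : E, ‖v‖ < ε → ∀ t ∈ Icc (0 : ℝ) 1, z₀ + t • v ∈ Metric.ball z₀ ε₀ := by
    intro v hv t ht
    rw [Metric.mem_ball, dist_eq_norm, add_sub_cancel_left, norm_smul, Real.norm_of_nonneg ht.1]
    exact ((mul_le_of_le_one_left (norm_nonneg _) ht.2).trans_lt hv).trans_le (min_le_left _ _)
  have hsol : ∀ v : E, ∃ y : ℝ → F, ‖v‖ < ε → (y 0 = y₀ ∧ ∀ t ∈ Icc (0 : ℝ) 1,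
      HasDerivWithinAt y (A (z₀ + t • v) v (y t)) (Icc 0 1) t) := by
    intro v
    by_cases hv : ‖v‖ < ε
    · obtain ⟨y, hy⟩ := exists_ray_solution (A := A) (z₀ := z₀) (v := v) (C := C)
        (fun t ht => (hball _ (hray v hv t ht)).2.1.continuousAt)
        (fun t ht => (hball _ (hray v hv t ht)).2.2.1.trans hCA)
        (by nlinarith [norm_nonneg v]) y₀
      exact ⟨y, fun _ => hy⟩
    · exact ⟨0, fun h => absurd h hv⟩
  -- `Y v` is the solution along the ray of direction `v`
  choose Y hY using hsol
  have hAv : ∀ v : E, ‖v‖ < ε → ∀ t ∈ Icc (0 : ℝ) 1, ∀ y, ‖A (z₀ + t • v) v y‖ ≤ ‖y‖ := by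
    intro v hv t ht y
    calc _ ≤ ‖A (z₀ + t • v)‖ * ‖v‖ * ‖y‖ := ContinuousLinearMap.le_opNorm₂ _ _ _
      _ ≤ C * ε * ‖y‖ := by
          gcongr
          exact (hball _ (hray v hv t ht)).2.2.1.trans hCA
      _ ≤ 1 * ‖y‖ := by gcongr; linarith
      _ = ‖y‖ := one_mul _
  set B : ℝ := 3 * ‖y₀‖ with hB
  have hB0 : 0 ≤ B := by positivity
  have hYB : ∀ v : E, ‖v‖ < ε → ∀ t ∈ Icc (0 : ℝ) 1, ‖Y v t‖ ≤ B := by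
    intro v hv
    have := norm_le_of_deriv_le_Icc_zero_one (f := Y v) (δ := ‖y₀‖) (ε := 0) (norm_nonneg _) le_rfl
      (hY v hv).2 (by rw [(hY v hv).1]) (fun t ht => by simpa using hAv v hv t ht _)
    simpa using this
  refine ⟨ε, hε0, fun z => Y (z - z₀) 1, ?_, ?_⟩
  · have h0 := hY 0 (by simpa using hε0)
    have := norm_le_of_deriv_le_Icc_zero_one (f := fun t => Y 0 t - y₀) (δ := 0) (ε := 0) le_rfl
      le_rfl (fun t ht => (h0.2 t ht).sub_const y₀) (by simp [h0.1]) (fun t ht => by simp) 1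
      (by simp)
    have h2 : ‖Y 0 1 - y₀‖ ≤ 0 := by simpa using this
    simpa [sub_eq_zero] using h2
  intro z hz
  obtain ⟨v, rfl⟩ : ∃ v, z = z₀ + v := ⟨z - z₀, by abel⟩
  have hv : ‖v‖ < ε := by simpa [dist_eq_norm] using hz
  -- the solutions along two rays differ by the candidate for the derivative, up to second order
  have main : ∀ w : E, ‖v + w‖ < ε → ‖w‖ ≤ 1 →
      ‖Y (v + w) 1 - Y v 1 - A (z₀ + v) w (Y v 1)‖ ≤ (6 * C * B + 36 * C ^ 2 * B) * ‖w‖ ^ 2 := by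
    intro w hw hw1
    have hb : ∀ t ∈ Icc (0 : ℝ) 1, ∀ y,
        ‖A (z₀ + t • (v + w)) (v + w) y - A (z₀ + t • v) v y‖ ≤ 2 * C * ‖w‖ * ‖y‖ := by
      intro t ht y
      have e1 : A (z₀ + t • (v + w)) (v + w) y - A (z₀ + t • v) v y =
          (A (z₀ + t • (v + w)) - A (z₀ + t • v)) (v + w) y + A (z₀ + t • v) w y := by
        simp
        abel
      have e2 : z₀ + t • (v + w) - (z₀ + t • v) = t • w := by rw [smul_add]; abel
      rw [e1]
      calc _ ≤ ‖A (z₀ + t • (v + w)) - A (z₀ + t • v)‖ * ‖v + w‖ * ‖y‖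
            + ‖A (z₀ + t • v)‖ * ‖w‖ * ‖y‖ :=
            norm_add_le_of_le (ContinuousLinearMap.le_opNorm₂ _ _ _)
              (ContinuousLinearMap.le_opNorm₂ _ _ _)
        _ ≤ (C * ‖w‖) * 1 * ‖y‖ + C * ‖w‖ * ‖y‖ := by
            gcongr
            · refine (hA1 _ (hray v hv t ht) _ (hray _ hw t ht)).trans ?_
              rw [e2, norm_smul, Real.norm_of_nonneg ht.1]
              gcongr
              exact mul_le_of_le_one_left (norm_nonneg _) ht.2
            · exact hw.le.trans hε1
            · exact (hball _ (hray v hv t ht)).2.2.1.trans hCA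
        _ = _ := by ring
    -- the solutions along two rays differ to first order
    have hδ : ∀ t ∈ Icc (0 : ℝ) 1, ‖Y (v + w) t - Y v t‖ ≤ 3 * (0 + 2 * C * ‖w‖ * B) := by
      refine norm_le_of_deriv_le_Icc_zero_one (f := fun t => Y (v + w) t - Y v t) le_rfl
        (by positivity) (fun t ht => ((hY _ hw).2 t ht).sub ((hY v hv).2 t ht)) ?_ ?_
      · simp [(hY _ hw).1, (hY v hv).1]
      · intro t ht
        have e1 : A (z₀ + t • (v + w)) (v + w) (Y (v + w) t) - A (z₀ + t • v) v (Y v t) =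
          A (z₀ + t • (v + w)) (v + w) (Y (v + w) t - Y v t)
          + (A (z₀ + t • (v + w)) (v + w) (Y v t) - A (z₀ + t • v) v (Y v t)) := by
          rw [map_sub]; abel
        rw [e1]
        refine norm_add_le_of_le (hAv _ hw t ht _) ((hb t ht _).trans ?_)
        gcongr
        exact hYB v hv t ht
    -- by integrability, the candidate solves the variational equation along the ray
    have hder : ∀ t ∈ Icc (0 : ℝ) 1, HasDerivWithinAt (fun t => t • A (z₀ + t • v) w (Y v t))
        (A (z₀ + t • v) w (Y v t) + t • fderiv ℝ A (z₀ + t • v) w v (Y v t)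
          + A (z₀ + t • v) v (t • A (z₀ + t • v) w (Y v t))) (Icc 0 1) t := by
      intro t ht
      have h1 : HasDerivWithinAt (fun t : ℝ => z₀ + t • v) v (Icc 0 1) t := by
        simpa using ((hasDerivWithinAt_id t (Icc 0 1)).smul_const v).const_add z₀
      have h2 : HasDerivWithinAt (fun t : ℝ => A (z₀ + t • v)) (fderiv ℝ A (z₀ + t • v) v)
          (Icc 0 1) t :=
        ((hball _ (hray v hv t ht)).2.1.hasFDerivAt).comp_hasDerivWithinAt t h1
      have h3 := (h2.clm_apply (hasDerivWithinAt_const t _ w)).clm_apply ((hY v hv).2 t ht)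
      have h4 := (hasDerivWithinAt_id t (Icc 0 1)).smul h3
      refine h4.congr_deriv ?_
      have h5 := congrArg (fun L => L (Y v t)) ((hball _ (hray v hv t ht)).2.2.2.2 v w)
      simp only [add_apply, ContinuousLinearMap.comp_apply] at h5
      simp only [map_zero, add_zero, id_eq, map_smul, one_smul]
      rw [h5, smul_add]
      abel
    have hE := norm_le_of_deriv_le_Icc_zero_one
      (f := fun t => Y (v + w) t - Y v t - t • A (z₀ + t • v) w (Y v t)) (δ := 0)
      (ε := 2 * C * ‖w‖ ^ 2 * B + 2 * C * ‖w‖ * (6 * C * ‖w‖ * B)) le_rfl (by positivity)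
      (fun t ht => (((hY _ hw).2 t ht).sub ((hY v hv).2 t ht)).sub (hder t ht))
      (by simp [(hY _ hw).1, (hY v hv).1]) ?_ 1 (by simp)
    · simp only [one_smul] at hE
      refine hE.trans (le_of_eq ?_)
      ring
    · intro t ht
      have e2 : z₀ + t • (v + w) - (z₀ + t • v) = t • w := by rw [smul_add]; abel
      have e1 : A (z₀ + t • (v + w)) (v + w) (Y (v + w) t) - A (z₀ + t • v) v (Y v t)
          - (A (z₀ + t • v) w (Y v t) + t • fderiv ℝ A (z₀ + t • v) w v (Y v t)
          + A (z₀ + t • v) v (t • A (z₀ + t • v) w (Y v t))) =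
          A (z₀ + t • v) v (Y (v + w) t - Y v t - t • A (z₀ + t • v) w (Y v t))
          + (((A (z₀ + t • (v + w)) - A (z₀ + t • v)
                - fderiv ℝ A (z₀ + t • v) (z₀ + t • (v + w) - (z₀ + t • v))) v (Y v t)
              + (A (z₀ + t • (v + w)) - A (z₀ + t • v)) w (Y v t))
            + (A (z₀ + t • (v + w)) (v + w) (Y (v + w) t - Y v t)
              - A (z₀ + t • v) v (Y (v + w) t - Y v t))) := by
        rw [e2]
        simp only [map_sub, map_add, add_apply, sub_apply, map_smul, smul_apply]
        abel
      have hw2 : ‖t • w‖ ≤ ‖w‖ := by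
        rw [norm_smul, Real.norm_of_nonneg ht.1]
        exact mul_le_of_le_one_left (norm_nonneg _) ht.2
      rw [e1]
      refine norm_add_le_of_le (hAv v hv t ht _) (norm_add_le_of_le ?_ ?_)
      · calc _ ≤ (C * ‖t • w‖ * ‖t • w‖) * ‖v‖ * ‖Y v t‖ + (C * ‖t • w‖) * ‖w‖ * ‖Y v t‖ := by
              refine norm_add_le_of_le ((ContinuousLinearMap.le_opNorm₂ _ _ _).trans ?_)
                ((ContinuousLinearMap.le_opNorm₂ _ _ _).trans ?_)
              · gcongr
                have := hA2 _ (hray v hv t ht) _ (hray _ hw t ht)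
                rwa [e2] at this ⊢
              · gcongr
                have := hA1 _ (hray v hv t ht) _ (hray _ hw t ht)
                rwa [e2] at this
          _ ≤ (C * ‖w‖ * ‖w‖) * 1 * B + (C * ‖w‖) * ‖w‖ * B := by
              gcongr
              · exact hv.le.trans hε1
              · exact hYB v hv t ht
              · exact hYB v hv t ht
          _ = _ := by ring
      · refine (hb t ht _).trans ?_
        gcongr
        refine (hδ t ht).trans (le_of_eq ?_)
        ring
  rw [hasFDerivAt_iff_isLittleO_nhds_zero]
  have hO : (fun w : E => Y (z₀ + v + w - z₀) 1 - Y (z₀ + v - z₀) 1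
      - (A (z₀ + v)).flip (Y (z₀ + v - z₀) 1) w) =O[𝓝 0] fun w => ‖w‖ ^ 2 := by
    refine Asymptotics.IsBigO.of_bound (6 * C * B + 36 * C ^ 2 * B) ?_
    have h1 : ∀ᶠ w : E in 𝓝 0, ‖v + w‖ < ε := by
      have : ContinuousAt (fun w : E => ‖v + w‖) 0 := by fun_prop
      exact this.eventually_lt_const (by simpa using hv)
    have h2 : ∀ᶠ w : E in 𝓝 0, ‖w‖ < 1 := by
      have : ContinuousAt (fun w : E => ‖w‖) 0 := by fun_prop
      exact this.eventually_lt_const (by simp)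
    filter_upwards [h1, h2] with w hw hw1
    have e3 : z₀ + v + w - z₀ = v + w := by abel
    rw [e3, add_sub_cancel_left, Real.norm_of_nonneg (by positivity)]
    exact main w hw hw1.le
  exact hO.trans_isLittleO (Asymptotics.isLittleO_norm_pow_id one_lt_two)

end TotalODE

/-! ### Flat metrics are locally Euclidean -/

section Flat

variable {q : ℕ} {G : FormField q} {Ω : Set (Euc q)}

/-- A scalar product on `ℝ^q` is the pull-back of the Euclidean one by a linear map. -/
lemma exists_linear_inner_eq (B : Euc q →L[ℝ] Euc q →L[ℝ] ℝ) (hs : ∀ u v, B u v = B v u)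
    (hp : ∀ u, u ≠ 0 → 0 < B u u) :
    ∃ Θ : Euc q →L[ℝ] Euc q, ∀ u v, B u v = inner ℝ (Θ u) (Θ v) := by
  let B' : LinearMap.BilinForm ℝ (Euc q) := LinearMap.mk₂ ℝ (fun u v => B u v)
    (by simp) (by simp) (by simp) (by simp)
  have hB' : ∀ u v, B' u v = B u v := fun u v => rfl
  obtain ⟨b₀, hb₀⟩ := LinearMap.BilinForm.exists_orthogonal_basis (B := B') ⟨fun u v => hs u v⟩
  let b := b₀.reindex (finCongr (finrank_euclideanSpace_fin (𝕜 := ℝ) (n := q)))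
  have hb : ∀ i j, i ≠ j → B (b i) (b j) = 0 := by
    intro i j hij
    have := hb₀ (i := (finCongr (finrank_euclideanSpace_fin (𝕜 := ℝ) (n := q))).symm i)
      (j := (finCongr (finrank_euclideanSpace_fin (𝕜 := ℝ) (n := q))).symm j) (by simpa using hij)
    simpa [b, Function.onFun, hB'] using this
  let Θ : Euc q →ₗ[ℝ] Euc q :=
    (WithLp.linearEquiv 2 ℝ (Fin q → ℝ)).symm.toLinearMap ∘ₗ
      LinearMap.pi fun i => Real.sqrt (B (b i) (b i)) • b.coord i
  have hΘ : ∀ u i, Θ u i = Real.sqrt (B (b i) (b i)) * b.repr u i := fun u i => rfl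
  refine ⟨LinearMap.toContinuousLinearMap Θ, fun u v => ?_⟩
  have h1 : B u v = ∑ i, ∑ j, b.repr u i * (b.repr v j * B (b i) (b j)) := by
    conv_lhs => rw [← b.sum_repr u, ← b.sum_repr v]
    simp only [map_sum, map_smul, sum_apply, smul_apply, smul_eq_mul, Finset.mul_sum]
    rw [Finset.sum_comm]
    exact Finset.sum_congr rfl fun i _ => Finset.sum_congr rfl fun j _ => by ring
  rw [h1, LinearMap.coe_toContinuousLinearMap', PiLp.inner_apply]
  refine Finset.sum_congr rfl fun i _ => ?_
  rw [Finset.sum_eq_single i (fun j _ hj => by rw [hb i j hj.symm]; ring) (by simp)]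
  rw [hΘ, hΘ]
  have hs : Real.sqrt (B (b i) (b i)) * Real.sqrt (B (b i) (b i)) = B (b i) (b i) :=
    Real.mul_self_sqrt (hp _ (b.ne_zero i)).le
  simp only [RCLike.inner_apply, conj_trivial]
  linear_combination (-(b.repr u i * b.repr v i)) * hs

/-- The Euclidean metric as a constant field of forms. -/
noncomputable def euclideanForm (q : ℕ) : FormField q := fun _ => innerSL ℝ

lemma euclideanForm_apply (z u v : Euc q) : euclideanForm q z u v = inner ℝ u v := rfl

lemma isRiemannianOn_euclideanForm : IsRiemannianOn (euclideanForm q) univ where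
  isOpen := isOpen_univ
  smooth := contDiffOn_const
  symm _ _ u v := by simp [euclideanForm_apply, real_inner_comm]
  pos _ _ u hu := by rw [euclideanForm_apply]; exact real_inner_self_pos.2 hu

lemma christoffelCLM_euclideanForm (z : Euc q) : christoffelCLM (euclideanForm q) z = 0 := by
  have h : fderiv ℝ (euclideanForm q) z = 0 := by
    unfold euclideanForm
    simp
  simp [christoffelCLM, koszulCLM, h]

/-- Solutions of a linear total differential equation with smooth coefficients are smooth. -/
lemma contDiffOn_of_total_equation {E F : Type*} [NormedAddCommGroup E] [NormedSpace ℝ E]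
    [NormedAddCommGroup F] [NormedSpace ℝ F] {A : E → E →L[ℝ] F →L[ℝ] F} {s : Set E} {θ : E → F}
    (hs : IsOpen s) (hA : ContDiffOn ℝ ∞ A s)
    (hθ : ∀ z ∈ s, HasFDerivAt θ ((A z).flip (θ z)) z) : ContDiffOn ℝ ∞ θ s := by
  rw [contDiffOn_infty]
  intro m
  induction m with
  | zero =>
    exact contDiffOn_zero.2 fun z hz => (hθ z hz).continuousAt.continuousWithinAt
  | succ m ih =>
    push_cast
    rw [contDiffOn_succ_iff_fderiv_of_isOpen hs]
    refine ⟨fun z hz => (hθ z hz).differentiableAt.differentiableWithinAt, by simp, ?_⟩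
    have h1 : ContDiffOn ℝ m (fun z => (A z).flip) s :=
      contDiff_clm_flip.comp_contDiffOn (hA.of_le (by exact_mod_cast le_top))
    exact (h1.clm_apply ih).congr fun z hz => (hθ z hz).fderiv

lemma differentiableAt_bilinearComp {E F : Type*} [NormedAddCommGroup E] [NormedSpace ℝ E]
    [NormedAddCommGroup F] [NormedSpace ℝ F] (B : F →L[ℝ] F →L[ℝ] ℝ) {Θ : E → F →L[ℝ] F} {z : E}
    (h : DifferentiableAt ℝ Θ z) :
    DifferentiableAt ℝ (fun y => B.bilinearComp (Θ y) (Θ y)) z := by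
  have h3 : DifferentiableAt ℝ (fun z => (B.comp (Θ z)).flip) z :=
    ((contDiff_clm_flip (m := 1)).differentiable (by simp)).differentiableAt.comp z
      ((differentiableAt_const B).clm_comp h)
  exact ((contDiff_clm_flip (m := 1)).differentiable (by simp)).differentiableAt.comp z
    (h3.clm_comp h)

/-- A parallel coframe which is orthonormal at the centre of a ball is orthonormal on the ball. -/
lemma IsRiemannianOn.eq_pullback_of_parallel {z₀ : Euc q} {ε C : ℝ}
    (hG : IsRiemannianOn G (Metric.ball z₀ ε)) {Θ : Euc q → Euc q →L[ℝ] Euc q}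
    (hΘ : ∀ z ∈ Metric.ball z₀ ε, DifferentiableAt ℝ Θ z)
    (hΘd : ∀ z ∈ Metric.ball z₀ ε, ∀ u v, fderiv ℝ Θ z u v = Θ z (christoffelCLM G z u v))
    (hC : ∀ z ∈ Metric.ball z₀ ε, ‖christoffelCLM G z‖ ≤ C)
    (h0 : ∀ u v, G z₀ u v = inner ℝ (Θ z₀ u) (Θ z₀ v)) :
    ∀ z ∈ Metric.ball z₀ ε, ∀ u v, G z u v = inner ℝ (Θ z u) (Θ z v) := by
  have h1 : ∀ z ∈ Metric.ball z₀ ε, DifferentiableAt ℝ G z := fun z hz =>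
    (hG.contDiffAt hz).differentiableAt (by simp)
  set M : FormField q := fun z => G z - (euclideanForm q 0).bilinearComp (Θ z) (Θ z) with hM
  have hd : ∀ z ∈ Metric.ball z₀ ε, DifferentiableAt ℝ M z := fun z hz =>
    (h1 z hz).sub (differentiableAt_bilinearComp _ (hΘ z hz))
  have hMa : ∀ z u v, M z u v = G z u v - inner ℝ (Θ z u) (Θ z v) := fun z u v => rfl
  suffices H : ∀ z ∈ Metric.ball z₀ ε, M z = 0 by
    intro z hz u v
    rw [← sub_eq_zero, ← hMa, H z hz]
    rfl
  refine eq_zero_of_norm_fderiv_le (C := 2 * C) (fun z hz => (hd z hz).hasFDerivAt) ?_ (by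
    ext u v
    rw [hMa, h0]
    simp)
  intro z hz
  have key : ∀ a u v, fderiv ℝ M z a u v =
      M z (christoffelCLM G z a u) v + M z u (christoffelCLM G z a v) := by
    intro a u v
    have e1 := ((hd z hz).hasFDerivAt.clm_apply (hasFDerivAt_const u z)).clm_apply
      (hasFDerivAt_const v z)
    have e2 := (((h1 z hz).hasFDerivAt.clm_apply (hasFDerivAt_const u z)).clm_apply
      (hasFDerivAt_const v z)).sub
      (((hΘ z hz).hasFDerivAt.clm_apply (hasFDerivAt_const u z)).inner ℝ
      ((hΘ z hz).hasFDerivAt.clm_apply (hasFDerivAt_const v z)))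
    have e3 := congrArg (fun L => L a) (e1.unique e2)
    simp only [hΘd z hz, fderivInnerCLM_apply, add_apply, sub_apply,
      ContinuousLinearMap.comp_apply, ContinuousLinearMap.flip_apply, zero_apply, map_zero,
      zero_add, ContinuousLinearMap.prod_apply] at e3
    rw [hMa, hMa, e3, hG.fderiv_eq hz]
    ring
  have hC0 : 0 ≤ C := (norm_nonneg _).trans (hC z hz)
  have hn : ∀ a b, ‖christoffelCLM G z a b‖ ≤ C * ‖a‖ * ‖b‖ := fun a b =>
    (ContinuousLinearMap.le_opNorm₂ _ _ _).trans (by gcongr; exact hC z hz)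
  refine ContinuousLinearMap.opNorm_le_bound _ (by positivity) fun a => ?_
  refine ContinuousLinearMap.opNorm_le_bound _ (by positivity) fun u => ?_
  refine ContinuousLinearMap.opNorm_le_bound _ (by positivity) fun v => ?_
  rw [key]
  calc _ ≤ ‖M z‖ * (C * ‖a‖ * ‖u‖) * ‖v‖ + ‖M z‖ * ‖u‖ * (C * ‖a‖ * ‖v‖) := by
        refine norm_add_le_of_le ((ContinuousLinearMap.le_opNorm₂ _ _ _).trans ?_)
          ((ContinuousLinearMap.le_opNorm₂ _ _ _).trans ?_)
        · gcongr; exact hn a u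
        · gcongr; exact hn a v
    _ = _ := by ring

set_option maxHeartbeats 800000 in
/-- A flat metric is locally isometric to the Euclidean one: a parallel coframe is closed, and its
primitive is a local isometry. -/
theorem IsRiemannianOn.exists_isometry (hG : IsRiemannianOn G Ω)
    (hR : ∀ z ∈ Ω, riemannCLM G z = 0) {z₀ : Euc q} (hz₀ : z₀ ∈ Ω) :
    ∃ ε > 0, ∃ f : Euc q → Euc q,
      IsHomothetyOn G (Metric.ball z₀ ε) (euclideanForm q) univ f 1 := by
  set Γ := christoffelCLM G with hΓ
  -- the equation `DΘ_z (u) = Θ_z ∘ Γ_z (u)` of parallel coframes, in the form `DΘ_z (u) = A_z (u) Θ_z`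
  let K := (ContinuousLinearMap.compL ℝ (Euc q) (Euc q) (Euc q)).flip
  let A : Euc q → Euc q →L[ℝ] (Euc q →L[ℝ] Euc q) →L[ℝ] (Euc q →L[ℝ] Euc q) :=
    fun z => K.comp (Γ z)
  have hA : ∀ z ∈ Ω, ContDiffAt ℝ ∞ A z := fun z hz =>
    contDiffAt_const.clm_comp (hG.contDiffAt_christoffel hz)
  have hAd : ∀ z ∈ Ω, ∀ u v, fderiv ℝ A z u v = K (fderiv ℝ Γ z u v) := by
    intro z hz u v
    have h := (hasFDerivAt_const K z).clm_comp (hG.differentiableAt_christoffel hz).hasFDerivAt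
    rw [h.fderiv]
    simp [hΓ]
  -- its integrability condition is the vanishing of the curvature
  have hint : ∀ z ∈ Ω, ∀ u v, fderiv ℝ A z u v + (A z v).comp (A z u) =
      fderiv ℝ A z v u + (A z u).comp (A z v) := by
    intro z hz u v
    rw [hAd z hz, hAd z hz]
    ext Θ w : 2
    have h := congrArg (fun T => T u v w) (hR z hz)
    simp only [riemannCLM_apply, zero_apply] at h
    rw [sub_eq_zero, sub_add_eq_add_sub, sub_eq_iff_eq_add] at h
    have h2 := congrArg Θ h
    simp only [map_add] at h2
    simp only [add_apply, ContinuousLinearMap.comp_apply, A, K, ContinuousLinearMap.flip_apply,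
      ContinuousLinearMap.compL_apply]
    rw [h2, add_comm]
  obtain ⟨Θ₀, hΘ₀⟩ := exists_linear_inner_eq (G z₀) (hG.symm z₀ hz₀) (hG.pos z₀ hz₀)
  obtain ⟨ε₁, hε₁, Θ, hΘ0, hΘ⟩ := exists_total_solution ((hA z₀ hz₀).of_le two_le_infty)
    (Filter.mem_of_superset (hG.isOpen.mem_nhds hz₀) hint) Θ₀
  have hev : ∀ᶠ z in 𝓝 z₀, z ∈ Ω ∧ ‖Γ z‖ < ‖Γ z₀‖ + 1 :=
    Filter.Eventually.and (hG.isOpen.mem_nhds hz₀)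
      ((hG.contDiffAt_christoffel hz₀).continuousAt.norm.eventually_lt_const (lt_add_one _))
  obtain ⟨ε₂, hε₂, hball⟩ := Metric.eventually_nhds_iff_ball.1 hev
  set ε := min ε₁ ε₂
  have hsub1 : Metric.ball z₀ ε ⊆ Metric.ball z₀ ε₁ := Metric.ball_subset_ball (min_le_left _ _)
  have hsub2 : Metric.ball z₀ ε ⊆ Metric.ball z₀ ε₂ := Metric.ball_subset_ball (min_le_right _ _)
  have hΩ : Metric.ball z₀ ε ⊆ Ω := fun z hz => (hball z (hsub2 hz)).1
  have hΘd : ∀ z ∈ Metric.ball z₀ ε, ∀ u v, fderiv ℝ Θ z u v = Θ z (Γ z u v) := by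
    intro z hz u v
    rw [(hΘ z (hsub1 hz)).fderiv]
    simp [A, K]
  -- the coframe is orthonormal, since this holds at `z₀` and the connection is metric
  have hmet : ∀ z ∈ Metric.ball z₀ ε, ∀ u v, G z u v = inner ℝ (Θ z u) (Θ z v) :=
    (hG.mono hΩ Metric.isOpen_ball).eq_pullback_of_parallel
      (fun z hz => (hΘ z (hsub1 hz)).differentiableAt) hΘd
      (fun z hz => (hball z (hsub2 hz)).2.le) (by rw [hΘ0]; exact hΘ₀)
  -- the coframe is closed, since the connection is torsion free
  obtain ⟨f, hf⟩ := (convex_ball z₀ ε).exists_forall_hasFDerivAt_of_fderiv_symmetric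
    Metric.isOpen_ball
    (fun z hz => (hΘ z (hsub1 hz)).differentiableAt.differentiableWithinAt)
    (fun z hz u v => by rw [hΘd z hz, hΘd z hz, hΓ, hG.christoffel_symm (hΩ hz)])
  have hΘs : ContDiffOn ℝ ∞ Θ (Metric.ball z₀ ε) :=
    contDiffOn_of_total_equation Metric.isOpen_ball
      (fun z hz => (hA z (hΩ hz)).contDiffWithinAt) (fun z hz => hΘ z (hsub1 hz))
  refine ⟨ε, lt_min hε₁ hε₂, f, hG.mono hΩ Metric.isOpen_ball, isRiemannianOn_euclideanForm, ?_,
    mapsTo_univ _ _, one_pos, ?_⟩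
  · rw [contDiffOn_infty_iff_fderiv_of_isOpen Metric.isOpen_ball]
    exact ⟨fun z hz => (hf z hz).differentiableAt.differentiableWithinAt,
      hΘs.congr fun z hz => (hf z hz).fderiv⟩
  · intro z hz u v
    rw [(hf z hz).fderiv, one_mul, euclideanForm_apply, hmet z hz]

/-- Two homotheties from the same metric to the Euclidean one differ locally by a similarity: their
differentials are parallel coframes, hence they are related by a constant linear map. -/
theorem IsHomothetyOn.exists_similarity {e₁ e₂ : Euc q → Euc q} {c₁ c₂ : ℝ}
    (h₁ : IsHomothetyOn G Ω (euclideanForm q) univ e₁ c₁)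
    (h₂ : IsHomothetyOn G Ω (euclideanForm q) univ e₂ c₂) {z₀ : Euc q} (hz₀ : z₀ ∈ Ω) :
    ∃ s : Euc q → Euc q, IsEuclideanSimilarity s ∧ ∀ᶠ z in 𝓝 z₀, e₂ z = s (e₁ z) := by
  set Γ := christoffelCLM G with hΓ
  have hG := h₁.source
  let φ : Euc q ≃L[ℝ] Euc q := (LinearEquiv.ofInjectiveEndo (fderiv ℝ e₁ z₀).toLinearMap
    (h₁.injective hz₀)).toContinuousLinearEquiv
  have hφ : ∀ u, φ u = fderiv ℝ e₁ z₀ u := fun u => rfl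
  let L₀ : Euc q →L[ℝ] Euc q := (fderiv ℝ e₂ z₀).comp φ.symm.toContinuousLinearMap
  have hL₀ : ∀ u, L₀ (fderiv ℝ e₁ z₀ u) = fderiv ℝ e₂ z₀ u := by
    intro u
    rw [← hφ]
    simp [L₀]
  have hev : ∀ᶠ z in 𝓝 z₀, z ∈ Ω ∧ ‖Γ z‖ < ‖Γ z₀‖ + 1 :=
    Filter.Eventually.and (hG.isOpen.mem_nhds hz₀)
      ((hG.contDiffAt_christoffel hz₀).continuousAt.norm.eventually_lt_const (lt_add_one _))
  obtain ⟨ε, hε, hball⟩ := Metric.eventually_nhds_iff_ball.1 hev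
  -- the differential of a homothety to the Euclidean metric is a parallel coframe
  have hd2 : ∀ {e : Euc q → Euc q} {c : ℝ} (h : IsHomothetyOn G Ω (euclideanForm q) univ e c),
      ∀ z ∈ Ω, DifferentiableAt ℝ e z ∧ DifferentiableAt ℝ (fderiv ℝ e) z ∧
        ∀ u v, fderiv ℝ (fderiv ℝ e) z u v = fderiv ℝ e z (Γ z u v) := by
    intro e c h z hz
    refine ⟨(h.contDiffAt hz).differentiableAt (by simp),
      ((h.contDiffAt hz).fderiv_right (m := ∞) (by simp)).differentiableAt (by simp),
      fun u v => ?_⟩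
    rw [h.fderiv_christoffel hz, christoffelCLM_euclideanForm]
    simp
  have hM : ∀ z ∈ Metric.ball z₀ ε, fderiv ℝ e₂ z - L₀.comp (fderiv ℝ e₁ z) = 0 := by
    have hder : ∀ z ∈ Metric.ball z₀ ε,
        HasFDerivAt (fun z => fderiv ℝ e₂ z - L₀.comp (fderiv ℝ e₁ z))
          ((ContinuousLinearMap.compL ℝ (Euc q) (Euc q) (Euc q)
            (fderiv ℝ e₂ z - L₀.comp (fderiv ℝ e₁ z))).comp (Γ z)) z := by
      intro z hz
      obtain ⟨-, a1, a2⟩ := hd2 h₁ z (hball z hz).1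
      obtain ⟨-, b1, b2⟩ := hd2 h₂ z (hball z hz).1
      refine (b1.hasFDerivAt.sub ((hasFDerivAt_const L₀ z).clm_comp a1.hasFDerivAt)).congr_fderiv ?_
      ext u v : 2
      simp [a2, b2]
    refine eq_zero_of_norm_fderiv_le (C := ‖Γ z₀‖ + 1) hder ?_ ?_
    · intro z hz
      refine (ContinuousLinearMap.opNorm_comp_le _ _).trans ?_
      rw [mul_comm]
      gcongr
      · exact (hball z hz).2.le
      · exact ContinuousLinearMap.opNorm_le_bound _ (norm_nonneg _) fun T =>
          ContinuousLinearMap.opNorm_comp_le _ _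
    · ext u : 1
      simp [hL₀]
  have hconst : ∀ z ∈ Metric.ball z₀ ε, e₂ z - L₀ (e₁ z) = e₂ z₀ - L₀ (e₁ z₀) := by
    intro z hz
    refine (convex_ball z₀ ε).is_const_of_fderivWithin_eq_zero (𝕜 := ℝ)
      (f := fun z => e₂ z - L₀ (e₁ z)) ?_ ?_ hz (Metric.mem_ball_self hε)
    · intro y hy
      have a := (hd2 h₁ y (hball y hy).1).1
      have b := (hd2 h₂ y (hball y hy).1).1
      exact (b.sub (L₀.differentiableAt.comp y a)).differentiableWithinAt
    · intro y hy
      have a := (hd2 h₁ y (hball y hy).1).1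
      have b := (hd2 h₂ y (hball y hy).1).1
      have h := (b.hasFDerivAt.sub (L₀.hasFDerivAt.comp y a.hasFDerivAt)).congr_fderiv (hM y hy)
      rw [fderivWithin_of_isOpen Metric.isOpen_ball hy]
      exact h.fderiv
  have hc : 0 < c₁ / c₂ := div_pos h₁.pos h₂.pos
  have hinner : ∀ u v, inner ℝ (L₀ u) (L₀ v) = c₁ / c₂ * inner ℝ u v := by
    intro u v
    obtain ⟨a, rfl⟩ := h₁.surjective hz₀ u
    obtain ⟨b, rfl⟩ := h₁.surjective hz₀ v
    have e1 := h₁.eq z₀ hz₀ a b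
    rw [h₂.eq z₀ hz₀ a b, euclideanForm_apply, euclideanForm_apply] at e1
    rw [hL₀, hL₀, div_mul_eq_mul_div, eq_div_iff h₂.pos.ne', ← e1]
    ring
  set r := Real.sqrt (c₁ / c₂) with hr
  have hr0 : 0 < r := Real.sqrt_pos.2 hc
  have hr2 : r * r = c₁ / c₂ := Real.mul_self_sqrt hc.le
  let I : Euc q →ₗᵢ[ℝ] Euc q := ⟨(r⁻¹ • L₀).toLinearMap, by
    intro u
    have h1 : ‖L₀ u‖ = r * ‖u‖ := by
      rw [← sq_eq_sq₀ (norm_nonneg _) (by positivity), ← real_inner_self_eq_norm_sq, hinner,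
        mul_pow, ← real_inner_self_eq_norm_sq, sq, hr2]
    simp only [ContinuousLinearMap.coe_coe, smul_apply, norm_smul, h1]
    rw [Real.norm_of_nonneg (by positivity)]
    field_simp⟩
  have hI : ∀ u, r • I u = L₀ u := by
    intro u
    change r • r⁻¹ • L₀ u = L₀ u
    rw [smul_smul, mul_inv_cancel₀ hr0.ne', one_smul]
  refine ⟨fun w => r • I.toLinearIsometryEquiv rfl w + (e₂ z₀ - L₀ (e₁ z₀)),
    ⟨r, I.toLinearIsometryEquiv rfl, _, hr0, fun w => rfl⟩, ?_⟩
  filter_upwards [Metric.ball_mem_nhds z₀ hε] with z hz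
  rw [LinearIsometry.coe_toLinearIsometryEquiv, hI, ← hconst z hz]
  abel

end Flat

/-! ### Compact pseudogroups of local homotheties -/

section Pseudogroup

variable {q : ℕ}

/-- The maximal distortion of a linear map, when forms are compared with the Euclidean norm. -/
lemma norm_map_le_of_form {B B' : Euc q →L[ℝ] Euc q →L[ℝ] ℝ} {L : Euc q →L[ℝ] Euc q} {C μ : ℝ}
    (hC : 0 ≤ C) (hμ : 0 ≤ μ) (h : ∀ u, ‖u‖ ^ 2 ≤ C * B' u u) (h' : ∀ u, B u u ≤ C * ‖u‖ ^ 2)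
    (hL : ∀ u, B' (L u) (L u) = μ * B u u) (u : Euc q) : ‖L u‖ ≤ C * Real.sqrt μ * ‖u‖ := by
  rw [← sq_le_sq₀ (norm_nonneg _) (by positivity)]
  calc ‖L u‖ ^ 2 ≤ C * (μ * B u u) := by rw [← hL]; exact h _
    _ ≤ C * (μ * (C * ‖u‖ ^ 2)) := by gcongr; exact h' u
    _ = (C * Real.sqrt μ * ‖u‖) ^ 2 := by rw [mul_pow, mul_pow, Real.sq_sqrt hμ]; ring

/-- A lower bound for a linear map, when forms are compared with the Euclidean norm. -/
lemma norm_le_map_of_form {B B' : Euc q →L[ℝ] Euc q →L[ℝ] ℝ} {L : Euc q →L[ℝ] Euc q} {C μ : ℝ}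
    (hC : 0 ≤ C) (hμ : 0 < μ) (h : ∀ u, ‖u‖ ^ 2 ≤ C * B u u) (h' : ∀ u, B' u u ≤ C * ‖u‖ ^ 2)
    (hL : ∀ u, B' (L u) (L u) = μ * B u u) (u : Euc q) :
    ‖u‖ * Real.sqrt μ ≤ C * ‖L u‖ := by
  rw [← sq_le_sq₀ (by positivity) (by positivity)]
  calc (‖u‖ * Real.sqrt μ) ^ 2 = ‖u‖ ^ 2 * μ := by rw [mul_pow, Real.sq_sqrt hμ.le]
    _ ≤ C * B u u * μ := by gcongr; exact h u
    _ = C * B' (L u) (L u) := by rw [hL]; ring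
    _ ≤ C * (C * ‖L u‖ ^ 2) := by gcongr; exact h' _
    _ = (C * ‖L u‖) ^ 2 := by ring

/-- A `(1, 3)`-tensor which is preserved by a homothety of ratio `√μ` has its norm multiplied by
`μ⁻¹`. -/
lemma norm_tensor_le_of_form {B B' : Euc q →L[ℝ] Euc q →L[ℝ] ℝ}
    {R R' : Euc q →L[ℝ] Euc q →L[ℝ] Euc q →L[ℝ] Euc q} {L : Euc q →L[ℝ] Euc q} {C μ : ℝ}
    (hC : 0 ≤ C) (hμ : 0 < μ)
    (h : ∀ u, ‖u‖ ^ 2 ≤ C * B u u ∧ B u u ≤ C * ‖u‖ ^ 2)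
    (h' : ∀ u, ‖u‖ ^ 2 ≤ C * B' u u ∧ B' u u ≤ C * ‖u‖ ^ 2)
    (hL : ∀ u, B' (L u) (L u) = μ * B u u)
    (hR : ∀ u v w, R' (L u) (L v) (L w) = L (R u v w)) : ‖R‖ ≤ C ^ 4 * μ * ‖R'‖ := by
  have h1 := norm_map_le_of_form hC hμ.le (fun u => (h' u).1) (fun u => (h u).2) hL
  have h2 := norm_le_map_of_form hC hμ (fun u => (h u).1) (fun u => (h' u).2) hL
  have hs : 0 < Real.sqrt μ := Real.sqrt_pos.2 hμ
  refine ContinuousLinearMap.opNorm_le_bound _ (by positivity) fun u => ?_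
  refine ContinuousLinearMap.opNorm_le_bound _ (by positivity) fun v => ?_
  refine ContinuousLinearMap.opNorm_le_bound _ (by positivity) fun w => ?_
  refine le_of_mul_le_mul_right ?_ hs
  calc ‖R u v w‖ * Real.sqrt μ ≤ C * ‖L (R u v w)‖ := h2 _
    _ = C * ‖R' (L u) (L v) (L w)‖ := by rw [hR]
    _ ≤ C * (‖R'‖ * ‖L u‖ * ‖L v‖ * ‖L w‖) := by
        gcongr
        exact (ContinuousLinearMap.le_opNorm _ _).trans
          (by gcongr; exact ContinuousLinearMap.le_opNorm₂ _ _ _)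
    _ ≤ C * (‖R'‖ * (C * Real.sqrt μ * ‖u‖) * (C * Real.sqrt μ * ‖v‖)
          * (C * Real.sqrt μ * ‖w‖)) := by
        gcongr
        exacts [h1 u, h1 v, h1 w]
    _ = C ^ 4 * (Real.sqrt μ * Real.sqrt μ) * ‖R'‖ * ‖u‖ * ‖v‖ * ‖w‖ * Real.sqrt μ := by ring
    _ = _ := by rw [Real.mul_self_sqrt hμ.le]

variable {A : Type*} {G : A → FormField q} {T K Ω : A → Set (Euc q)} {C r : ℝ}

/-- A local map of the transverse pseudogroup: it is defined on the ball of radius `r` around a point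
`b` of the transversal `T α`, sends `b` to a point `b'` of the transversal `T β`, is a homothety of
constant ratio `√μ` and preserves the curvature. -/
def IsTransition (G : A → FormField q) (T : A → Set (Euc q)) (r : ℝ) (α : A) (b : Euc q) (β : A)
    (b' : Euc q) (μ : ℝ) : Prop :=
  Metric.ball b r ⊆ T α ∧ ∃ h : Euc q → Euc q, h b = b' ∧ ∀ x ∈ Metric.ball b r,
    DifferentiableAt ℝ h x ∧ h x ∈ T β ∧
    (∀ u v, G β (h x) (fderiv ℝ h x u) (fderiv ℝ h x v) = μ * G α x u v) ∧
    ∀ u v w, riemannCLM (G β) (h x) (fderiv ℝ h x u) (fderiv ℝ h x v) (fderiv ℝ h x w) =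
      fderiv ℝ h x (riemannCLM (G α) x u v w)

/-- The metrics `G α` are comparable on `T α` with the Euclidean metric, with the constant `C`. -/
def IsComparable (G : A → FormField q) (T : A → Set (Euc q)) (C : ℝ) : Prop :=
  ∀ α, ∀ b ∈ T α, ∀ u, ‖u‖ ^ 2 ≤ C * G α b u u ∧ G α b u u ≤ C * ‖u‖ ^ 2

lemma isTransition_refl {α : A} {b : Euc q} (hb : Metric.ball b r ⊆ T α) :
    IsTransition G T r α b α b 1 := by
  refine ⟨hb, id, rfl, fun x hx => ⟨differentiableAt_id, hb hx, ?_, ?_⟩⟩ <;> simp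

/-- A transition is Lipschitz, with a constant determined by its ratio. -/
lemma norm_sub_le_of_transition (hC : 0 ≤ C) (hG : IsComparable G T C) {α β : A} {b : Euc q}
    {μ : ℝ} (hμ : 0 ≤ μ) {h : Euc q → Euc q} (hT : Metric.ball b r ⊆ T α)
    (hh : ∀ x ∈ Metric.ball b r, DifferentiableAt ℝ h x ∧ h x ∈ T β ∧
      (∀ u v, G β (h x) (fderiv ℝ h x u) (fderiv ℝ h x v) = μ * G α x u v))
    {x : Euc q} (hx : x ∈ Metric.ball b r) :
    ‖h x - h b‖ ≤ C * Real.sqrt μ * ‖x - b‖ := by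
  have hr : 0 < r := Metric.nonempty_ball.1 ⟨x, hx⟩
  refine (convex_ball b r).norm_image_sub_le_of_norm_fderiv_le (fun y hy => (hh y hy).1)
    (fun y hy => ?_) (Metric.mem_ball_self hr) hx
  exact ContinuousLinearMap.opNorm_le_bound _ (by positivity) (norm_map_le_of_form hC hμ
    (fun u => (hG β _ (hh y hy).2.1 u).1) (fun u => (hG α _ (hT hy) u).2)
    (fun u => (hh y hy).2.2 u u))

/-- Composition of transitions: as long as the ratio of the first one does not exceed one, the radius
of the ball on which the composition is defined does not shrink. -/
lemma IsTransition.trans {r' : ℝ} (hC : 0 < C) (hG : IsComparable G T C) {α β γ : A}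
    {a b c : Euc q} {μ ν : ℝ} (hμ : 0 ≤ μ) (hμ1 : μ ≤ 1) (hr : C * r' ≤ r)
    (h₁ : IsTransition G T r' α a β b μ) (h₂ : IsTransition G T r β b γ c ν) :
    IsTransition G T r' α a γ c (ν * μ) := by
  obtain ⟨hT₁, f, hf, h₁⟩ := h₁
  obtain ⟨hT₂, g, hg, h₂⟩ := h₂
  have hmaps : ∀ x ∈ Metric.ball a r', f x ∈ Metric.ball b r := by
    intro x hx
    have h3 := norm_sub_le_of_transition hC.le hG hμ hT₁
      (fun x hx => ⟨(h₁ x hx).1, (h₁ x hx).2.1, (h₁ x hx).2.2.1⟩) hx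
    rw [hf] at h3
    rw [Metric.mem_ball, dist_eq_norm] at hx ⊢
    calc ‖f x - b‖ ≤ C * Real.sqrt μ * ‖x - a‖ := h3
      _ ≤ C * 1 * ‖x - a‖ := by gcongr; exact Real.sqrt_le_one.2 hμ1
      _ < C * r' := by rw [mul_one]; gcongr
      _ ≤ r := hr
  refine ⟨hT₁, g ∘ f, by simp [hf, hg], fun x hx => ?_⟩
  obtain ⟨a1, a2, a3, a4⟩ := h₁ x hx
  obtain ⟨b1, b2, b3, b4⟩ := h₂ (f x) (hmaps x hx)
  have hfd : fderiv ℝ (g ∘ f) x = (fderiv ℝ g (f x)).comp (fderiv ℝ f x) := fderiv_comp x b1 a1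
  refine ⟨b1.comp x a1, b2, fun u v => ?_, fun u v w => ?_⟩
  · rw [hfd]
    simp only [ContinuousLinearMap.comp_apply, Function.comp_apply]
    rw [b3, a3, mul_assoc]
  · rw [hfd]
    simp only [ContinuousLinearMap.comp_apply, Function.comp_apply]
    rw [b4, a4]

/-- A chain of transitions starting at the point `b₀` of the transversal `T α₀`: the ratio of the
composition of the first `m` transitions is `√(l m)`. -/
structure IsTransitionChain (G : A → FormField q) (T K : A → Set (Euc q)) (r : ℝ) (α₀ : A)
    (b₀ : Euc q) (N : ℕ) (α : ℕ → A) (b : ℕ → Euc q) (l : ℕ → ℝ) : Prop where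
  index_zero : α 0 = α₀
  point_zero : b 0 = b₀
  ratio_zero : l 0 = 1
  mem : ∀ m ≤ N, b m ∈ K (α m)
  pos : ∀ m, 0 < l m
  forward : ∀ m < N, IsTransition G T r (α m) (b m) (α (m + 1)) (b (m + 1)) (l (m + 1) / l m)
  backward : ∀ m < N, IsTransition G T r (α (m + 1)) (b (m + 1)) (α m) (b m) (l m / l (m + 1))

section Chain

variable {α₀ : A} {b₀ : Euc q} {N : ℕ} {α : ℕ → A} {b : ℕ → Euc q} {l : ℕ → ℝ}

/-- The composition of the differentials of a chain of transitions. -/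
lemma IsTransitionChain.exists_linear (hr : 0 < r) (h : IsTransitionChain G T K r α₀ b₀ N α b l) :
    ∀ m ≤ N, ∃ L : Euc q →L[ℝ] Euc q, (∀ u v, G (α m) (b m) (L u) (L v) = l m * G α₀ b₀ u v) ∧
      ∀ u v w, riemannCLM (G (α m)) (b m) (L u) (L v) (L w) = L (riemannCLM (G α₀) b₀ u v w) := by
  intro m
  induction m with
  | zero =>
    intro _
    refine ⟨ContinuousLinearMap.id ℝ _, ?_⟩
    simp [h.index_zero, h.point_zero, h.ratio_zero]
  | succ m ih =>
    intro hm
    obtain ⟨L, hL1, hL2⟩ := ih (by omega)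
    obtain ⟨-, f, hf, hh⟩ := h.forward m (by omega)
    obtain ⟨-, -, h3, h4⟩ := hh (b m) (Metric.mem_ball_self hr)
    rw [hf] at h3 h4
    refine ⟨(fderiv ℝ f (b m)).comp L, fun u v => ?_, fun u v w => ?_⟩
    · simp only [ContinuousLinearMap.comp_apply]
      rw [h3, hL1, ← mul_assoc, div_mul_cancel₀ _ (h.pos m).ne']
    · simp only [ContinuousLinearMap.comp_apply]
      rw [h4, hL2]

/-- If the ratio of a chain is maximal at the end, then the inverse of the chain is defined on a ball
of uniform radius. -/
lemma IsTransitionChain.reverse {r' : ℝ} (hC : 0 < C) (hG : IsComparable G T C) (hr : C * r' ≤ r)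
    (h : IsTransitionChain G T K r α₀ b₀ N α b l) {m₀ : ℕ} (hm₀ : m₀ ≤ N) (hmax : ∀ m ≤ N, l m ≤ l m₀)
    (hb : Metric.ball (b m₀) r' ⊆ T (α m₀)) :
    IsTransition G T r' (α m₀) (b m₀) α₀ b₀ (l m₀)⁻¹ := by
  have key : ∀ j ≤ m₀, IsTransition G T r' (α m₀) (b m₀) (α (m₀ - j)) (b (m₀ - j))
      (l (m₀ - j) / l m₀) := by
    intro j
    induction j with
    | zero =>
      intro _
      rw [Nat.sub_zero, div_self (h.pos _).ne']
      exact isTransition_refl hb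
    | succ j ih =>
      intro hj
      have h1 := ih (by omega)
      have h2 := h.backward (m₀ - (j + 1)) (by omega)
      rw [show m₀ - (j + 1) + 1 = m₀ - j by omega] at h2
      have h3 := h1.trans hC hG (div_nonneg (h.pos _).le (h.pos _).le)
        ((div_le_one (h.pos _)).2 (hmax _ (by omega))) hr h2
      rwa [div_mul_div_cancel₀ (h.pos _).ne'] at h3
  have h1 := key m₀ le_rfl
  rwa [Nat.sub_self, h.index_zero, h.point_zero, h.ratio_zero, one_div] at h1

end Chain

/-- In a compact pseudogroup of homotheties, the ratios of the chains starting at a point of nonzero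
curvature are bounded, and bounded away from zero. The curvature is bounded, which gives the lower
bound. For the upper bound, cut the chain where its ratio is maximal. The inverse of this part is
defined on a ball of uniform radius, and if the ratio is large it sends this ball into a small
neighbourhood of the starting point, where the curvature has no zero. Hence the curvature has no zero
on the ball either, so that its norm at the centre is bounded below by compactness, while a large
ratio would make it small. -/
theorem exists_ratio_bound [Finite A] (hC : 0 < C) (hr : 0 < r)
    (hΩ : ∀ α, IsRiemannianOn (G α) (Ω α)) (hG : IsComparable G T C) (hK : ∀ α, IsCompact (K α))
    (hKΩ : ∀ α, K α ⊆ Ω α) (hKT : ∀ α, ∀ b ∈ K α, Metric.ball b r ⊆ T α)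
    {α₀ : A} {b₀ : Euc q} (hb₀ : b₀ ∈ K α₀) (hR : riemannCLM (G α₀) b₀ ≠ 0) :
    ∃ δ > 0, ∀ N α b l, IsTransitionChain G T K r α₀ b₀ N α b l → l N ≤ δ ∧ δ⁻¹ ≤ l N := by
  have hcont : ∀ α, ContinuousOn (fun z => ‖riemannCLM (G α) z‖) (Ω α) := fun α z hz =>
    (((hΩ α).continuousAt_riemannCLM hz).norm).continuousWithinAt
  -- an upper bound for the curvature
  obtain ⟨S, hS0, hS⟩ : ∃ S > 0, ∀ α, ∀ z ∈ K α, ‖riemannCLM (G α) z‖ ≤ S := by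
    have h1 : ∀ α, ∃ S, ∀ z ∈ K α, ‖riemannCLM (G α) z‖ ≤ S := fun α => by
      obtain ⟨S, hS⟩ := (hK α).bddAbove_image ((hcont α).mono (hKΩ α))
      exact ⟨S, fun z hz => hS (mem_image_of_mem _ hz)⟩
    choose S hS using h1
    obtain ⟨S', hS'⟩ := (finite_range S).bddAbove
    exact ⟨max S' 1, by positivity, fun α z hz =>
      ((hS α z hz).trans (hS' (mem_range_self α))).trans (le_max_left _ _)⟩
  set r' := min r (r / C) with hr'
  have hr'0 : 0 < r' := by positivity
  have hr'r : r' ≤ r := min_le_left _ _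
  have hCr : C * r' ≤ r := by
    calc C * r' ≤ C * (r / C) := by gcongr; exact min_le_right _ _
      _ = r := by field_simp
  -- a lower bound for the curvature at the points far from its zeros
  obtain ⟨ε, hε0, hε⟩ : ∃ ε > 0, ∀ α, ∀ z ∈ K α,
      (∀ x ∈ Metric.ball z r', riemannCLM (G α) x ≠ 0) → ε ≤ ‖riemannCLM (G α) z‖ := by
    have h1 : ∀ α, ∃ ε > 0, ∀ z ∈ K α,
        (∀ x ∈ Metric.ball z r', riemannCLM (G α) x ≠ 0) → ε ≤ ‖riemannCLM (G α) z‖ := by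
      intro α
      set Q := K α ∩ {z | ∀ x ∈ Metric.ball z r', riemannCLM (G α) x ≠ 0} with hQ
      have hQc : IsCompact Q := by
        refine (hK α).inter_right ?_
        rw [← isOpen_compl_iff]
        have : {z | ∀ x ∈ Metric.ball z r', riemannCLM (G α) x ≠ 0}ᶜ =
            ⋃ x ∈ {x | riemannCLM (G α) x = 0}, Metric.ball x r' := by
          ext z
          simp only [mem_compl_iff, mem_ofPred_eq, mem_iUnion, not_forall, not_not, exists_prop,
            Metric.mem_ball]
          exact ⟨fun ⟨x, h1, h2⟩ => ⟨x, h2, by rwa [dist_comm]⟩,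
            fun ⟨x, h1, h2⟩ => ⟨x, by rwa [dist_comm], h1⟩⟩
        rw [this]
        exact isOpen_biUnion fun x _ => Metric.isOpen_ball
      rcases Q.eq_empty_or_nonempty with hQe | hQn
      · refine ⟨1, one_pos, fun z hz hx => ?_⟩
        exact absurd (show z ∈ Q from ⟨hz, hx⟩) (by simp [hQe])
      · obtain ⟨z₀, hz₀, hmin⟩ := hQc.exists_isMinOn hQn
          ((hcont α).mono (inter_subset_left.trans (hKΩ α)))
        exact ⟨‖riemannCLM (G α) z₀‖, norm_pos_iff.2 (hz₀.2 z₀ (Metric.mem_ball_self hr'0)),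
          fun z hz hx => hmin ⟨hz, hx⟩⟩
    choose ε hε0 hε using h1
    cases isEmpty_or_nonempty A with
    | inl h => exact ⟨1, one_pos, fun α => (h.false α).elim⟩
    | inr h =>
      obtain ⟨α₁, hα₁⟩ := Finite.exists_min ε
      exact ⟨ε α₁, hε0 α₁, fun α z hz hx => (hα₁ α).trans (hε α z hz hx)⟩
  obtain ⟨η, hη0, hη⟩ : ∃ η > 0, ∀ x ∈ Metric.ball b₀ η, riemannCLM (G α₀) x ≠ 0 :=
    Metric.eventually_nhds_iff_ball.1
      (((hΩ α₀).continuousAt_riemannCLM (hKΩ _ hb₀)).eventually_ne hR)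
  have hcomp : ∀ α, ∀ z ∈ K α, ∀ u, ‖u‖ ^ 2 ≤ C * G α z u u ∧ G α z u u ≤ C * ‖u‖ ^ 2 :=
    fun α z hz => hG α z (hKT α z hz (Metric.mem_ball_self hr))
  have hR0 : 0 < ‖riemannCLM (G α₀) b₀‖ := norm_pos_iff.2 hR
  set δ₁ := C ^ 4 * S / ε with hδ₁
  set δ₂ := (C * r' / η) ^ 2 with hδ₂
  set δ₃ := C ^ 4 * S / ‖riemannCLM (G α₀) b₀‖ with hδ₃
  have hδ0 : 0 < max (max δ₁ δ₂) δ₃ := lt_max_of_lt_right (by positivity)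
  refine ⟨max (max δ₁ δ₂) δ₃, hδ0, fun N α b l hc => ⟨?_, ?_⟩⟩
  · -- the place `m₀` where the ratio is maximal
    obtain ⟨m₀, hm₀, hmax⟩ := Finset.exists_max_image (Finset.range (N + 1)) l ⟨0, by simp⟩
    have hm₀N : m₀ ≤ N := by simpa [Nat.lt_succ_iff] using hm₀
    have hmax' : ∀ m ≤ N, l m ≤ l m₀ := fun m hm => hmax m (by simpa [Nat.lt_succ_iff] using hm)
    refine (hmax' N le_rfl).trans ((le_max_left _ _).trans' ?_)
    have hl := hc.pos m₀
    have hKm := hc.mem m₀ hm₀N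
    obtain ⟨hT, F, hF, hh⟩ := hc.reverse hC hG hCr hm₀N hmax'
      ((Metric.ball_subset_ball hr'r).trans (hKT _ _ hKm))
    by_cases hsmall : C * Real.sqrt (l m₀)⁻¹ * r' ≤ η
    · refine le_max_of_le_left ?_
      -- the inverse `F` of the chain maps the ball into the set where the curvature does not vanish
      have hne : ∀ x ∈ Metric.ball (b m₀) r', riemannCLM (G (α m₀)) x ≠ 0 := by
        intro x hx h0
        obtain ⟨h1, h2, h3, h4⟩ := hh x hx
        have hlt := norm_sub_le_of_transition hC.le hG (inv_nonneg.2 hl.le) hT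
          (fun x hx => ⟨(hh x hx).1, (hh x hx).2.1, (hh x hx).2.2.1⟩) hx
        have hFx : F x ∈ Metric.ball b₀ η := by
          rw [Metric.mem_ball, dist_eq_norm, ← hF]
          refine hlt.trans_lt (lt_of_lt_of_le ?_ hsmall)
          rw [Metric.mem_ball, dist_eq_norm] at hx
          gcongr
        have hinj : Function.Injective (fderiv ℝ F x) := by
          rw [injective_iff_map_eq_zero]
          intro u hu
          have h5 := norm_le_map_of_form hC.le (inv_pos.2 hl) (fun u => (hG _ _ (hT hx) u).1)
            (fun u => (hG _ _ h2 u).2) (fun u => h3 u u) u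
          rw [hu, norm_zero, mul_zero] at h5
          have h6 : 0 < Real.sqrt (l m₀)⁻¹ := Real.sqrt_pos.2 (inv_pos.2 hl)
          exact norm_le_zero_iff.1 (by nlinarith [norm_nonneg u])
        have hsurj : Function.Surjective (fderiv ℝ F x) :=
          LinearMap.injective_iff_surjective.1
            (hinj : Function.Injective (fderiv ℝ F x).toLinearMap)
        refine hη _ hFx ?_
        ext u v w : 3
        obtain ⟨u, rfl⟩ := hsurj u
        obtain ⟨v, rfl⟩ := hsurj v
        obtain ⟨w, rfl⟩ := hsurj w
        rw [h4, h0]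
        simp
      have h1 := hε _ _ hKm hne
      obtain ⟨-, -, h3, h4⟩ := hh (b m₀) (Metric.mem_ball_self hr'0)
      rw [hF] at h3 h4
      have h5 := norm_tensor_le_of_form hC.le (inv_pos.2 hl) (hcomp _ _ hKm) (hcomp _ _ hb₀)
        (fun u => h3 u u) h4
      have h6 : ε ≤ C ^ 4 * (l m₀)⁻¹ * S := h1.trans (h5.trans (by gcongr; exact hS _ _ hb₀))
      rw [hδ₁, le_div_iff₀ hε0]
      calc l m₀ * ε ≤ l m₀ * (C ^ 4 * (l m₀)⁻¹ * S) := by gcongr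
        _ = C ^ 4 * S := by field_simp
    · refine le_max_of_le_right ?_
      -- a weak contraction bounds the ratio directly
      push Not at hsmall
      have h1 : Real.sqrt (l m₀) ≤ C * r' / η := by
        rw [Real.sqrt_inv] at hsmall
        have h2 : 0 < Real.sqrt (l m₀) := Real.sqrt_pos.2 hl
        rw [le_div_iff₀ hη0]
        calc Real.sqrt (l m₀) * η ≤ Real.sqrt (l m₀) * (C * (Real.sqrt (l m₀))⁻¹ * r') := by gcongr
          _ = C * r' := by field_simp
      calc l m₀ = Real.sqrt (l m₀) ^ 2 := (Real.sq_sqrt hl.le).symm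
        _ ≤ _ := by rw [hδ₂]; gcongr
  · obtain ⟨L, hL1, hL2⟩ := hc.exists_linear hr N le_rfl
    have h5 := norm_tensor_le_of_form hC.le (hc.pos N) (hcomp _ _ hb₀) (hcomp _ _ (hc.mem N le_rfl))
      (fun u => hL1 u u) hL2
    have h6 := h5.trans (mul_le_mul_of_nonneg_left (hS _ _ (hc.mem N le_rfl))
      (by have := hc.pos N; positivity))
    refine (inv_anti₀ (by positivity) (le_max_right _ _)).trans ?_
    rw [hδ₃, inv_div, div_le_iff₀ (by positivity)]
    linarith

end Pseudogroup

/-! ### Foliated charts and transverse metrics in coordinates -/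

namespace Foliation

variable {n p q : ℕ} {M : Type*} [TopologicalSpace M] [ChartedSpace (Euc n) M]

/-- The transverse component of a foliated chart. -/
def transverseCoord (φ : OpenPartialHomeomorph M (Euc p × Euc q)) : M → Euc q := fun y => (φ y).2

/-- The transversal along which the first component of the chart `φ` has the value `a`. -/
def coordSlice (φ : OpenPartialHomeomorph M (Euc p × Euc q)) (a : Euc p) : Euc q → M :=
  fun b => φ.symm (a, b)

/-- The differential of the transverse component of a foliated chart, with values in `ℝ^q`. -/
noncomputable def transverseDeriv (φ : OpenPartialHomeomorph M (Euc p × Euc q)) (y : M) :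
    TangentSpace (𝓡 n) y →L[ℝ] Euc q :=
  mfderiv (𝓡 n) 𝓘(ℝ, Euc q) (transverseCoord φ) y

variable {F : Foliation n p q M} {φ ψ : OpenPartialHomeomorph M (Euc p × Euc q)}

lemma contMDiffAt_chart (hφ : φ ∈ F.atlas) {x : M} (hx : x ∈ φ.source) :
    ContMDiffAt (𝓡 n) 𝓘(ℝ, Euc p × Euc q) ∞ φ x :=
  (F.smooth_chart φ hφ).contMDiffAt (φ.open_source.mem_nhds hx)

lemma contMDiffAt_chart_symm (hφ : φ ∈ F.atlas) {z : Euc p × Euc q} (hz : z ∈ φ.target) :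
    ContMDiffAt 𝓘(ℝ, Euc p × Euc q) (𝓡 n) ∞ φ.symm z :=
  (F.smooth_chart_symm φ hφ).contMDiffAt (φ.open_target.mem_nhds hz)

lemma contMDiffAt_transverseCoord (hφ : φ ∈ F.atlas) {x : M} (hx : x ∈ φ.source) :
    ContMDiffAt (𝓡 n) 𝓘(ℝ, Euc q) ∞ (transverseCoord φ) x :=
  (contDiff_snd.contMDiff (n := ∞)).contMDiffAt.comp x (contMDiffAt_chart hφ hx)

lemma mdifferentiableAt_transverseCoord (hφ : φ ∈ F.atlas) {x : M} (hx : x ∈ φ.source) :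
    MDifferentiableAt (𝓡 n) 𝓘(ℝ, Euc q) (transverseCoord φ) x :=
  (contMDiffAt_transverseCoord hφ hx).mdifferentiableAt (by simp)

lemma transverseDeriv_eq (hφ : φ ∈ F.atlas) {x : M} (hx : x ∈ φ.source)
    (v : TangentSpace (𝓡 n) x) :
    transverseDeriv φ x v =
      (mfderiv (𝓡 n) 𝓘(ℝ, Euc p × Euc q) φ x v : Euc p × Euc q).2 := by
  have h1 : MDifferentiableAt (𝓡 n) 𝓘(ℝ, Euc p × Euc q) φ x :=
    (contMDiffAt_chart hφ hx).mdifferentiableAt (by simp)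
  have h2 : MDifferentiableAt 𝓘(ℝ, Euc p × Euc q) 𝓘(ℝ, Euc q)
      (Prod.snd : Euc p × Euc q → Euc q) (φ x) :=
    mdifferentiableAt_iff_differentiableAt.2 differentiableAt_snd
  have h3 := mfderiv_comp_apply x h2 h1 v
  rw [mfderiv_eq_fderiv, fderiv_snd] at h3
  exact h3

/-- The chain rule for a map into the manifold followed by the transverse coordinate. -/
lemma differentiableAt_transverseCoord_comp {E : Type*} [NormedAddCommGroup E] [NormedSpace ℝ E]
    (hφ : φ ∈ F.atlas) {σ : E → M} {z : E} (hσ : MDifferentiableAt 𝓘(ℝ, E) (𝓡 n) σ z)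
    (hz : σ z ∈ φ.source) :
    DifferentiableAt ℝ (transverseCoord φ ∘ σ) z ∧
    ∀ u : E, fderiv ℝ (transverseCoord φ ∘ σ) z u =
      transverseDeriv φ (σ z) (mfderiv 𝓘(ℝ, E) (𝓡 n) σ z u) := by
  have h1 := mdifferentiableAt_transverseCoord hφ hz
  refine ⟨mdifferentiableAt_iff_differentiableAt.1 (h1.comp z hσ), fun u => ?_⟩
  rw [← mfderiv_eq_fderiv]
  exact mfderiv_comp_apply z h1 hσ u

/-- The tangent space of the leaf is the kernel of the differential of the transverse coordinate of
any foliated chart: along a line of the plaque direction in one chart, the transverse coordinates of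
the other charts are constant. -/
lemma leafTangent_eq (hφ : φ ∈ F.atlas) {x : M} (hx : x ∈ φ.source) :
    F.leafTangent x =
      LinearMap.ker (transverseDeriv φ x).toLinearMap := by
  apply le_antisymm
  · exact (iInf_le _ φ).trans ((iInf_le _ hφ).trans (iInf_le _ hx))
  refine le_iInf fun ψ => le_iInf fun hψ => le_iInf fun hxψ => ?_
  intro v hv
  change transverseDeriv φ x v = 0 at hv
  change transverseDeriv ψ x v = 0
  rw [transverseDeriv_eq hφ hx] at hv
  set w : Euc p × Euc q := mfderiv (𝓡 n) 𝓘(ℝ, Euc p × Euc q) φ x v with hw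
  have hφx : φ x ∈ φ.target := φ.map_source hx
  have hs : MDifferentiableAt 𝓘(ℝ, Euc p × Euc q) (𝓡 n) φ.symm (φ x) :=
    (contMDiffAt_chart_symm hφ hφx).mdifferentiableAt (by simp)
  have hxx : φ.symm (φ x) = x := φ.left_inv hx
  obtain ⟨hd, hd'⟩ := differentiableAt_transverseCoord_comp (φ := ψ) hψ hs (by rwa [hxx])
  -- `v` is the image of `w` under the differential of the inverse of the chart
  have hvw : transverseDeriv ψ x v =
      fderiv ℝ (transverseCoord ψ ∘ φ.symm) (φ x) w := by
    have h1 : MDifferentiableAt (𝓡 n) 𝓘(ℝ, Euc p × Euc q) φ x :=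
      (contMDiffAt_chart hφ hx).mdifferentiableAt (by simp)
    have h2 : MDifferentiableAt 𝓘(ℝ, Euc p × Euc q) 𝓘(ℝ, Euc q) (transverseCoord ψ ∘ φ.symm)
        (φ x) := mdifferentiableAt_iff_differentiableAt.2 hd
    have h3 := mfderiv_comp_apply x h2 h1 v
    rw [mfderiv_eq_fderiv] at h3
    refine Eq.trans ?_ h3
    have h4 : transverseCoord ψ =ᶠ[𝓝 x] (transverseCoord ψ ∘ φ.symm) ∘ φ := by
      filter_upwards [φ.open_source.mem_nhds hx] with y hy
      simp [φ.left_inv hy]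
    exact congrArg (fun L : Euc n →L[ℝ] Euc q => L v) (h4.mfderiv_eq (I := 𝓡 n) (I' := 𝓘(ℝ, Euc q)))
  rw [hvw]
  obtain ⟨V, hV, hpl⟩ := F.plaques φ hφ ψ hψ x ⟨hx, hxψ⟩
  have hline : HasDerivAt (fun t : ℝ => φ x + t • w) w 0 := by
    simpa using ((hasDerivAt_id (0 : ℝ)).smul_const w).const_add (φ x)
  have h1 : HasDerivAt (fun t : ℝ => (transverseCoord ψ ∘ φ.symm) (φ x + t • w))
      (fderiv ℝ (transverseCoord ψ ∘ φ.symm) (φ x) w) 0 := by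
    have : HasFDerivAt (transverseCoord ψ ∘ φ.symm) (fderiv ℝ (transverseCoord ψ ∘ φ.symm) (φ x))
      (φ x + (0 : ℝ) • w) := by simpa using hd.hasFDerivAt
    exact this.comp_hasDerivAt 0 hline
  have hc : ContinuousAt (fun t : ℝ => φ.symm (φ x + t • w)) 0 := by
    have h2 : ContinuousAt φ.symm (φ x + (0 : ℝ) • w) := by
      simpa using φ.continuousAt_symm hφx
    exact ContinuousAt.comp (f := fun t : ℝ => φ x + t • w) h2 hline.continuousAt
  have hc0 : φ.symm (φ x + (0 : ℝ) • w) = x := by simpa using hxx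
  have hev1 : ∀ᶠ t : ℝ in 𝓝 0, φ.symm (φ x + t • w) ∈ V :=
    hc.eventually (show V ∈ 𝓝 (φ.symm (φ x + (0 : ℝ) • w)) by rwa [hc0])
  have hev2 : ∀ᶠ t : ℝ in 𝓝 0, φ x + t • w ∈ φ.target :=
    hline.continuousAt.eventually (φ.open_target.mem_nhds (by simpa using hφx))
  have h2 : (fun t : ℝ => (transverseCoord ψ ∘ φ.symm) (φ x + t • w)) =ᶠ[𝓝 0]
      fun _ => transverseCoord ψ x := by
    filter_upwards [hev1, hev2] with t ht1 ht2
    refine hpl _ ht1 _ (mem_of_mem_nhds hV) ?_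
    have hv0 : w.2 = (0 : Euc q) := hv
    rw [φ.right_inv ht2, Prod.snd_add, Prod.smul_snd, hv0, smul_zero, add_zero]
  have h3 : HasDerivAt (fun t : ℝ => (transverseCoord ψ ∘ φ.symm) (φ x + t • w)) 0 0 :=
    (hasDerivAt_const (0 : ℝ) (transverseCoord ψ x)).congr_of_eventuallyEq h2
  exact h1.unique h3

lemma contMDiffAt_coordSlice (hφ : φ ∈ F.atlas) {a : Euc p} {b : Euc q} (h : (a, b) ∈ φ.target) :
    ContMDiffAt 𝓘(ℝ, Euc q) (𝓡 n) ∞ (coordSlice φ a) b := by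
  have h1 : ContMDiffAt 𝓘(ℝ, Euc q) 𝓘(ℝ, Euc p × Euc q) ∞ (fun b : Euc q => (a, b)) b :=
    (contDiff_const.prodMk contDiff_id).contMDiff.contMDiffAt
  exact ContMDiffAt.comp b (contMDiffAt_chart_symm hφ h) h1

lemma transverseDeriv_of_section (hφ : φ ∈ F.atlas) {σ : Euc q → M} {z : Euc q}
    (hσ : MDifferentiableAt 𝓘(ℝ, Euc q) (𝓡 n) σ z) (hz : σ z ∈ φ.source)
    (hs : ∀ᶠ b in 𝓝 z, transverseCoord φ (σ b) = b) (u : Euc q) :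
    transverseDeriv φ (σ z) (mfderiv 𝓘(ℝ, Euc q) (𝓡 n) σ z u) = u := by
  rw [← (differentiableAt_transverseCoord_comp hφ hσ hz).2 u]
  have h : transverseCoord φ ∘ σ =ᶠ[𝓝 z] id := hs
  rw [h.fderiv_eq, fderiv_id]
  rfl

lemma transverseCoord_coordSlice {a : Euc p} {b : Euc q} (h : (a, b) ∈ φ.target) :
    transverseCoord φ (coordSlice φ a b) = b := by
  simp [transverseCoord, coordSlice, φ.right_inv h]

lemma eventually_transverseCoord_coordSlice {a : Euc p} {b : Euc q} (h : (a, b) ∈ φ.target) :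
    ∀ᶠ b' in 𝓝 b, transverseCoord φ (coordSlice φ a b') = b' := by
  have hc : ContinuousAt (fun b' : Euc q => (a, b')) b := by fun_prop
  filter_upwards [hc.eventually (φ.open_target.mem_nhds h)] with b' hb'
    using transverseCoord_coordSlice hb'

lemma transverseDeriv_coordSlice (hφ : φ ∈ F.atlas) {a : Euc p} {b : Euc q} (h : (a, b) ∈ φ.target)
    (u : Euc q) :
    transverseDeriv φ (coordSlice φ a b)
      (mfderiv 𝓘(ℝ, Euc q) (𝓡 n) (coordSlice φ a) b u) = u :=
  transverseDeriv_of_section hφ ((contMDiffAt_coordSlice hφ h).mdifferentiableAt (by simp))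
    (φ.map_target h) (eventually_transverseCoord_coordSlice h) u

/-- A smooth section of the transverse coordinate of a foliated chart is a transversal. -/
lemma isTransversal_of_section (hφ : φ ∈ F.atlas) {D : Set (Euc q)} (hD : IsOpen D)
    {σ : Euc q → M} (hσ : ∀ z ∈ D, ContMDiffAt 𝓘(ℝ, Euc q) (𝓡 n) ∞ σ z)
    (hsrc : ∀ z ∈ D, σ z ∈ φ.source) (hs : ∀ z ∈ D, transverseCoord φ (σ z) = z) :
    F.IsTransversal D σ where
  isOpen := hD
  smooth := fun z hz => (hσ z hz).contMDiffWithinAt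
  embedding := by
    have hc : Continuous (D.domRestrict σ) :=
      continuousOn_iff_continuous_domRestrict.1 fun z hz => (hσ z hz).continuousAt.continuousWithinAt
    have h1 : Continuous (fun z : D => (⟨σ z, hsrc z z.2⟩ : φ.source)) :=
      Continuous.subtype_mk hc _
    have h2 : Continuous (fun y : φ.source => transverseCoord φ y) :=
      continuous_snd.comp (continuousOn_iff_continuous_domRestrict.1 φ.continuousOn)
    have h3 : (fun y : φ.source => transverseCoord φ y) ∘
        (fun z : D => (⟨σ z, hsrc z z.2⟩ : φ.source)) = Subtype.val := by
      ext1 z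
      exact hs z z.2
    have h4 : Topology.IsEmbedding (fun z : D => (⟨σ z, hsrc z z.2⟩ : φ.source)) :=
      Topology.IsEmbedding.of_comp h1 h2 (by rw [h3]; exact Topology.IsEmbedding.subtypeVal)
    exact Topology.IsEmbedding.subtypeVal.comp h4
  transverse := by
    intro z hz
    have hpd := transverseDeriv_of_section hφ ((hσ z hz).mdifferentiableAt (by simp))
      (hsrc z hz) (Filter.mem_of_superset (hD.mem_nhds hz) hs)
    rw [leafTangent_eq hφ (hsrc z hz)]
    constructor
    · rw [Submodule.disjoint_def]
      rintro _ ⟨u, rfl⟩ hv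
      have h1 : transverseDeriv φ (σ z)
        (mfderiv 𝓘(ℝ, Euc q) (𝓡 n) σ z u) = 0 := hv
      obtain rfl : u = 0 := (hpd u).symm.trans h1
      exact map_zero _
    · rw [codisjoint_iff, eq_top_iff]
      intro v _
      rw [Submodule.mem_sup]
      refine ⟨mfderiv 𝓘(ℝ, Euc q) (𝓡 n) σ z
        (transverseDeriv φ (σ z) v), ⟨_, rfl⟩,
        v - mfderiv 𝓘(ℝ, Euc q) (𝓡 n) σ z
        (transverseDeriv φ (σ z) v), ?_, add_sub_cancel _ _⟩
      change transverseDeriv φ (σ z) (v - _) = 0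
      rw [map_sub]
      exact sub_eq_zero.2 (hpd _).symm

/-- A path inside a plaque of a foliated chart is a leafwise path. -/
lemma isLeafwisePath_of_plaque (hφ : φ ∈ F.atlas) {c : unitInterval → M} (hc : Continuous c)
    (hsrc : ∀ t, c t ∈ φ.source) (hp : ∀ t s, transverseCoord φ (c t) = transverseCoord φ (c s)) :
    F.IsLeafwisePath c := by
  refine ⟨hc, fun t ψ hψ ht => ?_⟩
  obtain ⟨V, hV, hpl⟩ := F.plaques φ hφ ψ hψ (c t) ⟨hsrc t, ht⟩
  filter_upwards [hc.continuousAt.eventually hV] with s hs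
  exact hpl _ hs _ (mem_of_mem_nhds hV) (hp s t)

section Metric

variable [IsManifold (𝓡 n) ∞ M] {U : Set M}

/-- The Cauchy-Schwarz inequality: the radical of the form is the tangent space of the leaf. -/
lemma TransverseMetric.form_eq_zero (g : TransverseMetric F U) {x : M} (hx : x ∈ U)
    {v : TangentSpace (𝓡 n) x} (hv : v ∈ F.leafTangent x) (w : TangentSpace (𝓡 n) x) :
    g.form x v w = 0 := by
  have h0 : g.form x v v = 0 := (g.eq_zero_iff x hx v).2 hv
  have h1 : ∀ t : ℝ, 0 ≤ 2 * t * g.form x v w + g.form x w w := by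
    intro t
    have := g.nonneg x hx (t • v + w)
    simp only [map_add, map_smul, add_apply, smul_apply, smul_eq_mul, h0, g.symm x hx w v] at this
    linarith
  by_contra hne
  have h2 := h1 (-(g.form x w w + 1) / (2 * g.form x v w))
  have h3 : 2 * (-(g.form x w w + 1) / (2 * g.form x v w)) * g.form x v w =
      -(g.form x w w + 1) := by field_simp
  rw [h3] at h2
  linarith

/-- A transverse metric only depends on the images of the vectors in the normal bundle, which is
identified with `ℝ^q` by a chart. -/
lemma TransverseMetric.form_congr (g : TransverseMetric F U) (hφ : φ ∈ F.atlas) {x : M} (hx : x ∈ U)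
    (hxφ : x ∈ φ.source) {v v' w w' : TangentSpace (𝓡 n) x}
    (hv : transverseDeriv φ x v = transverseDeriv φ x v')
    (hw : transverseDeriv φ x w = transverseDeriv φ x w') :
    g.form x v w = g.form x v' w' := by
  have key : ∀ {v v' : TangentSpace (𝓡 n) x} (w : TangentSpace (𝓡 n) x),
      transverseDeriv φ x v = transverseDeriv φ x v' → g.form x v w = g.form x v' w := by
    intro v v' w h
    have h1 : v - v' ∈ F.leafTangent x := by
      rw [leafTangent_eq hφ hxφ]
      change transverseDeriv φ x (v - v') = 0
      rw [map_sub, h, sub_self]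
    have h2 := g.form_eq_zero hx h1 w
    rwa [map_sub, sub_apply, sub_eq_zero] at h2
  rw [key w hv, g.symm x hx, key v' hw, g.symm x hx]

/-- The pull-back of a transverse metric by a map from a normed space. -/
noncomputable def TransverseMetric.pullback {E : Type*} [NormedAddCommGroup E] [NormedSpace ℝ E]
    (g : TransverseMetric F U) (σ : E → M) (z : E) : E →L[ℝ] E →L[ℝ] ℝ :=
  let B : Euc n →L[ℝ] Euc n →L[ℝ] ℝ := g.form (σ z)
  let A : E →L[ℝ] Euc n := mfderiv 𝓘(ℝ, E) (𝓡 n) σ z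
  B.bilinearComp A A

lemma TransverseMetric.restrict_apply (g : TransverseMetric F U) (σ : Euc q → M) (z u v : Euc q) :
    g.restrict σ z u v =
      g.form (σ z) (mfderiv 𝓘(ℝ, Euc q) (𝓡 n) σ z u) (mfderiv 𝓘(ℝ, Euc q) (𝓡 n) σ z v) := rfl

/-- The tangent vectors `dσ_z (u)` form a smooth field along a smooth map `σ`. -/
lemma contMDiffOn_mfderiv_apply {E : Type*} [NormedAddCommGroup E] [NormedSpace ℝ E] {D : Set E}
    (hD : IsOpen D) {σ : E → M} (hσ : ContMDiffOn 𝓘(ℝ, E) (𝓡 n) ∞ σ D) (u : E) :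
    ContMDiffOn 𝓘(ℝ, E) ((𝓡 n).prod 𝓘(ℝ, Euc n)) ∞
      (fun z => (Bundle.TotalSpace.mk' (Euc n) (σ z) (mfderiv 𝓘(ℝ, E) (𝓡 n) σ z u) :
        TangentBundle (𝓡 n) M)) D := by
  have : IsManifold (𝓡 n) 1 M := IsManifold.of_le (n := ∞) (by simp)
  have h1 := hσ.contMDiffOn_tangentMapWithin (m := ∞) (by simp) hD.uniqueMDiffOn
  have h2 : ContMDiffOn 𝓘(ℝ, E) 𝓘(ℝ, E).tangent ∞
      (fun z => (Bundle.TotalSpace.mk' E z u : TangentBundle 𝓘(ℝ, E) E)) D := by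
    exact contMDiffOn_vectorSpace_iff_contDiffOn.2 contDiffOn_const
  refine (h1.comp h2 (fun z hz => hz)).congr fun z hz => ?_
  simp only [Function.comp_apply, tangentMapWithin]
  rw [mfderivWithin_of_isOpen hD hz]

lemma TransverseMetric.contDiffOn_pullback {E : Type*} [NormedAddCommGroup E] [NormedSpace ℝ E]
    [FiniteDimensional ℝ E] (g : TransverseMetric F U) {D : Set E} (hD : IsOpen D) {σ : E → M}
    (hσ : ContMDiffOn 𝓘(ℝ, E) (𝓡 n) ∞ σ D) (hU : MapsTo σ D U) :
    ContDiffOn ℝ ∞ (g.pullback σ) D := by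
  rw [contDiffOn_clm_apply]
  intro u
  rw [contDiffOn_clm_apply]
  intro v
  rw [← contMDiffOn_iff_contDiffOn]
  intro z hz
  have : ContMDiffWithinAt 𝓘(ℝ, E) ((𝓡 n).prod 𝓘(ℝ)) ∞
      (fun z ↦ Bundle.TotalSpace.mk' ℝ (E := Bundle.Trivial M ℝ) (σ z)
        (g.form (σ z) (mfderiv 𝓘(ℝ, E) (𝓡 n) σ z u) (mfderiv 𝓘(ℝ, E) (𝓡 n) σ z v))) D z := by
    apply ContMDiffWithinAt.clm_bundle_apply₂ (F₁ := Euc n) (F₂ := Euc n)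
    · exact (g.smooth.comp hσ hU) z hz
    · exact contMDiffOn_mfderiv_apply hD hσ u z hz
    · exact contMDiffOn_mfderiv_apply hD hσ v z hz
  rw [Bundle.contMDiffWithinAt_totalSpace] at this
  exact this.2

end Metric

end Foliation

/-! ### Metrics induced on transversals -/

namespace Foliation

variable {n p q : ℕ} {M : Type*} [TopologicalSpace M] [ChartedSpace (Euc n) M]
  [IsManifold (𝓡 n) ∞ M] {F : Foliation n p q M} {φ : OpenPartialHomeomorph M (Euc p × Euc q)}
  {U : Set M}

lemma TransverseMetric.form_coordSlice (g : TransverseMetric F U) (hφ : φ ∈ F.atlas) {y : M}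
    {a : Euc p} {b : Euc q} (hab : (a, b) ∈ φ.target) (hy : y = coordSlice φ a b) (hU : y ∈ U)
    (v w : TangentSpace (𝓡 n) y) : g.form y v w = g.restrict (coordSlice φ a) b
      (transverseDeriv φ y v) (transverseDeriv φ y w) := by
  subst hy
  rw [TransverseMetric.restrict_apply]
  exact g.form_congr hφ hU (φ.map_target hab) (transverseDeriv_coordSlice hφ hab _).symm
    (transverseDeriv_coordSlice hφ hab _).symm

lemma eq_coordSlice {y : M} (hy : y ∈ φ.source) :
    y = coordSlice φ (φ y).1 (transverseCoord φ y) :=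
  (φ.left_inv hy).symm

lemma TransverseMetric.form_eq (g : TransverseMetric F U) (hφ : φ ∈ F.atlas) {y : M}
    (hy : y ∈ φ.source) (hU : y ∈ U)
    (v w : TangentSpace (𝓡 n) y) : g.form y v w =
      g.restrict (coordSlice φ (φ y).1) (transverseCoord φ y)
      (transverseDeriv φ y v) (transverseDeriv φ y w) :=
  g.form_coordSlice hφ (φ.map_source hy) (eq_coordSlice hy) hU v w

/-- The metric induced on a transversal only depends on the transverse coordinate and on the metric
induced on the slice of the chart. -/
lemma TransverseMetric.restrict_of_section (g : TransverseMetric F U) (hφ : φ ∈ F.atlas)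
    {σ : Euc q → M} {z : Euc q} (hσ : MDifferentiableAt 𝓘(ℝ, Euc q) (𝓡 n) σ z)
    (hz : σ z ∈ φ.source) (hU : σ z ∈ U) (hs : ∀ᶠ b in 𝓝 z, transverseCoord φ (σ b) = b) :
    g.restrict σ z = g.restrict (coordSlice φ (φ (σ z)).1) z := by
  ext u v
  rw [g.restrict_apply, g.form_eq hφ hz hU, transverseDeriv_of_section hφ hσ hz hs,
    transverseDeriv_of_section hφ hσ hz hs, hs.self_of_nhds]

lemma TransverseMetric.isRiemannianOn_restrict (g : TransverseMetric F U) (hφ : φ ∈ F.atlas)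
    {a : Euc p} {D : Set (Euc q)} (hD : IsOpen D)
    (h : ∀ b ∈ D, (a, b) ∈ φ.target ∧ coordSlice φ a b ∈ U) :
    IsRiemannianOn (g.restrict (coordSlice φ a)) D where
  isOpen := hD
  smooth := g.contDiffOn_pullback hD
    (fun b hb => (contMDiffAt_coordSlice hφ (h b hb).1).contMDiffWithinAt) (fun b hb => (h b hb).2)
  symm b hb u v := g.symm _ (h b hb).2 _ _
  pos b hb u hu := by
    rw [g.restrict_apply]
    refine lt_of_le_of_ne (g.nonneg _ (h b hb).2 _) fun h0 => hu ?_
    have h1 := (g.eq_zero_iff _ (h b hb).2 _).1 h0.symm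
    have hsrc : coordSlice φ a b ∈ φ.source := φ.map_target (h b hb).1
    rw [leafTangent_eq hφ hsrc] at h1
    exact (transverseDeriv_coordSlice hφ (h b hb).1 u).symm.trans h1

end Foliation

namespace TransverseSimilarity

open Foliation

variable {n p q : ℕ} {M : Type*} [TopologicalSpace M] [ChartedSpace (Euc n) M]
  [IsManifold (𝓡 n) ∞ M] {F : Foliation n p q M} {ι : Type*} {S : TransverseSimilarity F ι}
  {φ : OpenPartialHomeomorph M (Euc p × Euc q)}

/-- Inside a box of a foliated chart, the metrics of a holonomy invariant similarity structure do not
depend on the position on the plaque. The plaques are slid by a varying amount, which vanishes at some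
point of the transversal; hence the ratio of the holonomy map is one. -/
lemma HolonomyInvariant.restrict_eq (hS : S.HolonomyInvariant) (hφ : φ ∈ F.atlas) {i : ι}
    {A : Set (Euc p)} (hA : Convex ℝ A) {b₀ : Euc q} {ρ : ℝ}
    (hbox : A ×ˢ Metric.ball b₀ ρ ⊆ φ.target)
    (hU : ∀ a ∈ A, ∀ b ∈ Metric.ball b₀ ρ, coordSlice φ a b ∈ S.U i)
    {a a₁ : Euc p} (ha : a ∈ A) (ha₁ : a₁ ∈ A) {b₁ : Euc q} (hb₁ : b₁ ∈ Metric.ball b₀ ρ) :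
    (S.g i).restrict (coordSlice φ a₁) b₁ = (S.g i).restrict (coordSlice φ a) b₁ := by
  rcases subsingleton_or_nontrivial (Euc q) with hq | hq
  · ext u v
    rw [Subsingleton.elim u 0]
    simp
  obtain ⟨b₂, hb₂, hne⟩ : ∃ b₂ ∈ Metric.ball b₀ ρ, b₂ ≠ b₁ :=
    (infinite_of_mem_nhds b₁ (Metric.isOpen_ball.mem_nhds hb₁)).nontrivial.exists_ne b₁
  have hdist : 0 < dist b₂ b₁ := dist_pos.2 hne
  -- the points of the transversal near `b₁` are slid by `a₁ - a`, the point `b₂` does not move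
  let θ : ContDiffBump b₁ := ⟨dist b₂ b₁ / 2, dist b₂ b₁, by positivity, by linarith⟩
  have hθ1 : θ b₁ = 1 := θ.one_of_mem_closedBall (by simp [θ.rIn_pos.le])
  have hθ2 : θ b₂ = 0 := θ.zero_of_le_dist le_rfl
  have hpt : ∀ s ∈ Icc (0 : ℝ) 1, a + s • (a₁ - a) ∈ A := fun s hs => hA.add_smul_sub_mem ha ha₁ hs
  have hθI : ∀ z, θ z ∈ Icc (0 : ℝ) 1 := fun z => ⟨θ.nonneg, θ.le_one⟩
  let τ : Euc q → M := fun z => φ.symm (a + θ z • (a₁ - a), z)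
  let H : unitInterval × Euc q → M := fun x => φ.symm (a + ((x.1 : ℝ) * θ x.2) • (a₁ - a), x.2)
  have hτt : ∀ z ∈ Metric.ball b₀ ρ, (a + θ z • (a₁ - a), z) ∈ φ.target := fun z hz =>
    hbox ⟨hpt _ (hθI z), hz⟩
  have hτs : ∀ z ∈ Metric.ball b₀ ρ, ContMDiffAt 𝓘(ℝ, Euc q) (𝓡 n) ∞ τ z := by
    intro z hz
    have h1 : ContMDiff 𝓘(ℝ, Euc q) 𝓘(ℝ, Euc p × Euc q) ∞
        (fun z : Euc q => (a + θ z • (a₁ - a), z)) :=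
      ((contDiff_const.add (θ.contDiff.smul contDiff_const)).prodMk contDiff_id).contMDiff
    exact ContMDiffAt.comp z (contMDiffAt_chart_symm hφ (hτt z hz)) h1.contMDiffAt
  have hτsec : ∀ z ∈ Metric.ball b₀ ρ, transverseCoord φ (τ z) = z := fun z hz => by
    simp [τ, transverseCoord, φ.right_inv (hτt z hz)]
  have hτsrc : ∀ z ∈ Metric.ball b₀ ρ, τ z ∈ φ.source := fun z hz => φ.map_target (hτt z hz)
  have hst : ∀ t : unitInterval, ∀ z, (t : ℝ) * θ z ∈ Icc (0 : ℝ) 1 := fun t z =>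
    ⟨mul_nonneg t.2.1 θ.nonneg, mul_le_one₀ t.2.2 θ.nonneg θ.le_one⟩
  have hHt : ∀ t : unitInterval, ∀ z ∈ Metric.ball b₀ ρ,
      (a + ((t : ℝ) * θ z) • (a₁ - a), z) ∈ φ.target := fun t z hz => hbox ⟨hpt _ (hst t z), hz⟩
  have hHc : ContinuousOn H (univ ×ˢ Metric.ball b₀ ρ) := by
    refine φ.continuousOn_symm.comp (Continuous.continuousOn ?_) (fun x hx => hHt x.1 x.2 hx.2)
    have : Continuous θ := θ.continuous
    fun_prop
  have hhol : F.IsHolonomy (Metric.ball b₀ ρ) (coordSlice φ a) τ H :=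
    { source := isTransversal_of_section hφ Metric.isOpen_ball
        (fun z hz => contMDiffAt_coordSlice hφ (hbox ⟨ha, hz⟩))
        (fun z hz => φ.map_target (hbox ⟨ha, hz⟩))
        (fun z hz => transverseCoord_coordSlice (hbox ⟨ha, hz⟩))
      target := isTransversal_of_section hφ Metric.isOpen_ball hτs hτsrc hτsec
      continuousOn := hHc
      start := fun z hz => by simp [H, coordSlice]
      finish := fun z hz => by simp [H, τ]
      leafwise := fun z hz => by
        refine isLeafwisePath_of_plaque hφ ?_ (fun t => φ.map_target (hHt t z hz)) fun t s => ?_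
        · rw [← continuousOn_univ]
          exact hHc.comp (by fun_prop) (fun t _ => ⟨mem_univ _, hz⟩)
        · simp [H, transverseCoord, φ.right_inv (hHt t z hz), φ.right_inv (hHt s z hz)] }
  have hconn : IsConnected (Metric.ball b₀ ρ) :=
    ⟨⟨b₁, hb₁⟩, (convex_ball b₀ ρ).isPreconnected⟩
  obtain ⟨r, hr, hrr⟩ := hS i i _ _ _ _ hhol hconn (fun z hz => hU a ha z hz)
    (fun z hz => hU _ (hpt _ (hθI z)) z hz)
  have hτr : ∀ z ∈ Metric.ball b₀ ρ, (S.g i).restrict τ z =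
      (S.g i).restrict (coordSlice φ (a + θ z • (a₁ - a))) z := by
    intro z hz
    have h1 := (S.g i).restrict_of_section hφ ((hτs z hz).mdifferentiableAt (by simp)) (hτsrc z hz)
      (hU _ (hpt _ (hθI z)) z hz) (Filter.mem_of_superset (Metric.isOpen_ball.mem_nhds hz) hτsec)
    rw [h1]
    have h2 : (φ (τ z)).1 = a + θ z • (a₁ - a) := by simp [τ, φ.right_inv (hτt z hz)]
    rw [h2]
  have hrie : IsRiemannianOn ((S.g i).restrict (coordSlice φ a)) (Metric.ball b₀ ρ) :=
    (S.g i).isRiemannianOn_restrict hφ Metric.isOpen_ball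
      (fun b hb => ⟨hbox ⟨ha, hb⟩, hU a ha b hb⟩)
  have h2 := hrr b₂ hb₂
  rw [hτr b₂ hb₂, hθ2, zero_smul, add_zero] at h2
  obtain ⟨u, hu⟩ := exists_ne (0 : Euc q)
  have hpos := hrie.pos b₂ hb₂ u hu
  -- comparison of the two metrics at the fixed point `b₂`
  have hr1 : r = 1 := by
    have h3 := congrArg (fun B => B u u) h2
    simp only [smul_apply, smul_eq_mul] at h3
    nlinarith
  have h1 := hrr b₁ hb₁
  rw [hτr b₁ hb₁, hθ1, one_smul, hr1, one_smul, add_sub_cancel] at h1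
  exact h1

end TransverseSimilarity

/-! ### Foliated boxes and the transverse pseudogroup -/

namespace TransverseSimilarity

open Foliation

variable {n p q : ℕ} {M : Type*} [TopologicalSpace M] [ChartedSpace (Euc n) M]
  [IsManifold (𝓡 n) ∞ M] {F : Foliation n p q M} {ι : Type*} {S : TransverseSimilarity F ι}

/-- A foliated box adapted to the similarity structure: a foliated chart whose image contains the
product of the balls of radius `3ρ` around `a₀` and `b₀`, where the part of the manifold corresponding
to this product is contained in one of the open sets `U i`. The factor three leaves room for enlarging
the box. -/
structure FoliatedBox (S : TransverseSimilarity F ι) where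
  chart : OpenPartialHomeomorph M (Euc p × Euc q)
  mem_atlas : chart ∈ F.atlas
  index : ι
  a₀ : Euc p
  b₀ : Euc q
  ρ : ℝ
  ρ_pos : 0 < ρ
  subset_target : Metric.ball a₀ (3 * ρ) ×ˢ Metric.ball b₀ (3 * ρ) ⊆ chart.target
  subset_U : ∀ a ∈ Metric.ball a₀ (3 * ρ), ∀ b ∈ Metric.ball b₀ (3 * ρ),
    coordSlice chart a b ∈ S.U index

namespace FoliatedBox

/-- The open part of the manifold where both components of the chart are at distance less than `s ρ`
from the centre of the box. -/
def region (B : FoliatedBox S) (s : ℝ) : Set M :=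
  B.chart.source ∩ B.chart ⁻¹' (Metric.ball B.a₀ (s * B.ρ) ×ˢ Metric.ball B.b₀ (s * B.ρ))

/-- The compact part of the manifold corresponding to the product of the closed balls of radius `ρ`. -/
def core (B : FoliatedBox S) : Set M :=
  B.chart.symm '' (Metric.closedBall B.a₀ B.ρ ×ˢ Metric.closedBall B.b₀ B.ρ)

/-- The metric of the similarity structure on the central transversal of the box. -/
noncomputable def metric (B : FoliatedBox S) : FormField q :=
  (S.g B.index).restrict (coordSlice B.chart B.a₀)

lemma isOpen_region (B : FoliatedBox S) (s : ℝ) : IsOpen (B.region s) :=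
  B.chart.isOpen_inter_preimage (Metric.isOpen_ball.prod Metric.isOpen_ball)

lemma region_mono (B : FoliatedBox S) {s t : ℝ} (h : s ≤ t) : B.region s ⊆ B.region t := by
  have h1 : s * B.ρ ≤ t * B.ρ := mul_le_mul_of_nonneg_right h B.ρ_pos.le
  exact inter_subset_inter_right _ (preimage_mono
    (prod_mono (Metric.ball_subset_ball h1) (Metric.ball_subset_ball h1)))

lemma closedBall_subset_ball (B : FoliatedBox S) {E : Type*} [PseudoMetricSpace E] (x : E) {s : ℝ}
    (hs : 1 < s) : Metric.closedBall x B.ρ ⊆ Metric.ball x (s * B.ρ) :=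
  Metric.closedBall_subset_ball (by nlinarith [B.ρ_pos])

lemma prod_closedBall_subset_target (B : FoliatedBox S) :
    Metric.closedBall B.a₀ B.ρ ×ˢ Metric.closedBall B.b₀ B.ρ ⊆ B.chart.target :=
  (prod_mono (B.closedBall_subset_ball _ (by norm_num))
    (B.closedBall_subset_ball _ (by norm_num))).trans B.subset_target

lemma isCompact_core (B : FoliatedBox S) : IsCompact B.core :=
  ((isCompact_closedBall _ _).prod (isCompact_closedBall _ _)).image_of_continuousOn
    (B.chart.continuousOn_symm.mono B.prod_closedBall_subset_target)

lemma mem_core_iff (B : FoliatedBox S) {y : M} : y ∈ B.core ↔ y ∈ B.chart.source ∧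
    (B.chart y).1 ∈ Metric.closedBall B.a₀ B.ρ ∧
      transverseCoord B.chart y ∈ Metric.closedBall B.b₀ B.ρ := by
  constructor
  · rintro ⟨z, hz, rfl⟩
    have hz' := B.prod_closedBall_subset_target hz
    refine ⟨B.chart.map_target hz', ?_⟩
    rw [transverseCoord, B.chart.right_inv hz']
    exact hz
  · rintro ⟨h1, h2, h3⟩
    exact ⟨B.chart y, ⟨h2, h3⟩, B.chart.left_inv h1⟩

lemma mem_region_iff (B : FoliatedBox S) {y : M} {s : ℝ} : y ∈ B.region s ↔ y ∈ B.chart.source ∧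
    (B.chart y).1 ∈ Metric.ball B.a₀ (s * B.ρ) ∧
      transverseCoord B.chart y ∈ Metric.ball B.b₀ (s * B.ρ) := Iff.rfl

lemma region_one_subset_core (B : FoliatedBox S) : B.region 1 ⊆ B.core := by
  intro y hy
  rw [mem_region_iff, one_mul] at hy
  exact B.mem_core_iff.2 ⟨hy.1, Metric.ball_subset_closedBall hy.2.1,
    Metric.ball_subset_closedBall hy.2.2⟩

lemma core_subset_region (B : FoliatedBox S) {s : ℝ} (hs : 1 < s) : B.core ⊆ B.region s := by
  intro y hy
  rw [mem_core_iff] at hy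
  exact ⟨hy.1, B.closedBall_subset_ball _ hs hy.2.1, B.closedBall_subset_ball _ hs hy.2.2⟩

lemma mem_U (B : FoliatedBox S) {y : M} (hy : y ∈ B.region 3) : y ∈ S.U B.index := by
  have h := B.subset_U _ hy.2.1 _ hy.2.2
  rwa [coordSlice, Prod.mk.eta, B.chart.left_inv hy.1] at h

lemma coordSlice_mem_region (B : FoliatedBox S) {s : ℝ} (hs : s ≤ 3) {a : Euc p} {b : Euc q}
    (ha : a ∈ Metric.ball B.a₀ (s * B.ρ)) (hb : b ∈ Metric.ball B.b₀ (s * B.ρ)) :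
    (a, b) ∈ B.chart.target ∧ coordSlice B.chart a b ∈ B.region s := by
  have h1 : s * B.ρ ≤ 3 * B.ρ := mul_le_mul_of_nonneg_right hs B.ρ_pos.le
  have ht := B.subset_target (mk_mem_prod (Metric.ball_subset_ball h1 ha)
    (Metric.ball_subset_ball h1 hb))
  refine ⟨ht, B.mem_region_iff.2 ⟨B.chart.map_target ht, ?_, ?_⟩⟩
  · rwa [coordSlice, B.chart.right_inv ht]
  · rwa [transverseCoord_coordSlice ht]

lemma center_mem (B : FoliatedBox S) : B.a₀ ∈ Metric.ball B.a₀ (3 * B.ρ) :=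
  Metric.mem_ball_self (by linarith [B.ρ_pos])

lemma isRiemannianOn_metric (B : FoliatedBox S) :
    IsRiemannianOn B.metric (Metric.ball B.b₀ (3 * B.ρ)) :=
  (S.g B.index).isRiemannianOn_restrict B.mem_atlas Metric.isOpen_ball fun _ hb =>
    ⟨(B.coordSlice_mem_region le_rfl B.center_mem hb).1, B.subset_U _ B.center_mem _ hb⟩

lemma restrict_eq_metric (B : FoliatedBox S) (hS : S.HolonomyInvariant) {a : Euc p} {b : Euc q}
    (ha : a ∈ Metric.ball B.a₀ (3 * B.ρ)) (hb : b ∈ Metric.ball B.b₀ (3 * B.ρ)) :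
    (S.g B.index).restrict (coordSlice B.chart a) b = B.metric b :=
  hS.restrict_eq B.mem_atlas (convex_ball _ _) B.subset_target B.subset_U B.center_mem ha hb

/-- In a box, the metric of the similarity structure is the pull-back of the metric of the central
transversal by the transverse coordinate. -/
lemma form_eq (B : FoliatedBox S) (hS : S.HolonomyInvariant) {y : M} (hy : y ∈ B.region 3)
    (v w : TangentSpace (𝓡 n) y) : (S.g B.index).form y v w =
      B.metric (transverseCoord B.chart y) (transverseDeriv B.chart y v)
        (transverseDeriv B.chart y w) := by
  rw [(S.g B.index).form_eq B.mem_atlas hy.1 (B.mem_U hy),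
    B.restrict_eq_metric hS (B.mem_region_iff.1 hy).2.1 (B.mem_region_iff.1 hy).2.2]

lemma exists_mem_region_one (S : TransverseSimilarity F ι) (x : M) :
    ∃ B : FoliatedBox S, x ∈ B.region 1 := by
  obtain ⟨φ, hφ, hx⟩ := F.exists_chart x
  obtain ⟨i, hi⟩ := S.cover x
  have h1 : φ.target ∩ φ.symm ⁻¹' (S.U i) ∈ 𝓝 (φ x) :=
    (φ.symm.isOpen_inter_preimage (S.isOpen i)).mem_nhds
      ⟨φ.map_source hx, by simpa [φ.left_inv hx] using hi⟩
  obtain ⟨ε, hε, hball⟩ := Metric.mem_nhds_iff.1 h1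
  have hsub : Metric.ball (φ x).1 (3 * (ε / 3)) ×ˢ Metric.ball (φ x).2 (3 * (ε / 3)) ⊆
      φ.target ∩ φ.symm ⁻¹' (S.U i) := by
    rw [mul_div_cancel₀ _ (by norm_num), ball_prod_same]
    exact hball
  refine ⟨⟨φ, hφ, i, (φ x).1, (φ x).2, ε / 3, by positivity, hsub.trans inter_subset_left,
    fun a ha b hb => (hsub (mk_mem_prod ha hb)).2⟩, hx, ?_, ?_⟩ <;>
  exact Metric.mem_ball_self (by positivity)

/-- Any slice of a foliated chart is homothetic, by the transverse coordinate of a box, to the central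
transversal of the box. -/
lemma isHomothetyOn (B : FoliatedBox S) (hS : S.HolonomyInvariant)
    {φ : OpenPartialHomeomorph M (Euc p × Euc q)} (hφ : φ ∈ F.atlas) {a : Euc p} {j : ι} {r : ℝ}
    (hr : 0 < r) (hrj : ∀ x ∈ S.U j ∩ S.U B.index, (S.g j).form x = r • (S.g B.index).form x)
    {D : Set (Euc q)} {G : FormField q} (hG : IsRiemannianOn G D)
    (hGe : ∀ b ∈ D, G b = (S.g j).restrict (coordSlice φ a) b)
    (hD : ∀ b ∈ D, (a, b) ∈ φ.target ∧ coordSlice φ a b ∈ S.U j ∧ coordSlice φ a b ∈ B.region 3) :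
    IsHomothetyOn G D B.metric (Metric.ball B.b₀ (3 * B.ρ))
      (transverseCoord B.chart ∘ coordSlice φ a) r where
  source := hG
  target := B.isRiemannianOn_metric
  smooth := by
    intro b hb
    have h1 := ContMDiffAt.comp b (contMDiffAt_transverseCoord B.mem_atlas (hD b hb).2.2.1)
      (contMDiffAt_coordSlice hφ (hD b hb).1)
    exact (contMDiffAt_iff_contDiffAt.1 h1).contDiffWithinAt
  mapsTo := fun b hb => (hD b hb).2.2.2.2
  pos := hr
  eq := by
    intro b hb u v
    obtain ⟨h1, h2, h3⟩ := hD b hb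
    have hσ : MDifferentiableAt 𝓘(ℝ, Euc q) (𝓡 n) (coordSlice φ a) b :=
      (contMDiffAt_coordSlice hφ h1).mdifferentiableAt (by simp)
    have hch := (differentiableAt_transverseCoord_comp B.mem_atlas hσ h3.1).2
    rw [hGe b hb, (S.g j).restrict_apply, hrj _ ⟨h2, B.mem_U h3⟩, hch, hch]
    simp only [smul_apply, smul_eq_mul]
    rw [B.form_eq hS h3]
    rfl

/-- Near a common point, two boxes are related in a neighbourhood of uniform size. -/
lemma exists_radius [T2Space M] (B B' : FoliatedBox S) : ∃ r > 0, ∀ y ∈ B.core ∩ B'.core,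
    ∀ b ∈ Metric.ball (transverseCoord B.chart y) r,
      coordSlice B.chart (B.chart y).1 b ∈ B'.region 2 := by
  have hK : IsCompact (B.core ∩ B'.core) := B.isCompact_core.inter_right B'.isCompact_core.isClosed
  have h1 : ∀ᶠ v : Euc q in 𝓝 0, ∀ y ∈ B.core ∩ B'.core,
      coordSlice B.chart (B.chart y).1 (transverseCoord B.chart y + v) ∈ B'.region 2 := by
    refine hK.eventually_forall_of_forall_eventually fun y hy => ?_
    have hsrc := (B.mem_core_iff.1 hy.1).1
    have h2 : ContinuousAt (fun z : Euc q × M => (B.chart z.2).1) (0, y) :=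
      continuousAt_fst.comp ((B.chart.continuousAt hsrc).comp (f := Prod.snd) continuousAt_snd)
    have h3 : ContinuousAt (fun z : Euc q × M => (B.chart z.2).2 + z.1) (0, y) :=
      (continuousAt_snd.comp ((B.chart.continuousAt hsrc).comp (f := Prod.snd)
        continuousAt_snd)).add continuousAt_fst
    have h4 : ContinuousAt (fun z : Euc q × M =>
        B.chart.symm ((B.chart z.2).1, (B.chart z.2).2 + z.1)) (0, y) := by
      refine ContinuousAt.comp (f := fun z : Euc q × M => ((B.chart z.2).1, (B.chart z.2).2 + z.1))
        ?_ (h2.prodMk h3)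
      simpa using B.chart.continuousAt_symm (B.chart.map_source hsrc)
    refine h4.eventually ((B'.isOpen_region 2).mem_nhds ?_)
    simpa [B.chart.left_inv hsrc] using B'.core_subset_region one_lt_two hy.2
  obtain ⟨r, hr, hball⟩ := Metric.eventually_nhds_iff_ball.1 h1
  refine ⟨r, hr, fun y hy b hb => ?_⟩
  have := hball (b - transverseCoord B.chart y) (by simpa [dist_eq_norm] using hb) y hy
  simpa using this

/-- If the cores of the boxes `B` and `B'` have the common point `y`, then sliding along plaques is a
homothety between their central transversals near `y`. -/
lemma isHomothetyOn_ball (B B' : FoliatedBox S) (hS : S.HolonomyInvariant) {r c : ℝ}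
    (hr : ∀ y ∈ B.core ∩ B'.core, ∀ b ∈ Metric.ball (transverseCoord B.chart y) r,
      coordSlice B.chart (B.chart y).1 b ∈ B'.region 2)
    (hrρ : r ≤ B.ρ) (hc : 0 < c)
    (hcj : ∀ x ∈ S.U B.index ∩ S.U B'.index, (S.g B.index).form x = c • (S.g B'.index).form x)
    {y : M} (hy : y ∈ B.core ∩ B'.core) :
    Metric.ball (transverseCoord B.chart y) r ⊆ Metric.ball B.b₀ (2 * B.ρ) ∧
    IsHomothetyOn B.metric (Metric.ball (transverseCoord B.chart y) r)
      B'.metric (Metric.ball B'.b₀ (3 * B'.ρ))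
      (transverseCoord B'.chart ∘ coordSlice B.chart (B.chart y).1) c := by
  have hyα := B.mem_core_iff.1 hy.1
  have hρ := B.ρ_pos
  have hball2 : Metric.ball (transverseCoord B.chart y) r ⊆ Metric.ball B.b₀ (2 * B.ρ) := by
    refine Metric.ball_subset_ball' ?_
    have := Metric.mem_closedBall.1 hyα.2.2
    linarith
  have hball3 : Metric.ball B.b₀ (2 * B.ρ) ⊆ Metric.ball B.b₀ (3 * B.ρ) :=
    Metric.ball_subset_ball (by linarith)
  have ha : (B.chart y).1 ∈ Metric.ball B.a₀ (3 * B.ρ) :=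
    B.closedBall_subset_ball _ (by norm_num) hyα.2.1
  refine ⟨hball2, B'.isHomothetyOn hS B.mem_atlas hc hcj
    (B.isRiemannianOn_metric.mono (hball2.trans hball3) Metric.isOpen_ball)
    (fun b hb => (B.restrict_eq_metric hS ha (hball3 (hball2 hb))).symm) fun b hb => ?_⟩
  have h1 := B.coordSlice_mem_region le_rfl ha (hball3 (hball2 hb))
  exact ⟨h1.1, B.mem_U h1.2, B'.region_mono (by norm_num) (hr y hy b hb)⟩

/-- Two boxes with a common point of their cores are related by a transition between their central
transversals. Its ratio is the constant of proportionality between the two metrics of the similarity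
structure. -/
lemma isTransition {A : Type*} (B : A → FoliatedBox S) (hS : S.HolonomyInvariant) {r c : ℝ}
    {α β : A} (hr : ∀ y ∈ (B α).core ∩ (B β).core,
      ∀ b ∈ Metric.ball (transverseCoord (B α).chart y) r,
      coordSlice (B α).chart ((B α).chart y).1 b ∈ (B β).region 2)
    (hrρ : r ≤ (B α).ρ) (hc : 0 < c)
    (hcj : ∀ x ∈ S.U (B α).index ∩ S.U (B β).index,
      (S.g (B α).index).form x = c • (S.g (B β).index).form x)
    {y : M} (hy : y ∈ (B α).core ∩ (B β).core) :
    IsTransition (fun α => (B α).metric) (fun α => Metric.ball (B α).b₀ (2 * (B α).ρ)) r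
      α (transverseCoord (B α).chart y) β (transverseCoord (B β).chart y) c⁻¹ := by
  obtain ⟨hball, hH⟩ := (B α).isHomothetyOn_ball (B β) hS hr hrρ hc hcj hy
  refine ⟨hball, _, ?_, fun x hx => ⟨(hH.contDiffAt hx).differentiableAt (by simp),
    (hr y hy x hx).2.2, fun u v => ?_, fun u v w => hH.riemann_eq hx u v w⟩⟩
  · simp only [Function.comp_apply]
    rw [← eq_coordSlice ((B α).mem_core_iff.1 hy.1).1]
  · rw [hH.eq x hx u v, inv_mul_cancel_left₀ hc.ne']

end FoliatedBox

end TransverseSimilarity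

/-! ### Metrics and curvature in a foliated box -/

/-- A continuous field of scalar products is uniformly comparable with the Euclidean one on a compact
set. -/
lemma exists_comparable_of_isCompact {q : ℕ} {X : Type*} [TopologicalSpace X] {K : Set X}
    (hK : IsCompact K) {G : X → Euc q →L[ℝ] Euc q →L[ℝ] ℝ} (hG : ContinuousOn G K)
    (hpos : ∀ x ∈ K, ∀ u, u ≠ 0 → 0 < G x u u) :
    ∃ C > 0, ∀ x ∈ K, ∀ u, ‖u‖ ^ 2 ≤ C * G x u u ∧ G x u u ≤ C * ‖u‖ ^ 2 := by
  obtain ⟨C₁, hC₁⟩ := hK.bddAbove_image hG.norm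
  have hC₁' : ∀ x ∈ K, ‖G x‖ ≤ C₁ := fun x hx => hC₁ (mem_image_of_mem _ hx)
  -- a lower bound on the unit sphere
  obtain ⟨m, hm, hmin⟩ : ∃ m > 0, ∀ x ∈ K, ∀ u ∈ Metric.sphere (0 : Euc q) 1, m ≤ G x u u := by
    have hKS : IsCompact (K ×ˢ Metric.sphere (0 : Euc q) 1) := hK.prod (isCompact_sphere _ _)
    have hcont : ContinuousOn (fun z : X × Euc q => G z.1 z.2 z.2)
        (K ×ˢ Metric.sphere (0 : Euc q) 1) := by
      have h1 : ContinuousOn (fun z : X × Euc q => G z.1) (K ×ˢ Metric.sphere (0 : Euc q) 1) :=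
        hG.comp continuousOn_fst fun z hz => hz.1
      exact (h1.clm_apply continuousOn_snd).clm_apply continuousOn_snd
    rcases (K ×ˢ Metric.sphere (0 : Euc q) 1).eq_empty_or_nonempty with he | hne
    · refine ⟨1, one_pos, fun x hx u hu => ?_⟩
      have : (x, u) ∈ K ×ˢ Metric.sphere (0 : Euc q) 1 := ⟨hx, hu⟩
      rw [he] at this
      exact this.elim
    · obtain ⟨z, hz, hzmin⟩ := hKS.exists_isMinOn hne hcont
      refine ⟨G z.1 z.2 z.2, hpos _ hz.1 _ ?_, fun x hx u hu => hzmin (mk_mem_prod hx hu)⟩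
      exact ne_zero_of_mem_unit_sphere ⟨z.2, hz.2⟩
  refine ⟨max C₁ m⁻¹, lt_max_of_lt_right (inv_pos.2 hm), fun x hx u => ⟨?_, ?_⟩⟩
  · rcases eq_or_ne u 0 with rfl | hu
    · simp
    have hn : 0 < ‖u‖ := norm_pos_iff.2 hu
    have h1 := hmin x hx (‖u‖⁻¹ • u) (by
      rw [mem_sphere_zero_iff_norm, norm_smul, norm_inv, norm_norm, inv_mul_cancel₀ hn.ne'])
    simp only [map_smul, smul_apply, smul_eq_mul] at h1
    have h2 : m * ‖u‖ ^ 2 ≤ G x u u := by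
      calc m * ‖u‖ ^ 2 ≤ ‖u‖⁻¹ * (‖u‖⁻¹ * G x u u) * ‖u‖ ^ 2 := by gcongr
        _ = G x u u := by field_simp
    calc ‖u‖ ^ 2 = m⁻¹ * (m * ‖u‖ ^ 2) := by field_simp
      _ ≤ m⁻¹ * G x u u := by gcongr
      _ ≤ _ := mul_le_mul_of_nonneg_right (le_max_right _ _) (hpos x hx u hu).le
  · calc G x u u ≤ ‖G x u u‖ := Real.le_norm_self _
      _ ≤ ‖G x‖ * ‖u‖ * ‖u‖ := ContinuousLinearMap.le_opNorm₂ _ _ _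
      _ ≤ max C₁ m⁻¹ * ‖u‖ * ‖u‖ := by
        gcongr
        exact (hC₁' x hx).trans (le_max_left _ _)
      _ = _ := by ring

namespace TransverseSimilarity

open Foliation

variable {n p q : ℕ} {M : Type*} [TopologicalSpace M] [ChartedSpace (Euc n) M]
  [IsManifold (𝓡 n) ∞ M] {F : Foliation n p q M} {ι : Type*} {S : TransverseSimilarity F ι}

namespace FoliatedBox

/-- On the core of a box, a transverse metric is comparable with the Euclidean metric of the
transverse coordinate. -/
lemma exists_comparable (B : FoliatedBox S) (k : F.TransverseMetric univ) :
    ∃ C > 0, ∀ y ∈ B.core, ∀ v : TangentSpace (𝓡 n) y,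
      ‖transverseDeriv B.chart y v‖ ^ 2 ≤ C * k.form y v v ∧
      k.form y v v ≤ C * ‖transverseDeriv B.chart y v‖ ^ 2 := by
  have hrestr : ∀ z ∈ B.chart.target, k.restrict (coordSlice B.chart z.1) z.2 =
      (k.pullback B.chart.symm z).bilinearComp (ContinuousLinearMap.inr ℝ (Euc p) (Euc q))
        (ContinuousLinearMap.inr ℝ (Euc p) (Euc q)) := by
    intro z hz
    have h1 : MDifferentiableAt 𝓘(ℝ, Euc p × Euc q) (𝓡 n) B.chart.symm (z.1, z.2) :=
      (contMDiffAt_chart_symm B.mem_atlas hz).mdifferentiableAt (by simp)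
    have h2 : HasFDerivAt (fun b : Euc q => (z.1, b)) (ContinuousLinearMap.inr ℝ (Euc p) (Euc q))
        z.2 := hasFDerivAt_prodMk_right z.1 z.2
    have h3 : ∀ u : Euc q, mfderiv 𝓘(ℝ, Euc q) (𝓡 n) (coordSlice B.chart z.1) z.2 u =
        mfderiv 𝓘(ℝ, Euc p × Euc q) (𝓡 n) B.chart.symm z
          (ContinuousLinearMap.inr ℝ (Euc p) (Euc q) u) := by
      intro u
      have h4 := mfderiv_comp_apply (f := fun b : Euc q => (z.1, b)) z.2 h1
        h2.differentiableAt.mdifferentiableAt u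
      rw [mfderiv_eq_fderiv, h2.fderiv] at h4
      exact h4
    ext u v
    rw [k.restrict_apply, h3, h3]
    rfl
  have hcont : ContinuousOn (fun z : Euc p × Euc q => k.restrict (coordSlice B.chart z.1) z.2)
      (Metric.closedBall B.a₀ B.ρ ×ˢ Metric.closedBall B.b₀ B.ρ) := by
    have h1 := (k.contDiffOn_pullback B.chart.open_target
      (F.smooth_chart_symm _ B.mem_atlas) (mapsTo_univ _ _)).continuousOn
    have h2 : Continuous (fun T : Euc p × Euc q →L[ℝ] Euc p × Euc q →L[ℝ] ℝ =>
        T.bilinearComp (ContinuousLinearMap.inr ℝ (Euc p) (Euc q))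
        (ContinuousLinearMap.inr ℝ (Euc p) (Euc q))) := by
      have hf : Continuous (fun T : Euc q →L[ℝ] Euc p × Euc q →L[ℝ] ℝ => T.flip) :=
        (contDiff_clm_flip (m := 0)).continuous
      have hf' : Continuous (fun T : Euc q →L[ℝ] Euc q →L[ℝ] ℝ => T.flip) :=
        (contDiff_clm_flip (m := 0)).continuous
      exact hf'.comp ((hf.comp (continuous_id.clm_comp continuous_const)).clm_comp continuous_const)
    exact (h2.comp_continuousOn (h1.mono B.prod_closedBall_subset_target)).congr
      fun z hz => hrestr z (B.prod_closedBall_subset_target hz)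
  obtain ⟨C, hC, h⟩ := exists_comparable_of_isCompact
    ((isCompact_closedBall B.a₀ B.ρ).prod (isCompact_closedBall B.b₀ B.ρ)) hcont
    (fun z hz u hu => (k.isRiemannianOn_restrict B.mem_atlas
      (D := {b | (z.1, b) ∈ B.chart.target}) (B.chart.open_target.preimage (by fun_prop))
      (fun b hb => ⟨hb, mem_univ _⟩)).pos z.2 (B.prod_closedBall_subset_target hz) u hu)
  refine ⟨C, hC, fun y hy v => ?_⟩
  have hy' := B.mem_core_iff.1 hy
  rw [k.form_eq B.mem_atlas hy'.1 (mem_univ _)]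
  exact h (B.chart y) ⟨hy'.2.1, hy'.2.2⟩ _

lemma exists_comparable_metric (B : FoliatedBox S) :
    ∃ C > 0, ∀ b ∈ Metric.ball B.b₀ (2 * B.ρ), ∀ u,
      ‖u‖ ^ 2 ≤ C * B.metric b u u ∧ B.metric b u u ≤ C * ‖u‖ ^ 2 := by
  have hρ := B.ρ_pos
  have hsub : Metric.closedBall B.b₀ (2 * B.ρ) ⊆ Metric.ball B.b₀ (3 * B.ρ) :=
    Metric.closedBall_subset_ball (by linarith)
  obtain ⟨C, hC, h⟩ := exists_comparable_of_isCompact (isCompact_closedBall B.b₀ (2 * B.ρ))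
    (B.isRiemannianOn_metric.smooth.continuousOn.mono hsub)
    (fun b hb => B.isRiemannianOn_metric.pos b (hsub hb))
  exact ⟨C, hC, fun b hb => h b (Metric.ball_subset_closedBall hb)⟩

/-- The transverse curvature, which is computed in some chart, agrees with the curvature of the
central transversal of any box, up to a linear change of coordinates. -/
lemma exists_curvature_eq (B : FoliatedBox S) (hS : S.HolonomyInvariant) {x : M}
    (hx : x ∈ B.region 3) : ∃ L : Euc q →L[ℝ] Euc q, Function.Bijective L ∧ ∀ u v w,
      riemannCLM B.metric (transverseCoord B.chart x) (L u) (L v) (L w) =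
        L (S.curvature x u v w) := by
  obtain ⟨hφ, hxφ⟩ : S.chart x ∈ F.atlas ∧ x ∈ (S.chart x).source :=
    Classical.choose_spec (F.exists_chart x)
  have hi : x ∈ S.U (S.index x) := Classical.choose_spec (S.cover x)
  set φ := S.chart x with hφdef
  set a := (φ x).1 with ha
  have hslice : S.slice x = coordSlice φ a := rfl
  set D : Set (Euc q) := {b | (a, b) ∈ φ.target ∩
    φ.symm ⁻¹' (S.U (S.index x) ∩ B.region 3)} with hDdef
  have hD : IsOpen D := (φ.symm.isOpen_inter_preimage
    ((S.isOpen _).inter (B.isOpen_region 3))).preimage (by fun_prop)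
  have hxD : (φ x).2 ∈ D := by
    have h1 : φ.symm (a, (φ x).2) = x := φ.left_inv hxφ
    exact ⟨φ.map_source hxφ, by rw [mem_preimage, h1]; exact ⟨hi, hx⟩⟩
  obtain ⟨r, hr, hrj⟩ := S.compatible (S.index x) B.index
  have hG : IsRiemannianOn ((S.g (S.index x)).restrict (coordSlice φ a)) D :=
    (S.g _).isRiemannianOn_restrict hφ hD fun b hb => ⟨hb.1, hb.2.1⟩
  have hH := B.isHomothetyOn hS hφ (a := a) hr hrj hG (fun b _ => rfl)
    (fun b hb => ⟨hb.1, hb.2.1, hb.2.2⟩)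
  refine ⟨fderiv ℝ (transverseCoord B.chart ∘ coordSlice φ a) (φ x).2,
    ⟨hH.injective hxD, hH.surjective hxD⟩, fun u v w => ?_⟩
  have h1 := hH.riemann_eq hxD u v w
  have h2 : coordSlice φ a (φ x).2 = x := φ.left_inv hxφ
  rw [Function.comp_apply, h2] at h1
  rw [h1, ← hG.riemannTensor_eq hxD]
  rfl

end FoliatedBox

/-- If the norm of the transverse curvature is not zero, then the curvature is not zero. -/
lemma exists_curvature_ne_zero (g : F.TransverseMetric univ) {x : M}
    (hx : S.curvatureNorm g x ≠ 0) : ∃ u v w, S.curvature x u v w ≠ 0 := by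
  by_contra! h
  apply hx
  rw [curvatureNorm, tensorNorm]
  have hsub : {r : ℝ | ∃ u v w : Euc q, g.restrict (S.slice x) (S.chart x x).2 u u ≤ 1 ∧
      g.restrict (S.slice x) (S.chart x x).2 v v ≤ 1 ∧
      g.restrict (S.slice x) (S.chart x x).2 w w ≤ 1 ∧
      r = Real.sqrt (g.restrict (S.slice x) (S.chart x x).2 (S.curvature x u v w)
        (S.curvature x u v w))} ⊆ {0} := by
    rintro r ⟨u, v, w, -, -, -, rfl⟩
    simp [h]
  rcases subset_singleton_iff_eq.1 hsub with h1 | h1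
  · rw [h1, Real.sSup_empty]
  · rw [h1, csSup_singleton]

end TransverseSimilarity

/-! ### Infinitesimal holonomy along a chain of boxes -/

namespace Foliation

variable {n p q : ℕ} {M : Type*} [TopologicalSpace M] [ChartedSpace (Euc n) M]
  {F : Foliation n p q M} {φ ψ : OpenPartialHomeomorph M (Euc p × Euc q)}

/-- Near a common point of two foliated charts, the transverse coordinate of the second is a function
of the transverse coordinate of the first. -/
lemma eventually_transverseCoord_eq (hφ : φ ∈ F.atlas) (hψ : ψ ∈ F.atlas) {y : M}
    (hyφ : y ∈ φ.source) (hyψ : y ∈ ψ.source) :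
    ∀ᶠ y' in 𝓝 y, transverseCoord ψ y' =
      (transverseCoord ψ ∘ coordSlice φ (φ y).1) (transverseCoord φ y') := by
  obtain ⟨V, hV, hpl⟩ := F.plaques φ hφ ψ hψ y ⟨hyφ, hyψ⟩
  have h1 : ContinuousAt (fun y' => ((φ y).1, transverseCoord φ y')) y :=
    continuousAt_const.prodMk (continuousAt_snd.comp (φ.continuousAt hyφ))
  have h2 : ContinuousAt (fun y' => coordSlice φ (φ y).1 (transverseCoord φ y')) y :=
    ContinuousAt.comp (f := fun y' => ((φ y).1, transverseCoord φ y'))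
      (φ.continuousAt_symm (φ.map_source hyφ)) h1
  filter_upwards [hV, h2.eventually (show V ∈ 𝓝 (coordSlice φ (φ y).1 (transverseCoord φ y)) by
      rwa [← eq_coordSlice hyφ]), h1.eventually (φ.open_target.mem_nhds (φ.map_source hyφ))]
    with y' h3 h4 h5
  exact hpl _ h3 _ h4 (transverseCoord_coordSlice h5).symm

/-- The transverse coordinate is constant along the part of a leafwise path inside a chart. -/
lemma IsLeafwisePath.transverseCoord_eq {c : unitInterval → M} (hc : F.IsLeafwisePath c)
    (hφ : φ ∈ F.atlas) {s t : unitInterval} (hst : s ≤ t)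
    (hsrc : ∀ x ∈ Icc s t, c x ∈ φ.source) :
    transverseCoord φ (c t) = transverseCoord φ (c s) := by
  have h1 : IsLocallyConstant fun x : Icc s t => transverseCoord φ (c x) :=
    (IsLocallyConstant.iff_eventually_eq _).2 fun x =>
      continuous_subtype_val.continuousAt.eventually (hc.2 x φ hφ (hsrc x x.2))
  have : PreconnectedSpace (Icc s t) := isPreconnected_iff_preconnectedSpace.1 isPreconnected_Icc
  exact h1.apply_eq_of_preconnectedSpace ⟨t, right_mem_Icc.2 hst⟩ ⟨s, left_mem_Icc.2 hst⟩

lemma IsHolonomy.eventually_transverseCoord_eq {D : Set (Euc q)} {σ τ : Euc q → M}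
    {H : unitInterval × Euc q → M} (hH : F.IsHolonomy D σ τ H) {z : Euc q} (hz : z ∈ D)
    (hφ : φ ∈ F.atlas) {s t : unitInterval} (hst : s ≤ t)
    (hsrc : ∀ x ∈ Icc s t, H (x, z) ∈ φ.source) :
    ∀ᶠ z' in 𝓝 z, transverseCoord φ (H (t, z')) = transverseCoord φ (H (s, z')) := by
  have h1 : ∀ᶠ z' in 𝓝 z, ∀ x ∈ Icc s t, H (x, z') ∈ φ.source := by
    refine isCompact_Icc.eventually_forall_of_forall_eventually fun x hx => ?_
    have h2 : ContinuousAt H (x, z) := hH.continuousOn.continuousAt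
      (prod_mem_nhds Filter.univ_mem (hH.source.isOpen.mem_nhds hz))
    have h3 : ContinuousAt (fun w : Euc q × unitInterval => H (w.2, w.1)) (z, x) :=
      ContinuousAt.comp (f := Prod.swap) h2 continuous_swap.continuousAt
    exact h3.eventually (φ.open_source.mem_nhds (hsrc x hx))
  filter_upwards [h1, hH.source.isOpen.mem_nhds hz] with z' h2 h3
  exact (hH.leafwise z' h3).transverseCoord_eq hφ hst h2

end Foliation

lemma exists_pos_forall_ge {A : Type*} [Finite A] (C : A → ℝ) : ∃ C' > 0, ∀ a, C a ≤ C' := by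
  obtain ⟨C', hC'⟩ := (finite_range C).bddAbove
  exact ⟨max C' 1, by positivity, fun a => (hC' (mem_range_self a)).trans (le_max_left _ _)⟩

lemma exists_pos_forall_le {A : Type*} [Finite A] {r : A → ℝ} (hr : ∀ a, 0 < r a) :
    ∃ r' > 0, ∀ a, r' ≤ r a := by
  obtain ⟨C, hC, h⟩ := exists_pos_forall_ge fun a => (r a)⁻¹
  exact ⟨C⁻¹, inv_pos.2 hC, fun a => inv_le_of_inv_le₀ (hr a) (h a)⟩

namespace TransverseSimilarity

open Foliation

variable {n p q : ℕ} {M : Type*} [TopologicalSpace M] [ChartedSpace (Euc n) M]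
  [IsManifold (𝓡 n) ∞ M] {F : Foliation n p q M} {ι : Type*} {S : TransverseSimilarity F ι}

namespace FoliatedBox

/-- One step in the computation of the differential of a holonomy map: the family of leafwise paths
`H (·, z')` stays in the box `B` between the times `s` and `t`, when it enters the box `B'`. -/
lemma exists_hasFDerivAt_of_isHolonomy {D : Set (Euc q)} {σ τ : Euc q → M}
    {H : unitInterval × Euc q → M} (hH : F.IsHolonomy D σ τ H) {z : Euc q} (hz : z ∈ D)
    (B B' : FoliatedBox S) (hS : S.HolonomyInvariant) {r c : ℝ} (hr0 : 0 < r)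
    (hr : ∀ y ∈ B.core ∩ B'.core, ∀ b ∈ Metric.ball (transverseCoord B.chart y) r,
      coordSlice B.chart (B.chart y).1 b ∈ B'.region 2)
    (hrρ : r ≤ B.ρ) (hc : 0 < c)
    (hcj : ∀ x ∈ S.U B.index ∩ S.U B'.index, (S.g B.index).form x = c • (S.g B'.index).form x)
    {s t : unitInterval} (hst : s ≤ t) (hsrc : ∀ x ∈ Icc s t, H (x, z) ∈ B.core)
    (ht : H (t, z) ∈ B'.core) {L : Euc q →L[ℝ] Euc q}
    (hL : HasFDerivAt (fun z' => transverseCoord B.chart (H (s, z'))) L z) :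
    ∃ L' : Euc q →L[ℝ] Euc q,
      HasFDerivAt (fun z' => transverseCoord B'.chart (H (t, z'))) L' z ∧
      ∀ u v, B'.metric (transverseCoord B'.chart (H (t, z))) (L' u) (L' v) =
        c⁻¹ * B.metric (transverseCoord B.chart (H (s, z))) (L u) (L v) := by
  have hy : H (t, z) ∈ B.core ∩ B'.core := ⟨hsrc t (right_mem_Icc.2 hst), ht⟩
  have hyB := (B.mem_core_iff.1 hy.1).1
  have hyB' := (B'.mem_core_iff.1 hy.2).1
  have hev := hH.eventually_transverseCoord_eq hz B.mem_atlas hst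
    fun x hx => (B.mem_core_iff.1 (hsrc x hx)).1
  have hst' := hev.self_of_nhds
  obtain ⟨-, hh⟩ := B.isHomothetyOn_ball B' hS hr hrρ hc hcj hy
  set h := transverseCoord B'.chart ∘ coordSlice B.chart (B.chart (H (t, z))).1 with hdef
  have hmem : transverseCoord B.chart (H (s, z)) ∈
      Metric.ball (transverseCoord B.chart (H (t, z))) r := by
    rw [hst']
    exact Metric.mem_ball_self hr0
  have hHc : ContinuousAt (fun z' => H (t, z')) z := by
    have h2 : ContinuousAt H (t, z) := hH.continuousOn.continuousAt
      (prod_mem_nhds Filter.univ_mem (hH.source.isOpen.mem_nhds hz))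
    exact ContinuousAt.comp (f := fun z' => (t, z')) h2 (by fun_prop)
  have heq : (fun z' => transverseCoord B'.chart (H (t, z'))) =ᶠ[𝓝 z]
      h ∘ fun z' => transverseCoord B.chart (H (s, z')) := by
    filter_upwards [hev, hHc.eventually
      (Foliation.eventually_transverseCoord_eq B.mem_atlas B'.mem_atlas hyB hyB')] with z' h1 h2
    rw [h2, Function.comp_apply (f := h), ← h1]
  have hd : HasFDerivAt h (fderiv ℝ h (transverseCoord B.chart (H (s, z))))
      (transverseCoord B.chart (H (s, z))) :=
    ((hh.contDiffAt hmem).differentiableAt (by simp)).hasFDerivAt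
  refine ⟨_, (hd.comp z hL).congr_of_eventuallyEq heq, fun u v => ?_⟩
  have h3 := heq.self_of_nhds
  simp only [Function.comp_apply (f := h)] at h3
  rw [h3, hh.eq _ hmem, inv_mul_cancel_left₀ hc.ne']
  rfl

end FoliatedBox

end TransverseSimilarity

/-! ### The bi-equicontinuity domain -/

namespace TransverseSimilarity

open Foliation

variable {n p q : ℕ} {M : Type*} [TopologicalSpace M] [ChartedSpace (Euc n) M]
  [IsManifold (𝓡 n) ∞ M] {F : Foliation n p q M} {ι : Type*} {S : TransverseSimilarity F ι}

/-- Finitely many foliated boxes covering the manifold, with the constants relating them: `r` is the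
common radius and `μ α β` is the square of the ratio of the transition from the box `α` to the box `β`,
which only depends on the two boxes. -/
structure BoxCover (S : TransverseSimilarity F ι) (A : Type*) where
  box : A → FoliatedBox S
  exists_mem : ∀ x, ∃ α, x ∈ (box α).region 1
  r : ℝ
  r_pos : 0 < r
  slide : ∀ α β, ∀ y ∈ (box α).core ∩ (box β).core,
    ∀ b ∈ Metric.ball (transverseCoord (box α).chart y) r,
      coordSlice (box α).chart ((box α).chart y).1 b ∈ (box β).region 2
  r_le : ∀ α, r ≤ (box α).ρ
  μ : A → A → ℝ
  μ_pos : ∀ α β, 0 < μ α β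
  form_eq : ∀ α β, ∀ x ∈ S.U (box α).index ∩ S.U (box β).index,
    (S.g (box α).index).form x = (μ α β)⁻¹ • (S.g (box β).index).form x

lemma exists_boxCover [T2Space M] [CompactSpace M] (S : TransverseSimilarity F ι) :
    ∃ s : Finset M, Nonempty (BoxCover S s) := by
  choose B hB using FoliatedBox.exists_mem_region_one S
  obtain ⟨s, hs⟩ := isCompact_univ.elim_finite_subcover (fun x => (B x).region 1)
    (fun x => (B x).isOpen_region 1) fun x _ => mem_iUnion.2 ⟨x, hB x⟩
  refine ⟨s, ?_⟩
  choose r₁ hr₁ hslide using fun α β : s => (B α).exists_radius (B β)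
  obtain ⟨r₂, hr₂, hle₂⟩ := exists_pos_forall_le fun α : s × s => hr₁ α.1 α.2
  obtain ⟨r₃, hr₃, hle₃⟩ := exists_pos_forall_le fun α : s => (B α).ρ_pos
  choose c hc hform using fun α β : s => S.compatible (B α).index (B β).index
  exact ⟨{
    box := fun α => B α
    exists_mem := fun x => by
      obtain ⟨α, hα, hx⟩ := mem_iUnion₂.1 (hs (mem_univ x))
      exact ⟨⟨α, hα⟩, hx⟩
    r := min r₂ r₃
    r_pos := lt_min hr₂ hr₃
    slide := fun α β y hy b hb => hslide α β y hy b
      (Metric.ball_subset_ball ((min_le_left _ _).trans (hle₂ (α, β))) hb)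
    r_le := fun α => (min_le_right _ _).trans (hle₃ α)
    μ := fun α β => (c α β)⁻¹
    μ_pos := fun α β => inv_pos.2 (hc α β)
    form_eq := fun α β x hx => by rw [inv_inv, hform α β x hx] }⟩

namespace BoxCover

variable {A : Type*} (W : BoxCover S A)

lemma form_eq' (α β : A) : ∀ x ∈ S.U (W.box β).index ∩ S.U (W.box α).index,
    (S.g (W.box β).index).form x = W.μ α β • (S.g (W.box α).index).form x := by
  intro x hx
  rw [W.form_eq α β x hx.symm, smul_inv_smul₀ (W.μ_pos α β).ne']

/-- The squares of the ratios of the compositions of transitions along a sequence of boxes. -/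
noncomputable def ratio (α : ℕ → A) (m : ℕ) : ℝ :=
  ∏ j ∈ Finset.range m, W.μ (α j) (α (j + 1))

lemma ratio_pos (α : ℕ → A) (m : ℕ) : 0 < W.ratio α m :=
  Finset.prod_pos fun _ _ => W.μ_pos _ _

lemma ratio_succ (α : ℕ → A) (m : ℕ) :
    W.ratio α (m + 1) = W.μ (α m) (α (m + 1)) * W.ratio α m := by
  rw [ratio, Finset.prod_range_succ, mul_comm]
  rfl

variable {D : Set (Euc q)} {σ τ : Euc q → M} {H : unitInterval × Euc q → M} {z : Euc q}
  {α : ℕ → A} {t : ℕ → unitInterval}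

/-- A leafwise path, subdivided into pieces contained in boxes, gives a chain of transitions. -/
lemma isTransitionChain (hS : S.HolonomyInvariant) {c : unitInterval → M} (hc : F.IsLeafwisePath c)
    (ht : Monotone t) (hα : ∀ m, ∀ x ∈ Icc (t m) (t (m + 1)), c x ∈ (W.box (α m)).core) (N : ℕ) :
    IsTransitionChain (fun α => (W.box α).metric)
      (fun α => Metric.ball (W.box α).b₀ (2 * (W.box α).ρ))
      (fun α => Metric.closedBall (W.box α).b₀ (W.box α).ρ) W.r
      (α 0) (transverseCoord (W.box (α 0)).chart (c (t 0))) N α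
      (fun m => transverseCoord (W.box (α m)).chart (c (t m))) (W.ratio α) := by
  have hle : ∀ m, t m ≤ t (m + 1) := fun m => ht m.le_succ
  have hl : ∀ m, c (t m) ∈ (W.box (α m)).core := fun m => hα m _ (left_mem_Icc.2 (hle m))
  have hy : ∀ m, c (t (m + 1)) ∈ (W.box (α m)).core ∩ (W.box (α (m + 1))).core := fun m =>
    ⟨hα m _ (right_mem_Icc.2 (hle m)), hl (m + 1)⟩
  have heq : ∀ m, transverseCoord (W.box (α m)).chart (c (t (m + 1))) =
      transverseCoord (W.box (α m)).chart (c (t m)) := fun m =>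
    hc.transverseCoord_eq (W.box (α m)).mem_atlas (hle m) fun x hx =>
      ((W.box (α m)).mem_core_iff.1 (hα m x hx)).1
  refine ⟨rfl, rfl, by simp [ratio], fun m _ => ((W.box (α m)).mem_core_iff.1 (hl m)).2.2,
    W.ratio_pos α, fun m _ => ?_, fun m _ => ?_⟩
  · have h1 := FoliatedBox.isTransition W.box hS (W.slide (α m) (α (m + 1))) (W.r_le _)
      (inv_pos.2 (W.μ_pos _ _)) (W.form_eq _ _) (hy m)
    rw [heq, inv_inv] at h1
    rwa [ratio_succ, mul_div_cancel_right₀ _ (W.ratio_pos α m).ne']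
  · have h1 := FoliatedBox.isTransition W.box hS (W.slide (α (m + 1)) (α m)) (W.r_le _)
      (W.μ_pos (α m) (α (m + 1))) (W.form_eq' _ _) (hy m).symm
    rw [heq] at h1
    rwa [ratio_succ, div_mul_cancel_right₀ (W.ratio_pos α m).ne']

/-- The differential of the family of leafwise paths at the time `t m` is a similarity whose ratio is
given by the first `m` transitions. -/
lemma exists_hasFDerivAt (hS : S.HolonomyInvariant) (hH : F.IsHolonomy D σ τ H) (hz : z ∈ D)
    (ht : Monotone t)
    (hα : ∀ m, ∀ x ∈ Icc (t m) (t (m + 1)), H (x, z) ∈ (W.box (α m)).core)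
    {L₀ : Euc q →L[ℝ] Euc q}
    (hL₀ : HasFDerivAt (fun z' => transverseCoord (W.box (α 0)).chart (H (t 0, z'))) L₀ z) (m : ℕ) :
    ∃ L : Euc q →L[ℝ] Euc q,
      HasFDerivAt (fun z' => transverseCoord (W.box (α m)).chart (H (t m, z'))) L z ∧
      ∀ u v, (W.box (α m)).metric (transverseCoord (W.box (α m)).chart (H (t m, z))) (L u) (L v) =
        W.ratio α m * (W.box (α 0)).metric
          (transverseCoord (W.box (α 0)).chart (H (t 0, z))) (L₀ u) (L₀ v) := by
  induction m with
  | zero => exact ⟨L₀, hL₀, fun u v => by simp [ratio]⟩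
  | succ m ih =>
    obtain ⟨L, hL, hLe⟩ := ih
    obtain ⟨L', hL', hLe'⟩ := FoliatedBox.exists_hasFDerivAt_of_isHolonomy hH hz
      (W.box (α m)) (W.box (α (m + 1))) hS W.r_pos (W.slide _ _) (W.r_le _)
      (inv_pos.2 (W.μ_pos (α m) (α (m + 1)))) (W.form_eq _ _) (ht m.le_succ) (hα m)
      (hα (m + 1) _ (left_mem_Icc.2 (ht (m + 1).le_succ))) hL
    refine ⟨L', hL', fun u v => ?_⟩
    rw [hLe', hLe, ratio_succ, inv_inv, mul_assoc]

end BoxCover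

/-- A point where the transverse curvature does not vanish belongs to the bi-equicontinuity domain: the
infinitesimal holonomy along a leafwise path is the differential of a chain of transitions between the
transversals of finitely many boxes, and the ratio of this chain is bounded by
`exists_ratio_bound`. -/
theorem mem_biEquicontinuityDomain [T2Space M] [CompactSpace M] (hS : S.HolonomyInvariant)
    (k : F.TransverseMetric univ) {x : M} (hx : ∃ u v w, S.curvature x u v w ≠ 0) :
    x ∈ F.biEquicontinuityDomain k := by
  obtain ⟨s, ⟨W⟩⟩ := exists_boxCover S
  choose C₁ hC₁ hcomp₁ using fun α => (W.box α).exists_comparable k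
  choose C₂ hC₂ hcomp₂ using fun α => (W.box α).exists_comparable_metric
  obtain ⟨C, hC, hCle⟩ := exists_pos_forall_ge fun α => max (C₁ α) (C₂ α)
  have hk : ∀ α, ∀ y ∈ (W.box α).core, ∀ v : TangentSpace (𝓡 n) y,
      ‖transverseDeriv (W.box α).chart y v‖ ^ 2 ≤ C * k.form y v v ∧
      k.form y v v ≤ C * ‖transverseDeriv (W.box α).chart y v‖ ^ 2 := by
    intro α y hy v
    have h1 := (le_max_left _ _).trans (hCle α)
    obtain ⟨h2, h3⟩ := hcomp₁ α y hy v
    exact ⟨h2.trans (mul_le_mul_of_nonneg_right h1 (k.nonneg y (mem_univ y) v)),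
      h3.trans (mul_le_mul_of_nonneg_right h1 (sq_nonneg _))⟩
  have hG : IsComparable (fun α => (W.box α).metric)
      (fun α => Metric.ball (W.box α).b₀ (2 * (W.box α).ρ)) C := by
    intro α b hb u
    have h1 := (le_max_right _ _).trans (hCle α)
    obtain ⟨h2, h3⟩ := hcomp₂ α b hb u
    have hb' : b ∈ Metric.ball (W.box α).b₀ (3 * (W.box α).ρ) :=
      Metric.ball_subset_ball (by linarith [(W.box α).ρ_pos]) hb
    have h4 : 0 ≤ (W.box α).metric b u u := by
      rcases eq_or_ne u 0 with rfl | hu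
      · simp
      · exact ((W.box α).isRiemannianOn_metric.pos b hb' u hu).le
    exact ⟨h2.trans (mul_le_mul_of_nonneg_right h1 h4),
      h3.trans (mul_le_mul_of_nonneg_right h1 (sq_nonneg _))⟩
  -- the ratios of all chains starting at `x` are bounded
  have hbound : ∀ α, ∃ δ > 0, x ∈ (W.box α).core → ∀ N β b l,
      IsTransitionChain (fun α => (W.box α).metric)
        (fun α => Metric.ball (W.box α).b₀ (2 * (W.box α).ρ))
        (fun α => Metric.closedBall (W.box α).b₀ (W.box α).ρ) W.r
        α (transverseCoord (W.box α).chart x) N β b l → l N ≤ δ ∧ δ⁻¹ ≤ l N := by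
    intro α
    by_cases hxα : x ∈ (W.box α).core
    swap
    · exact ⟨1, one_pos, fun h => absurd h hxα⟩
    obtain ⟨L, hL, hLe⟩ := (W.box α).exists_curvature_eq hS
      ((W.box α).core_subset_region (by norm_num) hxα)
    obtain ⟨u, v, w, huvw⟩ := hx
    obtain ⟨δ, hδ, h⟩ := exists_ratio_bound hC W.r_pos
      (fun α => (W.box α).isRiemannianOn_metric) hG (fun α => isCompact_closedBall _ _)
      (fun α => (W.box α).closedBall_subset_ball _ (by norm_num))
      (fun α b hb => Metric.ball_subset_ball' (by
        have := Metric.mem_closedBall.1 hb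
        linarith [W.r_le α]))
      ((W.box α).mem_core_iff.1 hxα).2.2 (fun h0 => huvw (hL.injective (by
        rw [← hLe, h0, map_zero]; rfl)))
    exact ⟨δ, hδ, fun _ => h⟩
  choose δ₁ hδ₁ hbound using hbound
  obtain ⟨δ, hδ, hδle⟩ := exists_pos_forall_ge δ₁
  set X := C * C * δ * C * C with hX
  have hX0 : 0 < X := by positivity
  -- `X` bounds the squares of the norms, hence `1 + X` bounds the norms
  have hXsq : X ≤ (1 + X) ^ 2 := by nlinarith
  refine ⟨1 + X, by linarith, ?_⟩
  intro c hc hcx D σ τ H z hH hz hHc a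
  -- subdivision of the path
  obtain ⟨t, ht0, htm, ⟨N, hN⟩, htI⟩ := exists_monotone_Icc_subset_open_cover_unitInterval
    (c := fun α => c ⁻¹' (W.box α).region 1) (fun α => ((W.box α).isOpen_region 1).preimage hc.1)
    (fun u _ => mem_iUnion.2 (W.exists_mem (c u)))
  choose α hα using htI
  have hαc : ∀ m, ∀ u ∈ Icc (t m) (t (m + 1)), c u ∈ (W.box (α m)).core := fun m u hu =>
    (W.box (α m)).region_one_subset_core (hα m hu)
  have hαH : ∀ m, ∀ u ∈ Icc (t m) (t (m + 1)), H (u, z) ∈ (W.box (α m)).core := fun m u hu => by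
    rw [hHc]
    exact hαc m u hu
  have hchain := W.isTransitionChain hS hc htm hαc N
  have hmem : ∀ m, H (t m, z) ∈ (W.box (α m)).core := fun m =>
    hαH m _ (left_mem_Icc.2 (htm m.le_succ))
  have hDz := hH.source.isOpen.mem_nhds hz
  have hσ0 : H (t 0, z) = σ z := by rw [ht0, hH.start z hz]
  have hτ1 : H (t N, z) = τ z := by rw [hN N le_rfl, hH.finish z hz]
  have hσmem : σ z ∈ (W.box (α 0)).core := hσ0 ▸ hmem 0
  have hτmem : τ z ∈ (W.box (α N)).core := hτ1 ▸ hmem N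
  have hσd : MDifferentiableAt 𝓘(ℝ, Euc q) (𝓡 n) σ z :=
    (hH.source.smooth.contMDiffAt hDz).mdifferentiableAt (by simp)
  have hτd : MDifferentiableAt 𝓘(ℝ, Euc q) (𝓡 n) τ z :=
    (hH.target.smooth.contMDiffAt hDz).mdifferentiableAt (by simp)
  obtain ⟨hσd1, hσd2⟩ := differentiableAt_transverseCoord_comp (W.box (α 0)).mem_atlas hσd
    ((W.box (α 0)).mem_core_iff.1 hσmem).1
  obtain ⟨hτd1, hτd2⟩ := differentiableAt_transverseCoord_comp (W.box (α N)).mem_atlas hτd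
    ((W.box (α N)).mem_core_iff.1 hτmem).1
  have hL₀ : HasFDerivAt (fun z' => transverseCoord (W.box (α 0)).chart (H (t 0, z')))
      (fderiv ℝ (transverseCoord (W.box (α 0)).chart ∘ σ) z) z := by
    refine hσd1.hasFDerivAt.congr_of_eventuallyEq ?_
    filter_upwards [hDz] with z' hz'
    rw [ht0, hH.start z' hz', Function.comp_apply]
  obtain ⟨L, hL, hLe⟩ := W.exists_hasFDerivAt hS hH hz htm hαH hL₀ N
  -- at the end, the family of paths is the transversal `τ`
  have hLτ : L = fderiv ℝ (transverseCoord (W.box (α N)).chart ∘ τ) z := by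
    refine (hL.congr_of_eventuallyEq ?_).fderiv.symm
    filter_upwards [hDz] with z' hz'
    rw [hN N le_rfl, hH.finish z' hz', Function.comp_apply]
  have hLea := hLe a a
  rw [hLτ, hσd2, hτd2, hσ0, hτ1] at hLea
  have hxc : x = c (t 0) := by rw [ht0, hcx]
  obtain ⟨hl1, hl2⟩ := hbound (α 0) (hxc ▸ hαc 0 _ (left_mem_Icc.2 (htm (Nat.zero_le 1)))) N α _ _
    (by rw [hxc]; exact hchain)
  have hball : ∀ m, transverseCoord (W.box (α m)).chart (H (t m, z)) ∈
      Metric.ball (W.box (α m)).b₀ (2 * (W.box (α m)).ρ) := fun m =>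
    (W.box (α m)).closedBall_subset_ball _ one_lt_two
      ((W.box (α m)).mem_core_iff.1 (hmem m)).2.2
  obtain ⟨hk1, hk2⟩ := hk (α 0) (σ z) hσmem (mfderiv 𝓘(ℝ, Euc q) (𝓡 n) σ z a)
  obtain ⟨hk3, hk4⟩ := hk (α N) (τ z) hτmem (mfderiv 𝓘(ℝ, Euc q) (𝓡 n) τ z a)
  obtain ⟨hg1, hg2⟩ := hG (α 0) _ (hσ0 ▸ hball 0)
    (transverseDeriv (W.box (α 0)).chart (σ z) (mfderiv 𝓘(ℝ, Euc q) (𝓡 n) σ z a))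
  obtain ⟨hg3, hg4⟩ := hG (α N) _ (hτ1 ▸ hball N)
    (transverseDeriv (W.box (α N)).chart (τ z) (mfderiv 𝓘(ℝ, Euc q) (𝓡 n) τ z a))
  simp only at hg1 hg2 hg3 hg4
  have hs0 := k.nonneg (σ z) (mem_univ _) (mfderiv 𝓘(ℝ, Euc q) (𝓡 n) σ z a)
  have ht0' := k.nonneg (τ z) (mem_univ _) (mfderiv 𝓘(ℝ, Euc q) (𝓡 n) τ z a)
  rw [hLea] at hg3 hg4
  set g₀ := (W.box (α 0)).metric (transverseCoord (W.box (α 0)).chart (σ z))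
    (transverseDeriv (W.box (α 0)).chart (σ z) (mfderiv 𝓘(ℝ, Euc q) (𝓡 n) σ z a))
    (transverseDeriv (W.box (α 0)).chart (σ z) (mfderiv 𝓘(ℝ, Euc q) (𝓡 n) σ z a))
  have hg0 : 0 ≤ g₀ := by
    by_contra! h
    nlinarith [sq_nonneg ‖transverseDeriv (W.box (α 0)).chart (σ z)
      (mfderiv 𝓘(ℝ, Euc q) (𝓡 n) σ z a)‖]
  have hlN := W.ratio_pos α N
  have hl1' : W.ratio α N ≤ δ := hl1.trans (hδle _)
  have hl2' : 1 ≤ δ * W.ratio α N := by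
    have h1 : 1 ≤ δ₁ (α 0) * W.ratio α N := (inv_le_iff_one_le_mul₀' (hδ₁ _)).1 hl2
    exact h1.trans (mul_le_mul_of_nonneg_right (hδle _) hlN.le)
  have key : ∀ {P Q : ℝ}, P ≤ X * Q → 0 ≤ Q → √P ≤ (1 + X) * √Q := by
    intro P Q hPQ hQ
    calc √P ≤ √((1 + X) ^ 2 * Q) :=
          Real.sqrt_le_sqrt (hPQ.trans (mul_le_mul_of_nonneg_right hXsq hQ))
      _ = (1 + X) * √Q := by rw [Real.sqrt_mul (sq_nonneg _), Real.sqrt_sq (by positivity)]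
  rw [div_le_iff₀' (by positivity)]
  refine ⟨key ?_ ht0', key ?_ hs0⟩
  · calc k.form (σ z) _ _ ≤ C * _ := hk2
      _ ≤ C * (C * g₀) := by gcongr
      _ ≤ C * (C * (δ * W.ratio α N * g₀)) := by
        gcongr
        exact le_mul_of_one_le_left hg0 hl2'
      _ = C * C * δ * (W.ratio α N * g₀) := by ring
      _ ≤ C * C * δ * (C * _) := by gcongr
      _ ≤ C * C * δ * (C * (C * _)) := by gcongr
      _ = X * _ := by rw [hX]; ring
  · calc k.form (τ z) _ _ ≤ C * _ := hk4
      _ ≤ C * (C * (W.ratio α N * g₀)) := by gcongr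
      _ ≤ C * (C * (δ * g₀)) := by gcongr
      _ ≤ C * (C * (δ * (C * _))) := by gcongr
      _ ≤ C * (C * (δ * (C * (C * _)))) := by gcongr
      _ = X * _ := by rw [hX]; ring

end TransverseSimilarity

/-! ### Flat structures -/

namespace TransverseSimilarity

open Foliation

variable {n p q : ℕ} {M : Type*} [TopologicalSpace M] [ChartedSpace (Euc n) M]
  [IsManifold (𝓡 n) ∞ M] {F : Foliation n p q M} {ι : Type*} {S : TransverseSimilarity F ι}

/-- An isometry from an open subset of the central transversal of a foliated box to the Euclidean
space. -/
structure FlatBox (S : TransverseSimilarity F ι) where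
  box : FoliatedBox S
  domain : Set (Euc q)
  toFun : Euc q → Euc q
  isometry : IsHomothetyOn box.metric domain (euclideanForm q) univ toFun 1

namespace FlatBox

variable (T : FlatBox S)

/-- The open set where the submersion of a flat box is defined. -/
def region : Set M := T.box.region 3 ∩ transverseCoord T.box.chart ⁻¹' T.domain

/-- The submersion to the Euclidean space defined by a flat box. -/
def submersion : M → Euc q := T.toFun ∘ transverseCoord T.box.chart

lemma isOpen_region : IsOpen T.region := by
  have h : T.region = T.box.region 3 ∩ (T.box.chart.source ∩
      T.box.chart ⁻¹' (Prod.snd ⁻¹' T.domain)) := by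
    ext y
    exact ⟨fun h => ⟨h.1, h.1.1, h.2⟩, fun h => ⟨h.1, h.2.2⟩⟩
  rw [h]
  exact (T.box.isOpen_region 3).inter
    (T.box.chart.isOpen_inter_preimage (T.isometry.source.isOpen.preimage continuous_snd))

lemma contMDiffAt_submersion {y : M} (hy : y ∈ T.region) :
    ContMDiffAt (𝓡 n) 𝓘(ℝ, Euc q) ∞ T.submersion y :=
  ContMDiffAt.comp y (contMDiffAt_iff_contDiffAt.2 (T.isometry.contDiffAt hy.2))
    (contMDiffAt_transverseCoord T.box.mem_atlas hy.1.1)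

lemma mfderiv_submersion {y : M} (hy : y ∈ T.region) (v : TangentSpace (𝓡 n) y) :
    (mfderiv (𝓡 n) 𝓘(ℝ, Euc q) T.submersion y v : Euc q) =
      fderiv ℝ T.toFun (transverseCoord T.box.chart y) (transverseDeriv T.box.chart y v) := by
  have h1 : MDifferentiableAt 𝓘(ℝ, Euc q) 𝓘(ℝ, Euc q) T.toFun (transverseCoord T.box.chart y) :=
    ((T.isometry.contDiffAt hy.2).differentiableAt (by simp)).mdifferentiableAt
  have h2 := mfderiv_comp_apply y h1
    (mdifferentiableAt_transverseCoord T.box.mem_atlas hy.1.1) v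
  rw [mfderiv_eq_fderiv] at h2
  exact h2

lemma surjective_mfderiv_submersion {y : M} (hy : y ∈ T.region) :
    Function.Surjective (mfderiv (𝓡 n) 𝓘(ℝ, Euc q) T.submersion y) := by
  intro w
  obtain ⟨u, hu⟩ := T.isometry.surjective hy.2 w
  have ht : ((T.box.chart y).1, (T.box.chart y).2) ∈ T.box.chart.target :=
    T.box.chart.map_source hy.1.1
  have h1 := transverseDeriv_coordSlice T.box.mem_atlas ht u
  have h2 : coordSlice T.box.chart (T.box.chart y).1 (T.box.chart y).2 = y :=
    T.box.chart.left_inv hy.1.1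
  rw [h2] at h1
  exact ⟨_, (T.mfderiv_submersion hy _).trans ((congrArg _ h1).trans hu)⟩

lemma ker_mfderiv_submersion {y : M} (hy : y ∈ T.region) :
    LinearMap.ker (mfderiv (𝓡 n) 𝓘(ℝ, Euc q) T.submersion y).toLinearMap = F.leafTangent y := by
  rw [leafTangent_eq T.box.mem_atlas hy.1.1]
  ext v
  rw [LinearMap.mem_ker, LinearMap.mem_ker]
  have h1 := T.mfderiv_submersion hy v
  constructor
  · intro h
    exact T.isometry.injective hy.2 ((h1.symm.trans h).trans (map_zero _).symm)
  · intro h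
    refine h1.trans ?_
    have h2 : transverseDeriv T.box.chart y v = 0 := h
    rw [h2, map_zero]
    rfl

lemma form_eq (hS : S.HolonomyInvariant) {y : M} (hy : y ∈ T.region) (u v : TangentSpace (𝓡 n) y) :
    (S.g T.box.index).form y u v =
      inner ℝ (E := Euc q) (mfderiv (𝓡 n) 𝓘(ℝ, Euc q) T.submersion y u)
        (mfderiv (𝓡 n) 𝓘(ℝ, Euc q) T.submersion y v) := by
  rw [T.box.form_eq hS hy.1, T.isometry.eq _ hy.2, one_mul, euclideanForm_apply]
  exact congrArg₂ (fun a b : Euc q => inner ℝ a b) (T.mfderiv_submersion hy u).symm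
    (T.mfderiv_submersion hy v).symm

/-- The submersions of two flat boxes differ locally by a similarity. -/
lemma exists_similarity (T' : FlatBox S) (hS : S.HolonomyInvariant) {x : M} (hx : x ∈ T.region)
    (hx' : x ∈ T'.region) : ∃ s : Euc q → Euc q, IsEuclideanSimilarity s ∧
      ∀ᶠ y in 𝓝 x, T'.submersion y = s (T.submersion y) := by
  set φ := T.box.chart with hφ
  set a := (φ x).1 with ha
  have hev := eventually_transverseCoord_eq T.box.mem_atlas T'.box.mem_atlas hx.1.1 hx'.1.1
  set h := transverseCoord T'.box.chart ∘ coordSlice φ a with hh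
  set D : Set (Euc q) := {b | (a, b) ∈ φ.target ∩ φ.symm ⁻¹' (T.region ∩ T'.region)} with hD
  have hDo : IsOpen D := (φ.symm.isOpen_inter_preimage
    (T.isOpen_region.inter T'.isOpen_region)).preimage (by fun_prop)
  have hxD : transverseCoord φ x ∈ D := by
    have h1 : φ.symm (a, transverseCoord φ x) = x := φ.left_inv hx.1.1
    exact ⟨φ.map_source hx.1.1, by rw [mem_preimage, h1]; exact ⟨hx, hx'⟩⟩
  have hDb : ∀ b ∈ D, b ∈ Metric.ball T.box.b₀ (3 * T.box.ρ) ∧ b ∈ T.domain := by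
    intro b hb
    have h1 : coordSlice φ a b ∈ T.region := hb.2.1
    have h2 := transverseCoord_coordSlice hb.1
    have h3 := h1.1.2.2
    have h4 := h1.2
    rw [mem_preimage, h2] at h4
    refine ⟨?_, h4⟩
    rw [← h2]
    exact h3
  have hΩ := T.box.isRiemannianOn_metric.mono (fun b hb => (hDb b hb).1) hDo
  obtain ⟨c, hc, hcj⟩ := S.compatible T.box.index T'.box.index
  have hH := T'.box.isHomothetyOn hS T.box.mem_atlas (a := a) hc hcj hΩ
    (fun b hb => (T.box.restrict_eq_metric hS hx.1.2.1 (hDb b hb).1).symm)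
    (fun b hb => ⟨hb.1, T.box.mem_U hb.2.1.1, hb.2.2.1⟩)
  obtain ⟨s, hs, hse⟩ := (T.isometry.mono (fun b hb => (hDb b hb).2) hDo).exists_similarity
    (T'.isometry.comp hH fun b hb => hb.2.2.2) hxD
  refine ⟨s, hs, ?_⟩
  have hP : ContinuousAt (transverseCoord φ) x := continuousAt_snd.comp (φ.continuousAt hx.1.1)
  filter_upwards [hev, hP.eventually hse] with y h1 h2
  rw [submersion, Function.comp_apply, h1]
  exact h2

end FlatBox

lemma exists_flatBox (hS : S.HolonomyInvariant) (h : ∀ x u v w, S.curvature x u v w = 0) (x : M) :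
    ∃ T : FlatBox S, x ∈ T.region := by
  obtain ⟨B, hB⟩ := FoliatedBox.exists_mem_region_one S x
  have hx := B.region_mono (show (1 : ℝ) ≤ 3 by norm_num) hB
  have hR : ∀ b ∈ Metric.ball B.b₀ (3 * B.ρ), riemannCLM B.metric b = 0 := by
    intro b hb
    obtain ⟨ht, hy⟩ := B.coordSlice_mem_region le_rfl B.center_mem hb
    obtain ⟨L, hL, hLe⟩ := B.exists_curvature_eq hS hy
    rw [transverseCoord_coordSlice ht] at hLe
    ext1 u
    ext1 v
    ext1 w
    obtain ⟨u, rfl⟩ := hL.surjective u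
    obtain ⟨v, rfl⟩ := hL.surjective v
    obtain ⟨w, rfl⟩ := hL.surjective w
    rw [hLe, h, map_zero]
    rfl
  obtain ⟨ε, hε, f, hf⟩ := B.isRiemannianOn_metric.exists_isometry hR hx.2.2
  exact ⟨⟨B, _, f, hf⟩, hx, Metric.mem_ball_self hε⟩

/-- A structure with vanishing transverse curvature is modelled on the similarities of the Euclidean
space: the transversals are locally isometric to the Euclidean space. -/
theorem isModelledOnSim (hS : S.HolonomyInvariant) (h : ∀ x u v w, S.curvature x u v w = 0) :
    S.IsModelledOnSim := by
  refine ⟨range fun T : FlatBox S => (T.region, T.submersion), fun x => ?_, ?_, ?_, ?_⟩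
  · obtain ⟨T, hT⟩ := exists_flatBox hS h x
    exact ⟨_, mem_range_self T, hT⟩
  · rintro _ ⟨T, rfl⟩
    exact ⟨T.isOpen_region, fun y hy => (T.contMDiffAt_submersion hy).contMDiffWithinAt,
      fun y hy => ⟨T.surjective_mfderiv_submersion hy, T.ker_mfderiv_submersion hy⟩⟩
  · rintro _ ⟨T, rfl⟩ _ ⟨T', rfl⟩ x ⟨hx, hx'⟩
    exact T.exists_similarity T' hS hx hx'
  · rintro _ ⟨T, rfl⟩ i x ⟨hx, hxi⟩
    obtain ⟨r, hr, hrj⟩ := S.compatible i T.box.index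
    refine ⟨r, hr, ?_⟩
    filter_upwards [(T.isOpen_region.inter (S.isOpen i)).mem_nhds ⟨hx, hxi⟩] with y hy u v
    rw [hrj y ⟨hy.2, T.box.mem_U hy.1.1⟩, ← T.form_eq hS hy.1]
    rfl

end TransverseSimilarity

theorem mainTheorem9 {n p q : ℕ} {M : Type*} [TopologicalSpace M] [T2Space M] [CompactSpace M]
    [ConnectedSpace M] [ChartedSpace (Euc n) M] [IsManifold (𝓡 n) ∞ M]
    (F : Foliation n p q M) {ι : Type*} (S : TransverseSimilarity F ι)
    (hS : S.HolonomyInvariant) (k : F.TransverseMetric univ) :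
    (∀ g : F.TransverseMetric univ, S.IsAdapted g →
      {x : M | S.curvatureNorm g x ≠ 0} ⊆ F.biEquicontinuityDomain k) ∧
    (F.biEquicontinuityDomain k = ∅ → S.IsTransverselyFlat) := by
  refine ⟨fun g _ x hx => TransverseSimilarity.mem_biEquicontinuityDomain hS k
    (TransverseSimilarity.exists_curvature_ne_zero g hx), fun hk => ?_⟩
  have hflat : ∀ x u v w, S.curvature x u v w = 0 := by
    intro x u v w
    by_contra h
    have hx := TransverseSimilarity.mem_biEquicontinuityDomain hS k ⟨u, v, w, h⟩
    rw [hk] at hx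
    exact hx
  exact ⟨hflat, TransverseSimilarity.isModelledOnSim hS hflat⟩
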